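/- Let $n$ be a positive integer and let $w_1,\dots,w_n$ be positive integer weights for the variables $x_1,\dots,x_n$. Let $\mathbb C\{\boldsymbol x\}=\mathbb C\{x_1,\dots,x_n\}$ be the $\mathbb C$-algebra of power series that converge absolutely in a neighbourhood of the origin of $\mathbb C^n$. The weight of the monomial $x_1^{d_1}\cdots x_n^{d_n}$ is $w_1d_1+\dots+w_nd_n$, the weight $\operatorname{wt} g$ of a non-zero $g\in\mathbb C\{\boldsymbol x\}$ is the least weight of a monomial with non-zero coefficient in $g$, and $\operatorname{wt} 0=\infty$. Let $f\in\mathbb C\{\boldsymbol x\}$ define an isolated singularity at the origin, that is, $f(\boldsymbol 0)=0$ and there is a neighbourhood of $\boldsymbol 0$ in which no point $z\neq\boldsymbol 0$ satisfies $f(z)=\frac{\partial f}{\partial x_1}(z)=\dots=\frac{\partial f}{\partial x_n}(z)=0$. Let $f_0$ be the least weight non-zero quasihomogeneous part of $f$, let $j(f_0)=(\partial f_0/\partial x_1,\dots,\partial f_0/\partial x_n)\subseteq\mathbb C\{\boldsymbol x\}$ be its Jacobian ideal, and let $S\subseteq\mathbb C[\boldsymbol x]$ be a set of monomials that is a monomial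 spanning set for the Milnor algebra $\mathbb C\{\boldsymbol x\}/j(f_0)$ of $f_0$, in the following sense: the class of every polynomial in $\mathbb C\{\boldsymbol x\}/j(f_0)$ is a finite $\mathbb C$-linear combination of classes of elements of $S$. (This holds in particular whenever the classes of the elements of $S$ span the vector space $\mathbb C\{\boldsymbol x\}/j(f_0)$.) Then there exist a $\mathbb C$-algebra automorphism $\Psi$ of $\mathbb C\{\boldsymbol x\}$ and $g_1,\dots,g_n\in\mathbb C\{\boldsymbol x\}$ such that, for all $i$, $\Psi(x_i)=x_i+g_i$ and either $g_i=0$ or $\operatorname{wt} g_i>\operatorname{wt} x_i$, and such that every monomial of weight greater than $\operatorname{wt} f_0$ that does not belong to $S$ has coefficient zero in $\Psi(f)$. -/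

import Mathlib

open Filter Topology

noncomputable section

namespace ConvergentSeries

/-- The value at `z` of the term of exponent `d` of the power series `f`. -/
def term {n : ℕ} (f : MvPowerSeries (Fin n) ℂ) (z : Fin n → ℂ) (d : Fin n →₀ ℕ) : ℂ :=
  MvPowerSeries.coeff d f * ∏ i, z i ^ d i

/-- Absolute convergence in a neighbourhood of the origin of `ℂⁿ`. -/
def IsConvergent {n : ℕ} (f : MvPowerSeries (Fin n) ℂ) : Prop :=
  ∀ᶠ z in 𝓝 (0 : Fin n → ℂ), Summable fun d => ‖term f z d‖

lemma IsConvergent.of_finite {n : ℕ} {f : MvPowerSeries (Fin n) ℂ}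
    (s : Finset (Fin n →₀ ℕ)) (h : ∀ d ∉ s, MvPowerSeries.coeff d f = 0) : IsConvergent f :=
  Eventually.of_forall fun z =>
    summable_of_ne_finset_zero (s := s) fun d hd => by simp [term, h d hd]

lemma IsConvergent.mono {n : ℕ} {f g : MvPowerSeries (Fin n) ℂ} (hf : IsConvergent f)
    (h : ∀ d, ‖MvPowerSeries.coeff d g‖ ≤ ‖MvPowerSeries.coeff d f‖) : IsConvergent g := by
  filter_upwards [hf] with z hz
  refine Summable.of_nonneg_of_le (fun _ => norm_nonneg _) (fun d => ?_) hz
  simp only [term, norm_mul]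
  exact mul_le_mul_of_nonneg_right (h d) (norm_nonneg _)

lemma IsConvergent.add {n : ℕ} {f g : MvPowerSeries (Fin n) ℂ} (hf : IsConvergent f)
    (hg : IsConvergent g) : IsConvergent (f + g) := by
  filter_upwards [hf, hg] with z hz hz'
  refine Summable.of_nonneg_of_le (fun _ => norm_nonneg _) (fun d => ?_) (hz.add hz')
  simp only [term, map_add, add_mul]
  exact norm_add_le _ _

lemma term_mul_term {n : ℕ} (f g : MvPowerSeries (Fin n) ℂ) (z : Fin n → ℂ)
    (a b : Fin n →₀ ℕ) : term f z a * term g z b =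
      MvPowerSeries.coeff a f * MvPowerSeries.coeff b g * ∏ i, z i ^ (a + b) i := by
  simp only [term, Finsupp.add_apply, pow_add, Finset.prod_mul_distrib]
  ring

lemma term_mul {n : ℕ} (f g : MvPowerSeries (Fin n) ℂ) (z : Fin n → ℂ) (d : Fin n →₀ ℕ) :
    term (f * g) z d =
      ∑ p ∈ Finset.HasAntidiagonal.antidiagonal d, term f z p.1 * term g z p.2 := by
  rw [term, MvPowerSeries.coeff_mul, Finset.sum_mul]
  refine Finset.sum_congr rfl fun p hp => ?_
  rw [term_mul_term, Finset.HasAntidiagonal.mem_antidiagonal.mp hp]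

lemma summable_term_mul {n : ℕ} (f g : MvPowerSeries (Fin n) ℂ) (z : Fin n → ℂ)
    (hf : Summable fun d => ‖term f z d‖) (hg : Summable fun d => ‖term g z d‖) :
    Summable fun d => ‖term (f * g) z d‖ := by
  have h1 : Summable fun p : (Fin n →₀ ℕ) × (Fin n →₀ ℕ) => ‖term f z p.1‖ * ‖term g z p.2‖ :=
    Summable.mul_of_nonneg (f := fun d => ‖term f z d‖) (g := fun d => ‖term g z d‖) hf hg
      (fun _ => norm_nonneg _) (fun _ => norm_nonneg _)
  have key := summable_sum_mul_antidiagonal_of_summable_mul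
    (f := fun d => ‖term f z d‖) (g := fun d => ‖term g z d‖) h1
  refine Summable.of_nonneg_of_le (fun _ => norm_nonneg _) (fun d => ?_) key
  rw [term_mul]
  refine (norm_sum_le _ _).trans (Finset.sum_le_sum fun p _ => ?_)
  rw [norm_mul]

lemma IsConvergent.mul {n : ℕ} {f g : MvPowerSeries (Fin n) ℂ} (hf : IsConvergent f)
    (hg : IsConvergent g) : IsConvergent (f * g) := by
  filter_upwards [hf, hg] with z hz hz'
  exact summable_term_mul f g z hz hz'

lemma IsConvergent.exists_radius {n : ℕ} {f : MvPowerSeries (Fin n) ℂ} (hf : IsConvergent f) :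
    ∃ r : ℝ, 0 < r ∧ Summable fun d : Fin n →₀ ℕ =>
      ‖MvPowerSeries.coeff d f‖ * ∏ i, r ^ d i := by
  obtain ⟨ε, hε, h⟩ := Metric.eventually_nhds_iff.mp hf
  refine ⟨ε / 2, by positivity, ?_⟩
  have := h (y := fun _ => ((ε / 2 : ℝ) : ℂ)) (by
    rw [dist_pi_lt_iff hε]
    intro i
    rw [Pi.zero_apply, dist_zero_right, Complex.norm_real, Real.norm_of_nonneg (by positivity)]
    linarith)
  refine this.congr fun d => ?_
  simp only [term, norm_mul, norm_prod, norm_pow, Complex.norm_real]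
  rw [Real.norm_of_nonneg (by positivity : 0 ≤ ε / 2)]

lemma IsConvergent.pderiv {n : ℕ} {f : MvPowerSeries (Fin n) ℂ} (hf : IsConvergent f)
    (i : Fin n) : IsConvergent (MvPowerSeries.pderiv ℂ i f) := by
  classical
  obtain ⟨r, hr, hs⟩ := hf.exists_radius
  have hs' : Summable fun d : Fin n →₀ ℕ => r⁻¹ * (‖MvPowerSeries.coeff
      (d + Finsupp.single i 1) f‖ * ∏ j, r ^ (d + Finsupp.single i 1 : Fin n →₀ ℕ) j) :=
    (hs.comp_injective (add_left_injective (Finsupp.single i 1))).mul_left _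
  refine Metric.eventually_nhds_iff.mpr ⟨r / 2, by positivity, fun z hz => ?_⟩
  refine Summable.of_nonneg_of_le (fun _ => norm_nonneg _) (fun d => ?_) hs'
  rw [dist_pi_lt_iff (by positivity)] at hz
  have hprod : ∏ j, r ^ (d + Finsupp.single i 1 : Fin n →₀ ℕ) j = (∏ j, r ^ d j) * r := by
    simp only [Finsupp.add_apply, pow_add, Finset.prod_mul_distrib]
    congr 1
    rw [Finset.prod_eq_single i]
    · simp
    · intro j _ hj
      simp [hj.symm]
    · simp
  have h1 : ((d i : ℝ) + 1) ≤ ∏ j, (2 : ℝ) ^ d j := by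
    calc ((d i : ℝ) + 1) ≤ 2 ^ d i := by exact_mod_cast Nat.lt_two_pow_self (n := d i)
      _ ≤ 2 ^ d i * ∏ j ∈ Finset.univ.erase i, (2 : ℝ) ^ d j :=
        le_mul_of_one_le_right (by positivity)
          (Finset.one_le_prod fun j _ => one_le_pow₀ (by norm_num))
      _ = ∏ j, (2 : ℝ) ^ d j := Finset.mul_prod_erase _ (fun j => (2 : ℝ) ^ d j) (Finset.mem_univ i)
  have h2 : ∏ j, ‖z j‖ ^ d j ≤ ∏ j, (r / 2) ^ d j := by
    refine Finset.prod_le_prod (fun j _ => by positivity) fun j _ => ?_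
    have := hz j
    rw [Pi.zero_apply, dist_zero_right] at this
    exact pow_le_pow_left₀ (norm_nonneg _) this.le _
  have h3 : (∏ j, (2 : ℝ) ^ d j) * ∏ j, (r / 2) ^ d j = ∏ j, r ^ d j := by
    rw [← Finset.prod_mul_distrib]
    refine Finset.prod_congr rfl fun j _ => ?_
    rw [← mul_pow]
    congr 1
    ring
  have h4 : ‖((d i : ℂ) + 1)‖ = (d i : ℝ) + 1 := by
    have : ((d i : ℂ) + 1) = (((d i : ℝ) + 1 : ℝ) : ℂ) := by push_cast; ring
    rw [this, Complex.norm_real, Real.norm_of_nonneg (by positivity)]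
  rw [hprod]
  simp only [term, MvPowerSeries.coeff_pderiv, norm_mul, norm_prod, norm_pow, h4]
  calc _ = ‖MvPowerSeries.coeff (d + Finsupp.single i 1) f‖ *
        (((d i : ℝ) + 1) * ∏ j, ‖z j‖ ^ d j) := by ring
    _ ≤ ‖MvPowerSeries.coeff (d + Finsupp.single i 1) f‖ * ∏ j, r ^ d j := by
        refine mul_le_mul_of_nonneg_left ?_ (norm_nonneg _)
        rw [← h3]
        exact mul_le_mul h1 h2 (by positivity) (by positivity)
    _ = _ := by field_simp

end ConvergentSeries

open ConvergentSeries

/-- The `ℂ`-algebra `ℂ{x₁, …, xₙ}` of power series that are absolutely convergent in a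
neighbourhood of the origin. -/
def ConvSeries (n : ℕ) : Subalgebra ℂ (MvPowerSeries (Fin n) ℂ) where
  carrier := {f | IsConvergent f}
  mul_mem' := IsConvergent.mul
  add_mem' := IsConvergent.add
  algebraMap_mem' c := IsConvergent.of_finite {0} fun d hd => by
    classical
    rw [MvPowerSeries.algebraMap_apply, MvPowerSeries.coeff_C, if_neg (by simpa using hd)]

namespace ConvSeries

/-- The coefficient of the monomial of exponent `d` in `f`. -/
def coeff {n : ℕ} (d : Fin n →₀ ℕ) (f : ConvSeries n) : ℂ :=
  MvPowerSeries.coeff d (f : MvPowerSeries (Fin n) ℂ)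

/-- The value at `z` of a convergent power series, for `z` close to the origin. -/
def eval {n : ℕ} (f : ConvSeries n) (z : Fin n → ℂ) : ℂ :=
  ∑' d, term (f : MvPowerSeries (Fin n) ℂ) z d

/-- The monomial of exponent `d`. -/
def mono {n : ℕ} (d : Fin n →₀ ℕ) : ConvSeries n :=
  ⟨MvPowerSeries.monomial d 1, IsConvergent.of_finite {d} fun e he => by
    classical
    rw [MvPowerSeries.coeff_monomial, if_neg (by simpa using he)]⟩

/-- The variable `xᵢ`. -/
def X {n : ℕ} (i : Fin n) : ConvSeries n :=
  mono (Finsupp.single i 1)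

/-- The partial derivative `∂f/∂xᵢ`. -/
def partialDeriv {n : ℕ} (i : Fin n) (f : ConvSeries n) : ConvSeries n :=
  ⟨MvPowerSeries.pderiv ℂ i (f : MvPowerSeries (Fin n) ℂ), IsConvergent.pderiv f.2 i⟩

/-- The weight `wt f`, the least weight of a monomial with non-zero coefficient; `wt 0 = ⊤`. -/
def wt {n : ℕ} (w : Fin n → ℕ) (f : ConvSeries n) : ℕ∞ :=
  MvPowerSeries.weightedOrder w (f : MvPowerSeries (Fin n) ℂ)

/-- The quasihomogeneous weight `d` part of `f`. -/
def quasihomogeneousPart {n : ℕ} (w : Fin n → ℕ) (d : ℕ) (f : ConvSeries n) : ConvSeries n :=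
  ⟨MvPowerSeries.weightedHomogeneousComponent w d (f : MvPowerSeries (Fin n) ℂ),
    IsConvergent.mono f.2 fun e => by
      classical
      rw [MvPowerSeries.coeff_weightedHomogeneousComponent]
      split_ifs <;> simp⟩

/-- The least weight non-zero quasihomogeneous part of a non-zero `f`. -/
def initialPart {n : ℕ} (w : Fin n → ℕ) (f : ConvSeries n) : ConvSeries n :=
  quasihomogeneousPart w (wt w f).toNat f

/-- The Jacobian ideal `j(f)`. -/
def jacobianIdeal {n : ℕ} (f : ConvSeries n) : Ideal (ConvSeries n) :=
  Ideal.span (Set.range fun i => partialDeriv i f)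

/-- The Milnor algebra `ℂ{x} / j(f)`. -/
abbrev MilnorAlgebra {n : ℕ} (f : ConvSeries n) : Type :=
  ConvSeries n ⧸ jacobianIdeal f

/-- The class of the monomial of exponent `d` in the Milnor algebra of `f`. -/
def monoClass {n : ℕ} (f : ConvSeries n) (d : Fin n →₀ ℕ) : MilnorAlgebra f :=
  Ideal.Quotient.mk (jacobianIdeal f) (mono d)

/-- A set `S` of monomials, given by their exponents, is a monomial spanning set for the Milnor
algebra of `f` if the class of every monomial, hence of every polynomial, is a finite `ℂ`-linear
combination of classes of elements of `S`. This holds as soon as the classes of the elements of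
`S` span the Milnor algebra (`IsMonomialSpanningSet.of_span_eq_top`), and is equivalent to that
when the Milnor algebra is finite-dimensional. When the Milnor algebra is infinite-dimensional,
no set of monomials spans all of it by finite linear combinations (its dimension is uncountable),
and the condition is then that `S` spans the classes of polynomials. -/
def IsMonomialSpanningSet {n : ℕ} (f : ConvSeries n) (S : Set (Fin n →₀ ℕ)) : Prop :=
  ∀ d, monoClass f d ∈ Submodule.span ℂ (monoClass f '' S)

lemma IsMonomialSpanningSet.of_span_eq_top {n : ℕ} {f : ConvSeries n} {S : Set (Fin n →₀ ℕ)}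
    (h : Submodule.span ℂ (monoClass f '' S) = ⊤) : IsMonomialSpanningSet f S :=
  fun _ => h ▸ Submodule.mem_top

/-- `f` defines an isolated singularity at the origin: the origin lies on the hypersurface germ
`f = 0`, and all other points of this germ near the origin are non-singular, that is, some
partial derivative of `f` does not vanish there. -/
def DefinesIsolatedSingularity {n : ℕ} (f : ConvSeries n) : Prop :=
  eval f 0 = 0 ∧
    ∀ᶠ z in 𝓝[≠] (0 : Fin n → ℂ), eval f z = 0 → ∃ i, eval (partialDeriv i f) z ≠ 0

end ConvSeries

end

/-! The proof has two halves. The analytic half, `exists_X_pow_mem_jacobianIdeal`, shows that an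
isolated singularity has a Jacobian ideal containing a power of every variable. The formal half,
`exists_normal_form`, uses only this consequence.

For the analytic half, suppose that `j(f)` contains no power of the ideal of the origin. Choose an
ideal `Q ⊇ j(f)` maximal with this property. It is prime, and every `y ∉ Q` is a parameter of `D =
ℂ{x}/Q`: modulo `Q`, powers of all variables are multiples of `y`. By a division with estimates
(`exists_expansion`), `D` is then finite over `ℂ{t}`, with `t ↦ y`. If `f ∉ Q`, take `y = f`. The
derivation `d/dt` extends to `Frac D`. Subtracting its chain rule expression in the `∂ᵢ` gives a
derivation on `ℂ{x}` that kills polynomials but sends `f` to `1`, since all `∂ᵢf` vanish in `D`.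
Approximating `f` by polynomials puts a common denominator in arbitrarily high powers of the maximal
ideal, which is absurd (`exists_map_partialDeriv_ne_zero`). Hence `f ∈ Q`. Now take as `y` a
variable outside `Q`. The same division holds on small polydiscs with fixed radii, so evaluation at
a small `t ≠ 0` extends to a character of the algebra of a polydisc that kills the elements of `Q`
in that algebra. Such a character is evaluation at a point `ξ` (`exists_eval_eq_character`), and `ξ
≠ 0`. Thus `f` and all `∂ᵢf` vanish at points arbitrarily close to the origin and different from it,
a contradiction.

For the formal half, the substitution `x ↦ x - a` changes the weight `k` part of `f` by `-∑ aᵢ ∂ᵢf₀`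
when `aᵢ` has weight `wᵢ + k - wt f₀`, and does not change the lower parts. The spanning property of
`S` lets one choose `a` so that the weight `k` part is left supported on `S`; repeating this clears
all weights up to any bound. No condition on `f₀` is needed, and its Milnor algebra may be
infinite-dimensional. The remaining tail is removed by finite determinacy of `f` itself
(`exists_isUnipotent_apply_eq_add`): perturbations of high weight lie in `j(f)²`, and a fixed point
argument realises them by a convergent substitution. Throughout, limits are formed in the weight
filtration, and convergence is recovered from `ℓ¹` norms on polydiscs. -/

noncomputable section

open scoped ENNReal

/-! ### The `ℓ¹` norms on polydiscs. -/

namespace ConvergentSeries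

open MvPowerSeries

variable {σ τ : Type*}

/-- The `ℓ¹`-norm `∑ |f_d| ρ^d` of a power series on the polydisc of polyradius `ρ`. -/
def polyNorm [Fintype σ] (ρ : σ → ℝ≥0∞) (f : MvPowerSeries σ ℂ) : ℝ≥0∞ :=
  ∑' d, ‖coeff d f‖ₑ * ∏ i, ρ i ^ d i

section polyNorm

variable [Fintype σ] (ρ : σ → ℝ≥0∞)

lemma polyNorm_mono_radius {ρ ρ' : σ → ℝ≥0∞} (h : ∀ i, ρ i ≤ ρ' i) (f : MvPowerSeries σ ℂ) :
    polyNorm ρ f ≤ polyNorm ρ' f :=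
  ENNReal.tsum_le_tsum fun d => by gcongr with i; exact h i

lemma polyNorm_mono {f g : MvPowerSeries σ ℂ} (h : ∀ d, ‖coeff d f‖ₑ ≤ ‖coeff d g‖ₑ) :
    polyNorm ρ f ≤ polyNorm ρ g :=
  ENNReal.tsum_le_tsum fun d => by gcongr; exact h d

@[simp] lemma polyNorm_zero : polyNorm ρ 0 = 0 := by simp [polyNorm]

lemma polyNorm_neg (f : MvPowerSeries σ ℂ) : polyNorm ρ (-f) = polyNorm ρ f := by
  simp [polyNorm]

lemma polyNorm_add_le (f g : MvPowerSeries σ ℂ) :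
    polyNorm ρ (f + g) ≤ polyNorm ρ f + polyNorm ρ g := by
  rw [polyNorm, polyNorm, polyNorm, ← ENNReal.tsum_add]
  refine ENNReal.tsum_le_tsum fun d => ?_
  rw [← add_mul, map_add]
  gcongr
  exact enorm_add_le _ _

lemma polyNorm_sub_le (f g : MvPowerSeries σ ℂ) :
    polyNorm ρ (f - g) ≤ polyNorm ρ f + polyNorm ρ g := by
  rw [sub_eq_add_neg, ← polyNorm_neg ρ g]
  exact polyNorm_add_le ρ _ _

lemma polyNorm_sum_le {κ : Type*} (s : Finset κ) (f : κ → MvPowerSeries σ ℂ) :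
    polyNorm ρ (∑ k ∈ s, f k) ≤ ∑ k ∈ s, polyNorm ρ (f k) := by
  classical
  induction s using Finset.induction_on with
  | empty => simp
  | insert a s ha ih =>
    rw [Finset.sum_insert ha, Finset.sum_insert ha]
    exact (polyNorm_add_le _ _ _).trans (by gcongr)

lemma polyNorm_monomial (d : σ →₀ ℕ) (c : ℂ) :
    polyNorm ρ (monomial d c) = ‖c‖ₑ * ∏ i, ρ i ^ d i := by
  classical
  rw [polyNorm, tsum_eq_single d]
  · rw [coeff_monomial_same]
  · intro e he
    rw [coeff_monomial_ne he]
    simp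

lemma polyNorm_X (i : σ) : polyNorm ρ (X i) = ρ i := by
  classical
  rw [X, polyNorm_monomial, Finset.prod_eq_single i] <;> simp +contextual

lemma polyNorm_C (c : ℂ) : polyNorm ρ (C c) = ‖c‖ₑ := by
  rw [← monomial_zero_eq_C_apply, polyNorm_monomial]
  simp

lemma polyNorm_one : polyNorm ρ 1 = 1 := by
  rw [← map_one C, polyNorm_C, enorm_one]

lemma coeff_mul_le_polyNorm (f : MvPowerSeries σ ℂ) (d : σ →₀ ℕ) :
    ‖coeff d f‖ₑ * ∏ i, ρ i ^ d i ≤ polyNorm ρ f :=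
  ENNReal.le_tsum d

/-- Coefficients of a product are sums over antidiagonals, and regrouping all antidiagonals gives
the product of the two sums. With values in `ℝ≥0∞` no convergence is needed. -/
lemma polyNorm_mul_le (f g : MvPowerSeries σ ℂ) :
    polyNorm ρ (f * g) ≤ polyNorm ρ f * polyNorm ρ g := by
  classical
  calc polyNorm ρ (f * g)
      ≤ ∑' d : σ →₀ ℕ, ∑ p ∈ Finset.HasAntidiagonal.antidiagonal d,
          (‖coeff p.1 f‖ₑ * ∏ i, ρ i ^ p.1 i) * (‖coeff p.2 g‖ₑ * ∏ i, ρ i ^ p.2 i) := by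
        refine ENNReal.tsum_le_tsum fun d => ?_
        rw [coeff_mul]
        refine (mul_le_mul_left (enorm_sum_le _ _) _).trans ?_
        rw [Finset.sum_mul]
        refine Finset.sum_le_sum fun p hp => le_of_eq ?_
        rw [← Finset.HasAntidiagonal.mem_antidiagonal.mp hp]
        simp only [Finsupp.add_apply, pow_add, Finset.prod_mul_distrib, enorm_mul]
        ring
    _ = ∑' p : (σ →₀ ℕ) × (σ →₀ ℕ),
          (‖coeff p.1 f‖ₑ * ∏ i, ρ i ^ p.1 i) * (‖coeff p.2 g‖ₑ * ∏ i, ρ i ^ p.2 i) := by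
        rw [← Finset.HasAntidiagonal.sigmaAntidiagonalEquivProd.tsum_eq, ENNReal.tsum_sigma']
        refine tsum_congr fun d => ?_
        rw [tsum_fintype, ← Finset.sum_coe_sort]
        rfl
    _ = polyNorm ρ f * polyNorm ρ g := by
        rw [ENNReal.tsum_prod']
        simp only [ENNReal.tsum_mul_left, ENNReal.tsum_mul_right]
        rfl

lemma polyNorm_pow_le (f : MvPowerSeries σ ℂ) (k : ℕ) :
    polyNorm ρ (f ^ k) ≤ polyNorm ρ f ^ k := by
  induction k with
  | zero => simp [polyNorm_one]
  | succ k ih =>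
    rw [pow_succ, pow_succ]
    exact (polyNorm_mul_le _ _ _).trans (by gcongr)

lemma polyNorm_prod_le {κ : Type*} (s : Finset κ) (f : κ → MvPowerSeries σ ℂ) :
    polyNorm ρ (∏ k ∈ s, f k) ≤ ∏ k ∈ s, polyNorm ρ (f k) := by
  classical
  induction s using Finset.induction_on with
  | empty => simp [polyNorm_one]
  | insert a s ha ih =>
    rw [Finset.prod_insert ha, Finset.prod_insert ha]
    exact (polyNorm_mul_le _ _ _).trans (by gcongr)

/-- A power series is bounded in norm as soon as it is a coefficientwise limit of series that
satisfy the bound. -/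
lemma polyNorm_le_of_forall_finset {f : MvPowerSeries σ ℂ} {c : ℝ≥0∞}
    (h : ∀ s : Finset (σ →₀ ℕ), ∃ g, polyNorm ρ g ≤ c ∧ ∀ d ∈ s, coeff d f = coeff d g) :
    polyNorm ρ f ≤ c := by
  rw [polyNorm, ENNReal.tsum_eq_iSup_sum]
  refine iSup_le fun s => ?_
  obtain ⟨g, hg, hs⟩ := h s
  refine le_trans ?_ hg
  rw [Finset.sum_congr rfl fun d hd => by rw [hs d hd]]
  exact ENNReal.sum_le_tsum s

end polyNorm

/-! ### The weight filtration. -/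

/-- The ideal of power series all of whose monomials have weight at least `N`. -/
def weightIdeal (w : σ → ℕ) (N : ℕ) : Ideal (MvPowerSeries σ ℂ) where
  carrier := {f | ∀ d, Finsupp.weight w d < N → coeff d f = 0}
  add_mem' hf hg d hd := by rw [map_add, hf d hd, hg d hd, add_zero]
  zero_mem' _ _ := map_zero _
  smul_mem' a f hf d hd := by
    classical
    rw [smul_eq_mul, coeff_mul]
    refine Finset.sum_eq_zero fun p hp => ?_
    rw [hf p.2, mul_zero]
    rw [← Finset.HasAntidiagonal.mem_antidiagonal.mp hp, map_add] at hd
    omega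

section weightIdeal

variable (w : σ → ℕ)

variable {w} in
lemma le_weightedOrder_iff {N : ℕ} {f : MvPowerSeries σ ℂ} :
    (N : ℕ∞) ≤ weightedOrder w f ↔ f ∈ weightIdeal w N :=
  ⟨fun h d hd => coeff_eq_zero_of_lt_weightedOrder w (lt_of_lt_of_le (by exact_mod_cast hd) h),
    fun h => nat_le_weightedOrder w h⟩

lemma mem_weightIdeal_zero (f : MvPowerSeries σ ℂ) : f ∈ weightIdeal w 0 :=
  fun _ hd => absurd hd (Nat.not_lt_zero _)

lemma weightIdeal_antitone {M N : ℕ} (h : M ≤ N) : weightIdeal w N ≤ weightIdeal w M :=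
  fun _ hf d hd => hf d (hd.trans_le h)

variable {w} in
lemma mul_mem_weightIdeal {M N : ℕ} {f g : MvPowerSeries σ ℂ} (hf : f ∈ weightIdeal w M)
    (hg : g ∈ weightIdeal w N) : f * g ∈ weightIdeal w (M + N) := by
  classical
  intro d hd
  rw [coeff_mul]
  refine Finset.sum_eq_zero fun p hp => ?_
  rw [← Finset.HasAntidiagonal.mem_antidiagonal.mp hp, map_add] at hd
  rcases lt_or_ge (Finsupp.weight w p.1) M with h | h
  · rw [hf p.1 h, zero_mul]
  · rw [hg p.2 (by omega), mul_zero]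

variable {w} in
lemma pow_mem_weightIdeal {M : ℕ} {f : MvPowerSeries σ ℂ} (hf : f ∈ weightIdeal w M) (k : ℕ) :
    f ^ k ∈ weightIdeal w (k * M) := by
  induction k with
  | zero => rw [zero_mul]; exact mem_weightIdeal_zero w _
  | succ k ih => rw [pow_succ, Nat.succ_mul]; exact mul_mem_weightIdeal ih hf

lemma weight_single (i : σ) (k : ℕ) : Finsupp.weight w (Finsupp.single i k) = k * w i := by
  simp [Finsupp.weight_single]

lemma X_mem_weightIdeal (i : σ) : (X i : MvPowerSeries σ ℂ) ∈ weightIdeal w (w i) := by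
  classical
  intro d hd
  rw [coeff_X, if_neg]
  rintro rfl
  rw [weight_single] at hd
  omega

variable {w} in
lemma eq_zero_of_forall_mem_weightIdeal {f : MvPowerSeries σ ℂ}
    (h : ∀ N, f ∈ weightIdeal w N) : f = 0 := by
  ext d
  exact h _ d (Nat.lt_succ_self _)

variable {w} in
lemma constantCoeff_eq_zero_of_mem {N : ℕ} (hN : 0 < N) {f : MvPowerSeries σ ℂ}
    (hf : f ∈ weightIdeal w N) : constantCoeff f = 0 := by
  rw [← coeff_zero_eq_constantCoeff_apply]
  exact hf 0 (by simpa using hN)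

variable {w} in
lemma mem_weightIdeal_one_iff (hw : ∀ i, 0 < w i) {f : MvPowerSeries σ ℂ} :
    f ∈ weightIdeal w 1 ↔ constantCoeff f = 0 := by
  refine ⟨constantCoeff_eq_zero_of_mem one_pos, fun h d hd => ?_⟩
  have : d = 0 := by
    have h0 : Finsupp.weight w d = 0 := by omega
    ext i
    by_contra hi
    have := Finsupp.le_weight w (s := i) (hw i).ne' d
    simp_all
  rw [this, coeff_zero_eq_constantCoeff_apply, h]

/-- The series `x_i + g_i` are eligible for substitution when the `g_i` have positive weight. -/
lemma hasSubst_of_mem [Finite σ] {v : τ → ℕ} {u : σ → ℕ} (hu : ∀ i, 0 < u i)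
    {a : σ → MvPowerSeries τ ℂ} (ha : ∀ i, a i ∈ weightIdeal v (u i)) : HasSubst a :=
  hasSubst_of_constantCoeff_zero fun i => constantCoeff_eq_zero_of_mem (hu i) (ha i)

end weightIdeal

/-! ### Substitution: effect on weights and on norms. -/

section subst

variable {w : τ → ℕ} {v : σ → ℕ} {a b : σ → MvPowerSeries τ ℂ}

lemma prod_pow_mem_weightIdeal (ha : ∀ i, a i ∈ weightIdeal w (v i)) (d : σ →₀ ℕ) :
    (d.prod fun i k => a i ^ k) ∈ weightIdeal w (Finsupp.weight v d) := by
  classical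
  induction d using Finsupp.induction with
  | zero => simpa using mem_weightIdeal_zero w _
  | single_add i k d hi hk ih =>
    rw [Finsupp.prod_add_index' (by simp) (by simp [pow_add]), Finsupp.prod_single_index (by simp),
      map_add, weight_single]
    exact mul_mem_weightIdeal (pow_mem_weightIdeal (ha i) k) ih

lemma mul_sub_mul_mem_weightIdeal {M M' N : ℕ} {p p' q q' : MvPowerSeries τ ℂ}
    (hp : p ∈ weightIdeal w M) (hq' : q' ∈ weightIdeal w M')
    (hpp : p - p' ∈ weightIdeal w (M + N)) (hqq : q - q' ∈ weightIdeal w (M' + N)) :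
    p * q - p' * q' ∈ weightIdeal w (M + M' + N) := by
  have : p * q - p' * q' = p * (q - q') + (p - p') * q' := by ring
  rw [this]
  refine add_mem ?_ ?_
  · have := mul_mem_weightIdeal hp hqq
    rwa [← add_assoc] at this
  · have := mul_mem_weightIdeal hpp hq'
    rwa [add_right_comm] at this

/-- Replace one factor at a time: each replacement trades a factor of weight `v i` for a difference
of weight `v i + N`. -/
lemma prod_pow_sub_prod_pow_mem_weightIdeal {N : ℕ} (ha : ∀ i, a i ∈ weightIdeal w (v i))
    (hb : ∀ i, b i ∈ weightIdeal w (v i)) (hab : ∀ i, a i - b i ∈ weightIdeal w (v i + N))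
    (d : σ →₀ ℕ) :
    (d.prod fun i k => a i ^ k) - (d.prod fun i k => b i ^ k) ∈
      weightIdeal w (Finsupp.weight v d + N) := by
  classical
  have hpow : ∀ i k, a i ^ k - b i ^ k ∈ weightIdeal w (k * v i + N) := by
    intro i k
    induction k with
    | zero => simp
    | succ k ih =>
      rw [pow_succ, pow_succ, Nat.succ_mul]
      exact mul_sub_mul_mem_weightIdeal (pow_mem_weightIdeal (ha i) k) (hb i) ih (hab i)
  induction d using Finsupp.induction with
  | zero => simp
  | single_add i k d hi hk ih =>
    rw [Finsupp.prod_add_index' (by simp) (by simp [pow_add]), Finsupp.prod_single_index (by simp),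
      Finsupp.prod_add_index' (by simp) (by simp [pow_add]), Finsupp.prod_single_index (by simp),
      map_add, weight_single]
    exact mul_sub_mul_mem_weightIdeal (pow_mem_weightIdeal (ha i) k)
      (prod_pow_mem_weightIdeal hb d) (hpow i k) ih

lemma subst_mem_weightIdeal (hs : HasSubst a) (ha : ∀ i, a i ∈ weightIdeal w (v i)) {M : ℕ}
    {f : MvPowerSeries σ ℂ} (hf : f ∈ weightIdeal v M) : subst a f ∈ weightIdeal w M := by
  intro e he
  rw [coeff_subst hs]
  refine finsum_eq_zero_of_forall_eq_zero fun d => ?_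
  rcases lt_or_ge (Finsupp.weight v d) M with h | h
  · rw [hf d h, zero_smul]
  · rw [prod_pow_mem_weightIdeal ha d e (by omega), smul_zero]

/-- The Lipschitz estimate for substitution in the weight filtration; both fixed point arguments
take their contraction property from it. -/
lemma subst_sub_subst_mem_weightIdeal (hsa : HasSubst a) (hsb : HasSubst b) {M N : ℕ}
    (ha : ∀ i, a i ∈ weightIdeal w (v i)) (hb : ∀ i, b i ∈ weightIdeal w (v i))
    (hab : ∀ i, a i - b i ∈ weightIdeal w (v i + N)) {f : MvPowerSeries σ ℂ}
    (hf : f ∈ weightIdeal v M) : subst a f - subst b f ∈ weightIdeal w (M + N) := by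
  intro e he
  rw [map_sub, sub_eq_zero, coeff_subst hsa, coeff_subst hsb]
  refine finsum_congr fun d => ?_
  rcases lt_or_ge (Finsupp.weight v d) M with h | h
  · rw [hf d h, zero_smul, zero_smul]
  · have := prod_pow_sub_prod_pow_mem_weightIdeal ha hb hab d e (by omega)
    rw [map_sub, sub_eq_zero] at this
    rw [this]

/-- Expand, use the triangle inequality, exchange the two non-negative sums and apply
submultiplicativity to each monomial in the `a i`. -/
lemma polyNorm_subst_le [Fintype σ] [Fintype τ] (ρ : τ → ℝ≥0∞) (hs : HasSubst a) (f : MvPowerSeries σ ℂ) :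
    polyNorm ρ (subst a f) ≤ polyNorm (fun i => polyNorm ρ (a i)) f := by
  calc polyNorm ρ (subst a f)
      ≤ ∑' e, ∑' d, ‖coeff d f‖ₑ *
          (‖coeff e (d.prod fun i k => a i ^ k)‖ₑ * ∏ i, ρ i ^ e i) := by
        refine ENNReal.tsum_le_tsum fun e => ?_
        rw [coeff_subst hs, finsum_eq_sum _ (coeff_subst_finite hs f e)]
        refine (mul_le_mul_left (enorm_sum_le _ _) _).trans ?_
        rw [Finset.sum_mul]
        refine le_trans (le_of_eq ?_) (ENNReal.sum_le_tsum (coeff_subst_finite hs f e).toFinset)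
        refine Finset.sum_congr rfl fun d _ => ?_
        rw [smul_eq_mul, enorm_mul, mul_assoc]
    _ = ∑' d, ‖coeff d f‖ₑ * polyNorm ρ (d.prod fun i k => a i ^ k) := by
        rw [ENNReal.tsum_comm]
        simp only [ENNReal.tsum_mul_left]
        rfl
    _ ≤ _ := by
        refine ENNReal.tsum_le_tsum fun d => ?_
        gcongr
        rw [Finsupp.prod_fintype _ _ (by simp)]
        exact (polyNorm_prod_le _ _ _).trans
          (Finset.prod_le_prod' fun i _ => polyNorm_pow_le _ _ _)

end subst

end ConvergentSeries

/-! ### Monomial division, limits in the weight filtration, convergence on small polydiscs. -/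

namespace ConvergentSeries

open MvPowerSeries

variable {σ τ : Type*}

/-- Division by monomials: a series supported on the union of the translates `m k + ℕ^σ` is a
combination of the monomials `x ^ m k`, with coefficients among those of the series. -/
lemma exists_eq_sum_monomial_mul {κ : Type*} [Fintype κ] (m : κ → σ →₀ ℕ)
    (G : MvPowerSeries σ ℂ) (hG : ∀ d, coeff d G ≠ 0 → ∃ k, m k ≤ d) :
    ∃ H : κ → MvPowerSeries σ ℂ, G = ∑ k, monomial (m k) 1 * H k ∧
      ∀ k d, coeff d (H k) = 0 ∨ coeff d (H k) = coeff (d + m k) G := by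
  classical
  -- Each exponent is assigned to a single translate containing it. The pieces are then disjoint,
  -- which is why every coefficient of a quotient is zero or a coefficient of `G`.
  let sel : (σ →₀ ℕ) → Option κ := fun d => if h : ∃ k, m k ≤ d then some h.choose else none
  let H : κ → MvPowerSeries σ ℂ :=
    fun k d => if sel (d + m k) = some k then coeff (d + m k) G else 0
  have hH : ∀ k d, coeff d (H k) = if sel (d + m k) = some k then coeff (d + m k) G else 0 :=
    fun _ _ => rfl
  refine ⟨H, ?_, fun k d => ?_⟩
  · ext d
    rw [map_sum]
    simp only [coeff_monomial_mul, one_mul]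
    by_cases h : ∃ k, m k ≤ d
    · have hsel : sel d = some h.choose := dif_pos h
      rw [Finset.sum_eq_single h.choose]
      · rw [if_pos h.choose_spec, hH, tsub_add_cancel_of_le h.choose_spec, if_pos hsel]
      · intro k _ hk
        split_ifs with hkd
        · rw [hH, tsub_add_cancel_of_le hkd, if_neg]
          rw [hsel]
          exact fun h => hk (Option.some.inj h).symm
        · rfl
      · simp
    · rw [Finset.sum_eq_zero fun k _ => if_neg fun hk => h ⟨k, hk⟩]
      by_contra hne
      exact h (hG d hne)
  · rw [hH]
    split_ifs
    · exact Or.inr rfl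
    · exact Or.inl rfl

lemma mul_polyNorm_le_of_coeff [Fintype σ] (ρ : σ → ℝ≥0∞) {m : σ →₀ ℕ} {G H : MvPowerSeries σ ℂ}
    (h : ∀ d, coeff d H = 0 ∨ coeff d H = coeff (d + m) G) :
    (∏ i, ρ i ^ m i) * polyNorm ρ H ≤ polyNorm ρ G := by
  rw [polyNorm, ← ENNReal.tsum_mul_left]
  calc _ ≤ ∑' d, ‖coeff (d + m) G‖ₑ * ∏ i, ρ i ^ (d + m) i := by
        refine ENNReal.tsum_le_tsum fun d => ?_
        rcases h d with h | h
        · simp [h]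
        · rw [h]
          simp only [Finsupp.add_apply, pow_add, Finset.prod_mul_distrib]
          exact le_of_eq (by ring)
    _ ≤ _ := ENNReal.tsum_comp_le_tsum_of_injective (add_left_injective m)
        fun d => ‖coeff d G‖ₑ * ∏ i, ρ i ^ d i

lemma mem_weightIdeal_of_coeff {w : σ → ℕ} {N : ℕ} {m : σ →₀ ℕ} {G H : MvPowerSeries σ ℂ}
    (h : ∀ d, coeff d H = 0 ∨ coeff d H = coeff (d + m) G) (hG : G ∈ weightIdeal w N) :
    H ∈ weightIdeal w (N - Finsupp.weight w m) := by
  intro d hd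
  rcases h d with h | h
  · exact h
  · rw [h, hG]
    rw [map_add]
    omega

/-- Summation of a series whose `N`-th term has weight at least `N`. -/
lemma exists_formal_sum (w : σ → ℕ) (g : ℕ → MvPowerSeries σ ℂ)
    (hg : ∀ N, g N ∈ weightIdeal w N) :
    ∃ G : MvPowerSeries σ ℂ, (∀ N, G - ∑ M ∈ Finset.range N, g M ∈ weightIdeal w N) ∧
      ∀ [Fintype σ] (ρ : σ → ℝ≥0∞), polyNorm ρ G ≤ ∑' N, polyNorm ρ (g N) := by
  -- Terms of index greater than the weight of `d` do not contribute at `d`, so the coefficient is a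
  -- finite sum.
  let G : MvPowerSeries σ ℂ :=
    fun d => ∑ M ∈ Finset.range (Finsupp.weight w d + 1), coeff d (g M)
  have hGc : ∀ d, coeff d G = ∑ M ∈ Finset.range (Finsupp.weight w d + 1), coeff d (g M) :=
    fun _ => rfl
  refine ⟨G, fun N d hd => ?_, fun ρ => ?_⟩
  · rw [map_sub, map_sum, hGc, sub_eq_zero]
    refine Finset.sum_subset (Finset.range_subset_range.mpr hd) fun M _ hM => hg M d ?_
    rw [Finset.mem_range] at hM
    omega
  · calc polyNorm ρ G ≤ ∑' d, ∑' N, ‖coeff d (g N)‖ₑ * ∏ i, ρ i ^ d i := by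
          refine ENNReal.tsum_le_tsum fun d => ?_
          rw [hGc, ENNReal.tsum_mul_right]
          gcongr
          exact (enorm_sum_le _ _).trans (ENNReal.sum_le_tsum _)
      _ = _ := ENNReal.tsum_comm

lemma eq_of_forall_sub_mem_weightIdeal {w : σ → ℕ} {f g : MvPowerSeries σ ℂ}
    (h : ∀ N, f - g ∈ weightIdeal w N) : f = g :=
  sub_eq_zero.mp (eq_zero_of_forall_mem_weightIdeal h)

/-- The Neumann series of `v / c`: it makes sense formally because `v` has positive weight, and its
norm is bounded by a geometric series of ratio less than one. -/
lemma exists_inverse_polyNorm_lt_top [Fintype σ] (ρ : σ → ℝ≥0∞) {w : σ → ℕ} {c : ℂ}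
    {v : MvPowerSeries σ ℂ} (hv : v ∈ weightIdeal w 1) (hvc : polyNorm ρ v < ‖c‖ₑ) :
    ∃ z, (C c - v) * z = 1 ∧ polyNorm ρ z < ⊤ := by
  have hc : c ≠ 0 := by
    rintro rfl
    simp at hvc
  let t : MvPowerSeries σ ℂ := C c⁻¹ * v
  have ht : t ∈ weightIdeal w 1 := Ideal.mul_mem_left _ _ hv
  have htn : polyNorm ρ t < 1 := by
    refine (polyNorm_mul_le _ _ _).trans_lt ?_
    rw [polyNorm_C, enorm_inv hc, mul_comm, ← div_eq_mul_inv]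
    exact ENNReal.div_lt_of_lt_mul (by simpa using hvc)
  obtain ⟨G, hG, hGn⟩ := exists_formal_sum w (fun N => t ^ N) fun N => by
    simpa using pow_mem_weightIdeal ht N
  have hcv : C c - v = C c * (1 - t) := by
    have : (C c * C c⁻¹ : MvPowerSeries σ ℂ) = 1 := by rw [← map_mul, mul_inv_cancel₀ hc, map_one]
    linear_combination v * this
  refine ⟨C c⁻¹ * G, ?_, ?_⟩
  · have h1 : (1 - t) * G = 1 := by
      refine eq_of_forall_sub_mem_weightIdeal (w := w) fun N => ?_
      have h2 : (1 - t) * G - 1 = (1 - t) * (G - ∑ M ∈ Finset.range N, t ^ M) - t ^ N := by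
        have := mul_neg_geom_sum t N
        linear_combination this
      rw [h2]
      exact sub_mem (Ideal.mul_mem_left _ _ (hG N)) (by simpa using pow_mem_weightIdeal ht N)
    rw [hcv]
    have : (C c * C c⁻¹ : MvPowerSeries σ ℂ) = 1 := by rw [← map_mul, mul_inv_cancel₀ hc, map_one]
    linear_combination (1 - t) * G * this + h1
  · refine (polyNorm_mul_le _ _ _).trans_lt (ENNReal.mul_lt_top (by simp [polyNorm_C]) ?_)
    refine (hGn ρ).trans_lt ?_
    refine (ENNReal.tsum_le_tsum fun N => polyNorm_pow_le ρ t N).trans_lt ?_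
    rw [ENNReal.tsum_geometric, ENNReal.inv_lt_top]
    exact tsub_pos_of_lt htn

/-- A fixed point theorem: an operator that contracts the weight filtration and preserves norm
bounds has a fixed point satisfying these bounds. -/
lemma exists_fixedPoint [Fintype σ] {ι : Type*} (ρ : σ → ℝ≥0∞) {w : σ → ℕ} (c : ι → ℝ≥0∞)
    (l s : ι → ℕ) (hsl : ∀ i, s i ≤ l i)
    (Φ : (ι → MvPowerSeries σ ℂ) → ι → MvPowerSeries σ ℂ)
    (hmaps : ∀ u, (∀ i, polyNorm ρ (u i) ≤ c i ∧ u i ∈ weightIdeal w (l i)) →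
      ∀ i, polyNorm ρ (Φ u i) ≤ c i ∧ Φ u i ∈ weightIdeal w (l i))
    (hcontr : ∀ N u v, (∀ i, polyNorm ρ (u i) ≤ c i ∧ u i ∈ weightIdeal w (l i)) →
      (∀ i, polyNorm ρ (v i) ≤ c i ∧ v i ∈ weightIdeal w (l i)) →
      (∀ i, u i - v i ∈ weightIdeal w (s i + N)) →
      ∀ i, Φ u i - Φ v i ∈ weightIdeal w (s i + (N + 1))) :
    ∃ u, (∀ i, polyNorm ρ (u i) ≤ c i ∧ u i ∈ weightIdeal w (l i)) ∧ Φ u = u := by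
  let U : ℕ → ι → MvPowerSeries σ ℂ := fun k => Φ^[k] 0
  have hU : ∀ k, U (k + 1) = Φ (U k) := fun k => Function.iterate_succ_apply' Φ k 0
  have hgood : ∀ k i, polyNorm ρ (U k i) ≤ c i ∧ U k i ∈ weightIdeal w (l i) := by
    intro k
    induction k with
    | zero => intro i; simp [U]
    | succ k ih => rw [hU]; exact hmaps _ ih
  have hbase : ∀ u : ι → MvPowerSeries σ ℂ, ∀ i, u i ∈ weightIdeal w (l i) →
      u i ∈ weightIdeal w (s i) := fun u i h => weightIdeal_antitone w (hsl i) h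
  have hcauchy : ∀ k m i, U (k + m) i - U k i ∈ weightIdeal w (s i + k) := by
    intro k
    induction k with
    | zero =>
      intro m i
      exact sub_mem (hbase _ i (hgood _ i).2) (hbase _ i (hgood _ i).2)
    | succ k ih =>
      intro m i
      rw [Nat.add_right_comm, hU, hU]
      exact hcontr k _ _ (hgood _) (hgood _) (ih m) i
  -- Diagonal limit: by `hcauchy`, coefficients of weight `N` no longer change from the iterate `N +
  -- 1` on.
  let u : ι → MvPowerSeries σ ℂ := fun i d => coeff d (U (Finsupp.weight w d + 1) i)
  have huU : ∀ k i, u i - U k i ∈ weightIdeal w (s i + k) := by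
    intro k i d hd
    have hud : coeff d (u i) = coeff d (U (Finsupp.weight w d + 1) i) := rfl
    rw [map_sub, hud, ← map_sub]
    rcases le_total k (Finsupp.weight w d + 1) with h | h
    · obtain ⟨m, hm⟩ := Nat.exists_eq_add_of_le h
      rw [hm]
      exact hcauchy k m i d hd
    · obtain ⟨m, hm⟩ := Nat.exists_eq_add_of_le h
      have := hcauchy (Finsupp.weight w d + 1) m i d (by omega)
      rw [← hm, map_sub] at this
      rw [map_sub, ← neg_sub, this, neg_zero]
  have hu : ∀ i, polyNorm ρ (u i) ≤ c i ∧ u i ∈ weightIdeal w (l i) := by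
    refine fun i => ⟨polyNorm_le_of_forall_finset ρ fun t => ?_, fun d hd => ?_⟩
    · refine ⟨U (t.sup (Finsupp.weight w) + 1) i, (hgood _ i).1, fun d hd => ?_⟩
      have := huU (t.sup (Finsupp.weight w) + 1) i d
        (by have := Finset.le_sup (f := Finsupp.weight w) hd; omega)
      rwa [map_sub, sub_eq_zero] at this
    · exact (hgood (Finsupp.weight w d + 1) i).2 d hd
  refine ⟨u, hu, funext fun i => eq_of_forall_sub_mem_weightIdeal (w := w) fun N => ?_⟩
  -- Both `Φ u` and `u` agree with `U (N + 1) = Φ (U N)` up to weight `s i + (N + 1)`.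
  have h1 := hcontr N u (U N) hu (hgood N) (huU N) i
  have h2 := huU (N + 1) i
  rw [hU] at h2
  have h3 := sub_mem h1 h2
  rw [sub_sub_sub_cancel_right] at h3
  exact weightIdeal_antitone w (by omega) h3

/-- The polyradius `(r ^ w₁, …, r ^ wₙ)`. -/
def radius (w : σ → ℕ) (r : ℝ≥0∞) : σ → ℝ≥0∞ := fun i => r ^ w i

lemma prod_radius [Fintype σ] (w : σ → ℕ) (r : ℝ≥0∞) (d : σ →₀ ℕ) :
    ∏ i, radius w r i ^ d i = r ^ Finsupp.weight w d := by
  rw [Finsupp.weight_apply, Finsupp.sum_fintype _ _ (by simp), ← Finset.prod_pow_eq_pow_sum]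
  refine Finset.prod_congr rfl fun i _ => ?_
  rw [radius, ← pow_mul, smul_eq_mul, mul_comm]

lemma radius_mono (w : σ → ℕ) {r s : ℝ≥0∞} (h : r ≤ s) (i : σ) : radius w r i ≤ radius w s i :=
  pow_le_pow_left' h _

/-- Convergence on some polydisc around the origin. -/
def Converges [Fintype σ] (w : σ → ℕ) (f : MvPowerSeries σ ℂ) : Prop :=
  ∀ᶠ r in 𝓝[>] (0 : ℝ≥0∞), polyNorm (radius w r) f < ⊤

lemma eventually_le_nhdsGT_zero {r : ℝ≥0∞} (hr : 0 < r) : ∀ᶠ s in 𝓝[>] (0 : ℝ≥0∞), s ≤ r :=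
  (eventually_le_nhds hr).filter_mono nhdsWithin_le_nhds

lemma Converges.of_radius [Fintype σ] {w : σ → ℕ} {f : MvPowerSeries σ ℂ} {r : ℝ≥0∞} (hr : 0 < r)
    (h : polyNorm (radius w r) f < ⊤) : Converges w f := by
  filter_upwards [eventually_le_nhdsGT_zero hr] with s hs
  exact (polyNorm_mono_radius (radius_mono w hs) f).trans_lt h

lemma Converges.exists_radius [Fintype σ] {w : σ → ℕ} {f : MvPowerSeries σ ℂ}
    (h : Converges w f) : ∃ r : ℝ≥0∞, 0 < r ∧ r < ⊤ ∧ polyNorm (radius w r) f < ⊤ := by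
  obtain ⟨r, hr, hr1, hr0⟩ :=
    (h.and ((eventually_le_nhdsGT_zero one_pos).and self_mem_nhdsWithin)).exists
  exact ⟨r, hr0, hr1.trans_lt ENNReal.one_lt_top, hr⟩

/-- A Schwarz lemma: on the polyradius `r ^ w` a monomial scales by `r` to the power its weight, so
shrinking the radius gains at least `(r / s) ^ N`. -/
lemma polyNorm_radius_le_mul [Fintype σ] {w : σ → ℕ} {N : ℕ} {f : MvPowerSeries σ ℂ}
    (hf : f ∈ weightIdeal w N) {r s : ℝ≥0∞} (hrs : r ≤ s) (hs : 0 < s) (hs' : s < ⊤) :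
    polyNorm (radius w r) f ≤ (r / s) ^ N * polyNorm (radius w s) f := by
  rw [polyNorm, polyNorm, ← ENNReal.tsum_mul_left]
  refine ENNReal.tsum_le_tsum fun d => ?_
  rw [prod_radius, prod_radius]
  rcases lt_or_ge (Finsupp.weight w d) N with h | h
  · simp [hf d h]
  · rw [mul_left_comm]
    gcongr
    calc r ^ Finsupp.weight w d = (r / s) ^ Finsupp.weight w d * s ^ Finsupp.weight w d := by
          rw [← mul_pow, ENNReal.div_mul_cancel hs.ne' hs'.ne]
      _ ≤ (r / s) ^ N * s ^ Finsupp.weight w d := by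
          gcongr ?_ * _
          exact pow_le_pow_right_of_le_one' (ENNReal.div_le_of_le_mul (by simpa using hrs)) h

lemma Converges.eventually_le [Fintype σ] {w : σ → ℕ} {M : ℕ} {f : MvPowerSeries σ ℂ}
    (hf : Converges w f) (hfM : f ∈ weightIdeal w (M + 1)) {ε : ℝ≥0∞} (hε : 0 < ε) :
    ∀ᶠ r in 𝓝[>] (0 : ℝ≥0∞), polyNorm (radius w r) f ≤ ε * r ^ M := by
  obtain ⟨s, hs, hs', hfs⟩ := hf.exists_radius
  have hlim : Tendsto (fun r : ℝ≥0∞ => r * ((s ^ (M + 1))⁻¹ * polyNorm (radius w s) f)) (𝓝[>] 0)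
      (𝓝 0) := by
    have h1 : (s ^ (M + 1))⁻¹ * polyNorm (radius w s) f ≠ ⊤ :=
      (ENNReal.mul_lt_top (by rw [ENNReal.inv_lt_top]; exact ENNReal.pow_pos hs _) hfs).ne
    have := ENNReal.Tendsto.mul_const (f := 𝓝[>] (0 : ℝ≥0∞)) (m := id)
      (tendsto_id.mono_left nhdsWithin_le_nhds) (Or.inr h1)
    simpa using this
  filter_upwards [eventually_le_nhdsGT_zero hs, hlim.eventually_le_const hε] with r hr hr'
  calc polyNorm (radius w r) f ≤ (r / s) ^ (M + 1) * polyNorm (radius w s) f :=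
        polyNorm_radius_le_mul hfM hr hs hs'
    _ = (r * ((s ^ (M + 1))⁻¹ * polyNorm (radius w s) f)) * r ^ M := by
        rw [div_eq_mul_inv, mul_pow, ENNReal.inv_pow, pow_succ]
        ring
    _ ≤ ε * r ^ M := by gcongr

lemma Converges.eventually_le_const [Fintype σ] {w : σ → ℕ} {f : MvPowerSeries σ ℂ}
    (hf : Converges w f) (hf1 : f ∈ weightIdeal w 1) {ε : ℝ≥0∞} (hε : 0 < ε) :
    ∀ᶠ r in 𝓝[>] (0 : ℝ≥0∞), polyNorm (radius w r) f ≤ ε := by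
  simpa using hf.eventually_le (M := 0) hf1 hε

lemma summable_norm_term {n : ℕ} {ρ : Fin n → ℝ≥0∞} {f : MvPowerSeries (Fin n) ℂ}
    (hf : polyNorm ρ f < ⊤) {z : Fin n → ℂ} (hz : ∀ i, ‖z i‖ₑ ≤ ρ i) :
    Summable fun d => ‖term f z d‖ := by
  refine tsum_enorm_ne_top_iff_summable_norm.mp
    ((ENNReal.tsum_le_tsum fun d => ?_).trans_lt hf).ne
  rw [term, enorm_mul]
  gcongr
  rw [← ofReal_norm, norm_prod, ENNReal.ofReal_prod_of_nonneg fun _ _ => norm_nonneg _]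
  refine Finset.prod_le_prod' fun i _ => ?_
  rw [ofReal_norm, enorm_pow]
  exact pow_le_pow_left' (hz i) _

/-- Positive weights only distort the polyradius, so all of them define the same notion of
convergence. This permits weights `w` in the normal form argument and weights `1` in the analytic
one. -/
lemma isConvergent_iff_converges {n : ℕ} {w : Fin n → ℕ} (hw : ∀ i, 0 < w i)
    {f : MvPowerSeries (Fin n) ℂ} : IsConvergent f ↔ Converges w f := by
  constructor
  · intro hf
    obtain ⟨r, hr, hs⟩ := hf.exists_radius
    have hr' : 0 < ENNReal.ofReal r := ENNReal.ofReal_pos.mpr hr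
    -- For a radius at most one, `r ^ w i ≤ r` because `w i > 0`.
    refine Converges.of_radius (r := min 1 (ENNReal.ofReal r)) (lt_min one_pos hr') ?_
    have hle : ∀ i, radius w (min 1 (ENNReal.ofReal r)) i ≤ ENNReal.ofReal r := fun i =>
      (pow_le_of_le_one zero_le (min_le_left _ _) (hw i).ne').trans (min_le_right _ _)
    refine (polyNorm_mono_radius hle f).trans_lt ?_
    have := hs.tsum_ofReal_lt_top
    refine lt_of_le_of_lt (le_of_eq (tsum_congr fun d => ?_)) this
    rw [ENNReal.ofReal_mul (norm_nonneg _), ofReal_norm, ENNReal.ofReal_prod_of_nonneg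
      (fun i _ => by positivity)]
    simp only [ENNReal.ofReal_pow hr.le]
  · intro hf
    obtain ⟨r, hr, hr', hfr⟩ := hf.exists_radius
    have hnhds : ∀ᶠ z in 𝓝 (0 : Fin n → ℂ), ∀ i, ‖z i‖ₑ ≤ radius w r i := by
      rw [eventually_all]
      intro i
      have h1 : Tendsto (fun z : Fin n → ℂ => ‖z i‖ₑ) (𝓝 0) (𝓝 0) := by
        have : Continuous fun z : Fin n → ℂ => ‖z i‖ₑ := by fun_prop
        simpa using this.tendsto 0
      exact h1.eventually_le_const (ENNReal.pow_pos hr _)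
    filter_upwards [hnhds] with z hz using summable_norm_term hfr hz

end ConvergentSeries

/-! ### Stability of convergence, and Taylor expansion to second order. -/

namespace ConvergentSeries

open MvPowerSeries

variable {σ τ : Type*}

section Converges

variable [Fintype σ] {w : σ → ℕ} {f g : MvPowerSeries σ ℂ}

lemma Converges.add (hf : Converges w f) (hg : Converges w g) : Converges w (f + g) := by
  filter_upwards [hf, hg] with r hr hr'
  exact (polyNorm_add_le _ _ _).trans_lt (ENNReal.add_lt_top.mpr ⟨hr, hr'⟩)

lemma Converges.neg (hf : Converges w f) : Converges w (-f) := by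
  filter_upwards [hf] with r hr
  rwa [polyNorm_neg]

lemma Converges.sub (hf : Converges w f) (hg : Converges w g) : Converges w (f - g) := by
  rw [sub_eq_add_neg]
  exact hf.add hg.neg

lemma Converges.mul (hf : Converges w f) (hg : Converges w g) : Converges w (f * g) := by
  filter_upwards [hf, hg] with r hr hr'
  exact (polyNorm_mul_le _ _ _).trans_lt (ENNReal.mul_lt_top hr hr')

lemma Converges.sum {κ : Type*} (s : Finset κ) {f : κ → MvPowerSeries σ ℂ}
    (hf : ∀ k ∈ s, Converges w (f k)) : Converges w (∑ k ∈ s, f k) := by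
  classical
  induction s using Finset.induction_on with
  | empty => exact Eventually.of_forall fun r => by simp
  | insert a s ha ih =>
    rw [Finset.sum_insert ha]
    exact (hf a (Finset.mem_insert_self a s)).add
      (ih fun k hk => hf k (Finset.mem_insert_of_mem hk))

lemma converges_X (i : σ) : Converges w (X i) := by
  refine Converges.of_radius one_pos ?_
  rw [polyNorm_X, radius]
  simp

lemma Converges.of_coeff {m : σ →₀ ℕ} {G H : MvPowerSeries σ ℂ}
    (h : ∀ d, coeff d H = 0 ∨ coeff d H = coeff (d + m) G) (hG : Converges w G) :
    Converges w H := by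
  filter_upwards [hG, self_mem_nhdsWithin] with r hr hr0
  have h1 := (mul_polyNorm_le_of_coeff (radius w r) h).trans_lt hr
  rw [prod_radius] at h1
  by_contra h2
  rw [not_lt, top_le_iff] at h2
  rw [h2, ENNReal.mul_top (ENNReal.pow_pos hr0 _).ne'] at h1
  exact lt_irrefl _ h1

lemma Converges.subst [Fintype τ] {v : τ → ℕ} {a : σ → MvPowerSeries τ ℂ} (ha : ∀ i, Converges v (a i))
    (ha1 : ∀ i, a i ∈ weightIdeal v 1) (hf : Converges w f) :
    Converges v (MvPowerSeries.subst a f) := by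
  obtain ⟨s, hs, -, hfs⟩ := hf.exists_radius
  have : ∀ᶠ r in 𝓝[>] (0 : ℝ≥0∞), ∀ i, polyNorm (radius v r) (a i) ≤ radius w s i :=
    eventually_all.mpr fun i => (ha i).eventually_le_const (ha1 i) (ENNReal.pow_pos hs _)
  filter_upwards [this] with r hr
  exact (polyNorm_subst_le _ (hasSubst_of_mem (u := fun _ => 1) (fun _ => one_pos) ha1) f).trans_lt
    ((polyNorm_mono_radius hr f).trans_lt hfs)

end Converges

lemma pderiv_mem_weightIdeal {w : σ → ℕ} {N : ℕ} {f : MvPowerSeries σ ℂ}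
    (hf : f ∈ weightIdeal w N) (i : σ) : pderiv ℂ i f ∈ weightIdeal w (N - w i) := by
  intro d hd
  rw [coeff_pderiv, hf, zero_mul]
  rw [map_add, weight_single]
  omega

lemma exists_mvPolynomial_sub_mem [Finite σ] (f : MvPowerSeries σ ℂ) (N : ℕ) :
    ∃ p : MvPolynomial σ ℂ, f - p ∈ weightIdeal (fun _ => 1) N := by
  classical
  refine ⟨truncTotal N f, fun d hd => ?_⟩
  have hd' : d.degree < N := by rwa [Finsupp.degree_eq_weight_one]
  rw [map_sub, MvPolynomial.coeff_coe, coeff_truncTotal _ hd', sub_self]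

section Taylor

variable [Fintype σ]

/-- The series `f(x)`, as a series in the variables `(x, z)`. -/
def baseSeries (f : MvPowerSeries σ ℂ) : MvPowerSeries (σ ⊕ σ) ℂ :=
  subst (fun i => X (Sum.inl i)) f

/-- The series `f(x + z)`, as a series in the variables `(x, z)`. -/
def shiftSeries (f : MvPowerSeries σ ℂ) : MvPowerSeries (σ ⊕ σ) ℂ :=
  subst (fun i => X (Sum.inl i) + X (Sum.inr i)) f

/-- The remainder of the first order Taylor expansion of `f(x + z)` at `z = 0`. -/
def taylorRemainder (f : MvPowerSeries σ ℂ) : MvPowerSeries (σ ⊕ σ) ℂ :=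
  shiftSeries f - baseSeries f - ∑ i, baseSeries (pderiv ℂ i f) * X (Sum.inr i)

lemma hasSubst_base : HasSubst fun i : σ => (X (Sum.inl i) : MvPowerSeries (σ ⊕ σ) ℂ) :=
  hasSubst_of_constantCoeff_zero fun _ => constantCoeff_X _

lemma hasSubst_shift :
    HasSubst fun i : σ => (X (Sum.inl i) + X (Sum.inr i) : MvPowerSeries (σ ⊕ σ) ℂ) :=
  hasSubst_of_constantCoeff_zero fun _ => by simp

lemma hasSubst_elim {g : σ → MvPowerSeries σ ℂ} (hg : ∀ i, constantCoeff (g i) = 0) :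
    HasSubst (Sum.elim X g : σ ⊕ σ → MvPowerSeries σ ℂ) :=
  hasSubst_of_constantCoeff_zero fun i => by cases i <;> simp [hg]

lemma subst_elim_baseSeries {g : σ → MvPowerSeries σ ℂ} (hg : ∀ i, constantCoeff (g i) = 0)
    (f : MvPowerSeries σ ℂ) : subst (Sum.elim X g) (baseSeries f) = f := by
  rw [baseSeries, subst_comp_subst_apply hasSubst_base (hasSubst_elim hg)]
  simp only [subst_X (hasSubst_elim hg), Sum.elim_inl]
  exact congrFun subst_self f

lemma subst_elim_shiftSeries {g : σ → MvPowerSeries σ ℂ} (hg : ∀ i, constantCoeff (g i) = 0)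
    (f : MvPowerSeries σ ℂ) :
    subst (Sum.elim X g) (shiftSeries f) = subst (fun i => X i + g i) f := by
  rw [shiftSeries, subst_comp_subst_apply hasSubst_shift (hasSubst_elim hg)]
  simp only [subst_add (hasSubst_elim hg), subst_X (hasSubst_elim hg), Sum.elim_inl, Sum.elim_inr]

lemma baseSeries_mem {w : σ → ℕ} {N : ℕ} {f : MvPowerSeries σ ℂ} (hf : f ∈ weightIdeal w N) :
    baseSeries f ∈ weightIdeal (Sum.elim w w) N :=
  subst_mem_weightIdeal hasSubst_base
    (fun i => X_mem_weightIdeal (Sum.elim w w) (Sum.inl i)) hf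

lemma taylorRemainder_mem {w : σ → ℕ} {N : ℕ} {f : MvPowerSeries σ ℂ}
    (hf : f ∈ weightIdeal w N) : taylorRemainder f ∈ weightIdeal (Sum.elim w w) N := by
  refine sub_mem (sub_mem ?_ (baseSeries_mem hf)) (sum_mem fun i _ => ?_)
  · exact subst_mem_weightIdeal hasSubst_shift
      (fun i => add_mem (X_mem_weightIdeal (Sum.elim w w) (Sum.inl i))
        (X_mem_weightIdeal (Sum.elim w w) (Sum.inr i))) hf
  · exact weightIdeal_antitone _ (by simp only [Sum.elim_inr]; omega)
      (mul_mem_weightIdeal (baseSeries_mem (pderiv_mem_weightIdeal hf i))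
        (X_mem_weightIdeal (Sum.elim w w) (Sum.inr i)))

lemma baseSeries_add (f g : MvPowerSeries σ ℂ) :
    baseSeries (f + g) = baseSeries f + baseSeries g := subst_add hasSubst_base f g

lemma baseSeries_mul (f g : MvPowerSeries σ ℂ) :
    baseSeries (f * g) = baseSeries f * baseSeries g := subst_mul hasSubst_base f g

lemma baseSeries_X (i : σ) : baseSeries (X i : MvPowerSeries σ ℂ) = X (Sum.inl i) :=
  subst_X hasSubst_base i

lemma taylorRemainder_add (f g : MvPowerSeries σ ℂ) :
    taylorRemainder (f + g) = taylorRemainder f + taylorRemainder g := by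
  simp only [taylorRemainder, shiftSeries, subst_add hasSubst_shift, baseSeries_add, map_add,
    add_mul, Finset.sum_add_distrib]
  ring

lemma taylorRemainder_C (c : ℂ) : taylorRemainder (C c : MvPowerSeries σ ℂ) = 0 := by
  have h0 : baseSeries (0 : MvPowerSeries σ ℂ) = 0 := by
    simpa using (baseSeries_add (0 : MvPowerSeries σ ℂ) 0)
  have h1 : shiftSeries (C c : MvPowerSeries σ ℂ) = C c := subst_C c
  have h2 : baseSeries (C c : MvPowerSeries σ ℂ) = C c := subst_C c
  simp [taylorRemainder, h0, h1, h2]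

/-- The product rule for the remainder. The additional term is visibly quadratic in `z`, which gives
the induction step for polynomials in `taylorRemainder_mem_order_two`. -/
lemma taylorRemainder_mul_X (f : MvPowerSeries σ ℂ) (i : σ) :
    taylorRemainder (f * X i) = taylorRemainder f * (X (Sum.inl i) + X (Sum.inr i)) +
      ∑ j, baseSeries (pderiv ℂ j f) * X (Sum.inr j) * X (Sum.inr i) := by
  classical
  have h0 : baseSeries (0 : MvPowerSeries σ ℂ) = 0 := by
    simpa using (baseSeries_add (0 : MvPowerSeries σ ℂ) 0)
  have h1 : ∀ j, baseSeries (pderiv ℂ j (f * X i)) * X (Sum.inr j) =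
      baseSeries (pderiv ℂ j f) * X (Sum.inr j) * X (Sum.inl i) +
        if j = i then baseSeries f * X (Sum.inr i) else 0 := by
    intro j
    rw [Derivation.leibniz, baseSeries_add, smul_eq_mul, smul_eq_mul, baseSeries_mul,
      baseSeries_mul, baseSeries_X]
    split_ifs with h
    · subst h
      have h2 : baseSeries (1 : MvPowerSeries σ ℂ) = 1 := by
        rw [baseSeries, ← coe_substAlgHom hasSubst_base, map_one]
      rw [pderiv_X_self, h2]
      ring
    · rw [pderiv_X_of_ne (Ne.symm h), h0]
      ring
  have h2 : shiftSeries (f * X i) = shiftSeries f * (X (Sum.inl i) + X (Sum.inr i)) := by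
    rw [shiftSeries, subst_mul hasSubst_shift, subst_X hasSubst_shift, shiftSeries]
  rw [taylorRemainder, Finset.sum_congr rfl fun j _ => h1 j, Finset.sum_add_distrib,
    Finset.sum_ite_eq', if_pos (Finset.mem_univ i), h2, baseSeries_mul, baseSeries_X,
    taylorRemainder, ← Finset.sum_mul, ← Finset.sum_mul]
  ring

/-- The Taylor remainder is of order at least two in `z`. -/
lemma taylorRemainder_mem_order_two (f : MvPowerSeries σ ℂ) :
    taylorRemainder f ∈ weightIdeal (Sum.elim (fun _ => 0) fun _ => 1) 2 := by
  have hz : ∀ i : σ, (X (Sum.inr i) : MvPowerSeries (σ ⊕ σ) ℂ) ∈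
      weightIdeal (Sum.elim (fun _ => 0) fun _ => 1) 1 := fun i =>
    X_mem_weightIdeal (Sum.elim (fun _ => 0) fun _ => 1) (Sum.inr i)
  have hpoly : ∀ p : MvPolynomial σ ℂ, taylorRemainder (p : MvPowerSeries σ ℂ) ∈
      weightIdeal (Sum.elim (fun _ => 0) fun _ => 1) 2 := by
    intro p
    induction p using MvPolynomial.induction_on with
    | C c =>
      rw [MvPolynomial.coe_C, taylorRemainder_C]
      exact zero_mem _
    | add p q hp hq =>
      rw [MvPolynomial.coe_add, taylorRemainder_add]
      exact add_mem hp hq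
    | mul_X p i hp =>
      rw [MvPolynomial.coe_mul, MvPolynomial.coe_X, taylorRemainder_mul_X]
      refine add_mem (Ideal.mul_mem_right _ _ hp) (sum_mem fun j _ => ?_)
      rw [mul_assoc]
      exact Ideal.mul_mem_left _ _ (mul_mem_weightIdeal (hz j) (hz i))
  intro e he
  -- The remainder preserves total degree, so its coefficient at `e` only involves a polynomial
  -- truncation of `f`.
  obtain ⟨p, hp⟩ := exists_mvPolynomial_sub_mem f (Finsupp.weight (fun _ => 1) e + 1)
  have h1 := taylorRemainder_mem hp e (by
    have : (Sum.elim (fun _ => 1) fun _ => 1 : σ ⊕ σ → ℕ) = fun _ => 1 := by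
      ext i; cases i <;> rfl
    rw [this]
    exact Nat.lt_succ_self _)
  have h2 := taylorRemainder_add (f - (p : MvPowerSeries σ ℂ)) p
  rw [sub_add_cancel] at h2
  rw [h2, map_add, h1, hpoly p e he, add_zero]

end Taylor

/-- Taylor expansion of `f(x + g)` to second order. -/
lemma exists_taylor {n : ℕ} (f : MvPowerSeries (Fin n) ℂ) :
    ∃ H : Fin n → Fin n → MvPowerSeries (Fin n ⊕ Fin n) ℂ,
      (∀ g : Fin n → MvPowerSeries (Fin n) ℂ, (∀ i, constantCoeff (g i) = 0) →
        subst (fun i => X i + g i) f = f + ∑ i, g i * pderiv ℂ i f +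
          ∑ k, ∑ l, g k * g l * subst (Sum.elim X g) (H k l)) ∧
      (∀ (w : Fin n → ℕ) (N : ℕ), f ∈ weightIdeal w N →
        ∀ k l, H k l ∈ weightIdeal (Sum.elim w w) (N - (w k + w l))) ∧
      ∀ w : Fin n → ℕ, (∀ i, 0 < w i) → Converges w f →
        ∀ k l, Converges (Sum.elim w w) (H k l) := by
  classical
  let m : Fin n × Fin n → (Fin n ⊕ Fin n) →₀ ℕ := fun p =>
    Finsupp.single (Sum.inr p.1) 1 + Finsupp.single (Sum.inr p.2) 1
  obtain ⟨H, hH, hHc⟩ := exists_eq_sum_monomial_mul m (taylorRemainder f) (by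
    intro d hd
    have h2 : 2 ≤ Finsupp.weight (Sum.elim (fun _ => 0) fun _ => 1) d := by
      by_contra h
      exact hd (taylorRemainder_mem_order_two f d (not_le.mp h))
    rw [Finsupp.weight_apply, Finsupp.sum_fintype _ _ (by simp)] at h2
    simp only [Fintype.sum_sum_type, Sum.elim_inl, Sum.elim_inr, smul_eq_mul, mul_zero, mul_one,
      Finset.sum_const_zero, zero_add] at h2
    obtain ⟨k, -, hk⟩ : ∃ k ∈ Finset.univ, d (Sum.inr k) ≠ 0 := by
      by_contra! h
      rw [Finset.sum_eq_zero h] at h2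
      omega
    -- A monomial of degree at least two in `z` is divisible by `z_k²`, or else by `z_k z_l` for two
    -- distinct indices.
    by_cases hk2 : 2 ≤ d (Sum.inr k)
    · refine ⟨(k, k), fun i => ?_⟩
      by_cases hi : i = Sum.inr k
      · subst hi; simpa [m] using hk2
      · simp [m, Finsupp.single_eq_of_ne hi]
    · obtain ⟨l, hl, hl0⟩ : ∃ l ∈ Finset.univ.erase k, d (Sum.inr l) ≠ 0 := by
        by_contra! h
        rw [← Finset.add_sum_erase _ _ (Finset.mem_univ k), Finset.sum_eq_zero h] at h2
        omega
      have hlk : (Sum.inr l : Fin n ⊕ Fin n) ≠ Sum.inr k := by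
        simpa using (Finset.mem_erase.mp hl).1
      refine ⟨(k, l), fun i => ?_⟩
      by_cases hi : i = Sum.inr k
      · subst hi
        simp only [m, Finsupp.add_apply, Finsupp.single_eq_same, Finsupp.single_eq_of_ne hlk.symm]
        omega
      · by_cases hi' : i = Sum.inr l
        · subst hi'
          simp only [m, Finsupp.add_apply, Finsupp.single_eq_same, Finsupp.single_eq_of_ne hlk]
          omega
        · simp [m, Finsupp.single_eq_of_ne hi, Finsupp.single_eq_of_ne hi'])
  refine ⟨fun k l => H (k, l), fun g hg => ?_, fun w N hf k l => ?_, fun w hw hf k l => ?_⟩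
  · have hs := hasSubst_elim hg
    have hmon : ∀ p, (monomial (m p) 1 : MvPowerSeries (Fin n ⊕ Fin n) ℂ) =
        X (Sum.inr p.1) * X (Sum.inr p.2) := fun p => by
      rw [X, X, monomial_mul_monomial, one_mul]
    -- Specialise the universal identity in `(x, z)` to `z = g`.
    have h1 := congrArg (substAlgHom hs) hH
    simp only [taylorRemainder, map_sub, map_sum, map_mul, hmon] at h1
    simp only [coe_substAlgHom, subst_elim_shiftSeries hg, subst_elim_baseSeries hg, subst_X hs,
      Sum.elim_inr] at h1
    rw [Fintype.sum_prod_type] at h1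
    simp only [mul_comm (g _) (pderiv ℂ _ f)]
    linear_combination h1
  · have := mem_weightIdeal_of_coeff (hHc (k, l)) (taylorRemainder_mem hf)
    simpa [m, weight_single] using this
  · refine Converges.of_coeff (hHc (k, l)) ?_
    have hw' : ∀ i, 0 < (Sum.elim w w : Fin n ⊕ Fin n → ℕ) i := by
      rintro (i | i) <;> exact hw i
    have hX := converges_X (w := (Sum.elim w w : Fin n ⊕ Fin n → ℕ))
    have hX1 : ∀ i, (X i : MvPowerSeries (Fin n ⊕ Fin n) ℂ) ∈ weightIdeal (Sum.elim w w) 1 :=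
      fun i => (mem_weightIdeal_one_iff hw').mpr (constantCoeff_X i)
    have hbase : ∀ h, Converges w h → Converges (Sum.elim w w) (baseSeries h) := fun h hh =>
      hh.subst (fun i => hX _) (fun i => hX1 _)
    refine Converges.sub (Converges.sub ?_ (hbase f hf)) (Converges.sum _ fun i _ => ?_)
    · exact hf.subst (fun i => (hX _).add (hX _)) (fun i => add_mem (hX1 _) (hX1 _))
    · refine (hbase _ ?_).mul (hX _)
      rw [← isConvergent_iff_converges hw] at hf ⊢
      exact hf.pderiv i

end ConvergentSeries

/-! ### Inversion of weight raising substitutions. -/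

namespace ConvergentSeries

open MvPowerSeries

variable {n : ℕ} {w : Fin n → ℕ}

lemma two_mul_radius_le {σ : Type*} {w : σ → ℕ} {i : σ} (hw : 0 < w i) (r : ℝ≥0∞) :
    2 * radius w r i ≤ radius w (2 * r) i := by
  rw [radius, radius, mul_pow]
  gcongr
  exact le_self_pow (by norm_num) hw.ne'

lemma X_add_mem {σ : Type*} {w : σ → ℕ} {g : σ → MvPowerSeries σ ℂ}
    (hg : ∀ i, g i ∈ weightIdeal w (w i + 1)) (i : σ) : X i + g i ∈ weightIdeal w (w i) :=
  add_mem (X_mem_weightIdeal w i) (weightIdeal_antitone w (Nat.le_succ _) (hg i))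

lemma hasSubst_X_add {σ : Type*} [Finite σ] {w : σ → ℕ} {g : σ → MvPowerSeries σ ℂ}
    (hg : ∀ i, g i ∈ weightIdeal w (w i + 1)) : HasSubst fun i => X i + g i :=
  hasSubst_of_constantCoeff_zero fun i => by
    rw [map_add, constantCoeff_X, constantCoeff_eq_zero_of_mem (Nat.succ_pos _) (hg i), add_zero]

lemma eventually_two_mul {p : ℝ≥0∞ → Prop} (h : ∀ᶠ r in 𝓝[>] (0 : ℝ≥0∞), p r) :
    ∀ᶠ r in 𝓝[>] (0 : ℝ≥0∞), p (2 * r) := by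
  have h1 : Tendsto (fun r : ℝ≥0∞ => 2 * r) (𝓝[>] 0) (𝓝[>] 0) := by
    refine tendsto_nhdsWithin_of_tendsto_nhds_of_eventually_within _ ?_ ?_
    · have := ENNReal.Tendsto.const_mul (f := 𝓝[>] (0 : ℝ≥0∞)) (m := id) (a := 2) (b := 0)
        (tendsto_id.mono_left nhdsWithin_le_nhds) (Or.inr (by norm_num))
      simpa using this
    · filter_upwards [self_mem_nhdsWithin] with r hr
      exact ENNReal.mul_pos (by norm_num) (Set.mem_Ioi.mp hr).ne'
  exact h1.eventually h

/-- A substitution `x ↦ x + g` that raises weights has a convergent inverse of the same kind. -/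
lemma exists_subst_left_inverse {σ : Type*} [Fintype σ] {w : σ → ℕ} (hw : ∀ i, 0 < w i)
    {g : σ → MvPowerSeries σ ℂ} (hg : ∀ i, g i ∈ weightIdeal w (w i + 1))
    (hgc : ∀ i, Converges w (g i)) :
    ∃ h : σ → MvPowerSeries σ ℂ, (∀ i, h i ∈ weightIdeal w (w i + 1)) ∧
      (∀ i, Converges w (h i)) ∧
      ∀ f, subst (fun i => X i + h i) (subst (fun i => X i + g i) f) = f := by
  -- If `u j` has norm at most `r ^ w j`, then `x j + u j` has norm at most `2 r ^ w j ≤ (2r) ^ w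
  -- j`. Controlling `g` on the doubled radius therefore makes the operator below preserve its
  -- bounds.
  have hev : ∀ᶠ r in 𝓝[>] (0 : ℝ≥0∞), ∀ i, polyNorm (radius w (2 * r)) (g i) ≤ r ^ w i := by
    refine eventually_all.mpr fun i => ?_
    have h1 := eventually_two_mul ((hgc i).eventually_le (hg i) (ε := (2 ^ w i)⁻¹)
      (ENNReal.inv_pos.mpr (by finiteness)))
    filter_upwards [h1] with r hr
    refine hr.trans (le_of_eq ?_)
    rw [mul_pow, ← mul_assoc, ENNReal.inv_mul_cancel (by positivity) (by finiteness), one_mul]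
  obtain ⟨r, hr, hr1, hr0⟩ :=
    (hev.and ((eventually_le_nhdsGT_zero one_pos).and self_mem_nhdsWithin)).exists
  -- The inverse `x + h` satisfies `h = -g(x + h)`. Since `g i` has weight at least `w i + 1`, this
  -- operator gains one step in the filtration.
  obtain ⟨h, hh, hfix⟩ := exists_fixedPoint (radius w r) (w := w) (fun i => r ^ w i)
    (fun i => w i + 1) w (fun i => Nat.le_succ _) (fun u i => -subst (fun j => X j + u j) (g i))
    (by
      intro u hu i
      have hs : HasSubst fun j => X j + u j := hasSubst_X_add fun j => (hu j).2
      refine ⟨?_, neg_mem (subst_mem_weightIdeal hs (X_add_mem fun j => (hu j).2) (hg i))⟩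
      rw [polyNorm_neg]
      refine (polyNorm_subst_le _ hs _).trans ((polyNorm_mono_radius (fun j => ?_) _).trans (hr i))
      refine (polyNorm_add_le _ _ _).trans (le_trans ?_ (two_mul_radius_le (hw j) r))
      rw [polyNorm_X, two_mul]
      exact add_le_add le_rfl (hu j).1)
    (by
      intro N u v hu hv huv i
      rw [neg_sub_neg, ← neg_sub, neg_mem_iff]
      have := subst_sub_subst_mem_weightIdeal (N := N) (hasSubst_X_add fun j => (hu j).2)
        (hasSubst_X_add fun j => (hv j).2) (X_add_mem fun j => (hu j).2)
        (X_add_mem fun j => (hv j).2) (fun j => by simpa using huv j) (hg i)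
      convert this using 2
      omega)
  have hs : HasSubst fun j => X j + h j := hasSubst_X_add fun j => (hh j).2
  refine ⟨h, fun i => (hh i).2, fun i => Converges.of_radius (r := r) hr0
    ((hh i).1.trans_lt (ENNReal.pow_lt_top (hr1.trans_lt ENNReal.one_lt_top))), fun f => ?_⟩
  rw [subst_comp_subst_apply (hasSubst_X_add hg) hs]
  have : (fun i => subst (fun i => X i + h i) (X i + g i)) = X := by
    funext i
    rw [subst_add hs, subst_X hs]
    have := congrFun hfix i
    linear_combination -this
  rw [this]
  exact congrFun subst_self f

end ConvergentSeries

/-! ### Automorphisms of `ℂ{x}` given by weight raising substitutions. -/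

namespace ConvSeries

open ConvergentSeries MvPowerSeries

variable {n : ℕ} {w : Fin n → ℕ}

lemma mem_iff_converges (hw : ∀ i, 0 < w i) {f : MvPowerSeries (Fin n) ℂ} :
    f ∈ ConvSeries n ↔ Converges w f := isConvergent_iff_converges hw

lemma converges (hw : ∀ i, 0 < w i) (f : ConvSeries n) :
    Converges w (f : MvPowerSeries (Fin n) ℂ) := (mem_iff_converges hw).mp f.2

lemma coe_X (i : Fin n) : ((ConvSeries.X i : ConvSeries n) : MvPowerSeries (Fin n) ℂ) =
    MvPowerSeries.X i := rfl

lemma hasSubst_coe {m : ℕ} {a : Fin m → ConvSeries n}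
    (ha : ∀ i, constantCoeff (a i : MvPowerSeries (Fin n) ℂ) = 0) :
    HasSubst fun i => (a i : MvPowerSeries (Fin n) ℂ) :=
  hasSubst_of_constantCoeff_zero ha

/-- Substitution of convergent series without constant term into convergent series. -/
def substHom {m : ℕ} (a : Fin m → ConvSeries n)
    (ha : ∀ i, constantCoeff (a i : MvPowerSeries (Fin n) ℂ) = 0) :
    ConvSeries m →ₐ[ℂ] ConvSeries n :=
  (((substAlgHom (hasSubst_coe ha)).restrictScalars ℂ).comp (ConvSeries m).val).codRestrict
    (ConvSeries n) fun f => by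
      have h1 : ∀ {k : ℕ} (_ : Fin k), 0 < 1 := fun _ => one_pos
      refine (mem_iff_converges (w := fun _ => 1) h1).mpr ?_
      have : Converges (fun _ => 1) (subst (fun i => (a i : MvPowerSeries (Fin n) ℂ))
          (f : MvPowerSeries (Fin m) ℂ)) :=
        (converges (w := fun _ => 1) h1 f).subst (fun i => converges h1 (a i))
          fun i => (mem_weightIdeal_one_iff h1).mpr (ha i)
      simpa [coe_substAlgHom] using this

lemma coe_substHom {m : ℕ} (a : Fin m → ConvSeries n)
    (ha : ∀ i, constantCoeff (a i : MvPowerSeries (Fin n) ℂ) = 0) (f : ConvSeries m) :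
    (substHom a ha f : MvPowerSeries (Fin n) ℂ) =
      subst (fun i => (a i : MvPowerSeries (Fin n) ℂ)) (f : MvPowerSeries (Fin m) ℂ) := by
  simp [substHom, coe_substAlgHom]

/-- The endomorphism `Ψ` is the substitution `x ↦ x + g`, which raises weights. -/
structure IsWeightRaisingSubst (w : Fin n → ℕ) (Ψ : ConvSeries n → ConvSeries n)
    (g : Fin n → ConvSeries n) : Prop where
  mem : ∀ i, (g i : MvPowerSeries (Fin n) ℂ) ∈ weightIdeal w (w i + 1)
  coe_apply : ∀ f, (Ψ f : MvPowerSeries (Fin n) ℂ) =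
    subst (fun i => MvPowerSeries.X i + (g i : MvPowerSeries (Fin n) ℂ))
      (f : MvPowerSeries (Fin n) ℂ)

namespace IsWeightRaisingSubst

variable {Ψ Φ : ConvSeries n → ConvSeries n} {g g' : Fin n → ConvSeries n}

lemma map_mem (h : IsWeightRaisingSubst w Ψ g) {f : ConvSeries n} {N : ℕ}
    (hf : (f : MvPowerSeries (Fin n) ℂ) ∈ weightIdeal w N) :
    (Ψ f : MvPowerSeries (Fin n) ℂ) ∈ weightIdeal w N := by
  rw [h.coe_apply]
  exact subst_mem_weightIdeal (hasSubst_X_add h.mem) (X_add_mem h.mem) hf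

lemma map_X (h : IsWeightRaisingSubst w Ψ g) (i : Fin n) :
    Ψ (ConvSeries.X i) = ConvSeries.X i + g i := by
  apply Subtype.ext
  rw [h.coe_apply, coe_X, subst_X (hasSubst_X_add h.mem)]
  rfl

lemma comp (h : IsWeightRaisingSubst w Ψ g) (h' : IsWeightRaisingSubst w Φ g') :
    IsWeightRaisingSubst w (Ψ ∘ Φ) fun i => g i + Ψ (g' i) where
  mem i := add_mem (h.mem i) (h.map_mem (h'.mem i))
  coe_apply f := by
    have hs := hasSubst_X_add h.mem
    rw [Function.comp_apply, h.coe_apply, h'.coe_apply,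
      subst_comp_subst_apply (hasSubst_X_add h'.mem) hs]
    congr 1
    funext i
    rw [subst_add hs, subst_X hs, Subalgebra.coe_add, h.coe_apply, add_assoc]

end IsWeightRaisingSubst

/-- An automorphism which, together with its inverse, is a weight raising substitution. -/
def IsUnipotent (w : Fin n → ℕ) (Ψ : ConvSeries n ≃ₐ[ℂ] ConvSeries n) : Prop :=
  (∃ g, IsWeightRaisingSubst w Ψ g) ∧ ∃ g, IsWeightRaisingSubst w Ψ.symm g

lemma IsUnipotent.refl (w : Fin n → ℕ) : IsUnipotent w AlgEquiv.refl := by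
  have : IsWeightRaisingSubst w (id : ConvSeries n → ConvSeries n) 0 :=
    ⟨fun i => zero_mem _, fun f => by
      simp only [Pi.zero_apply, ZeroMemClass.coe_zero, add_zero, id]
      exact (congrFun subst_self _).symm⟩
  exact ⟨⟨0, this⟩, ⟨0, this⟩⟩

lemma IsUnipotent.trans {Φ Ψ : ConvSeries n ≃ₐ[ℂ] ConvSeries n} (hΦ : IsUnipotent w Φ)
    (hΨ : IsUnipotent w Ψ) : IsUnipotent w (Φ.trans Ψ) := by
  obtain ⟨⟨a, ha⟩, b, hb⟩ := hΦ
  obtain ⟨⟨c, hc⟩, d, hd⟩ := hΨ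
  exact ⟨⟨_, hc.comp ha⟩, _, hb.comp hd⟩

/-- Every weight raising substitution is an automorphism. -/
lemma exists_isUnipotent (hw : ∀ i, 0 < w i) (g : Fin n → ConvSeries n)
    (hg : ∀ i, (g i : MvPowerSeries (Fin n) ℂ) ∈ weightIdeal w (w i + 1)) :
    ∃ Ψ : ConvSeries n ≃ₐ[ℂ] ConvSeries n, IsUnipotent w Ψ ∧ IsWeightRaisingSubst w Ψ g := by
  have key : ∀ g : Fin n → ConvSeries n,
      (∀ i, (g i : MvPowerSeries (Fin n) ℂ) ∈ weightIdeal w (w i + 1)) →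
      ∃ Ψ : ConvSeries n →ₐ[ℂ] ConvSeries n, IsWeightRaisingSubst w Ψ g := by
    intro g hg
    refine ⟨substHom (fun i => ConvSeries.X i + g i) fun i => ?_, hg, fun f => coe_substHom _ _ f⟩
    rw [Subalgebra.coe_add, coe_X, map_add, constantCoeff_X,
      constantCoeff_eq_zero_of_mem (Nat.succ_pos _) (hg i), add_zero]
  have left_inv : ∀ (g : Fin n → ConvSeries n) (Ψ : ConvSeries n →ₐ[ℂ] ConvSeries n),
      IsWeightRaisingSubst w Ψ g → ∃ (h : Fin n → ConvSeries n)
        (Φ : ConvSeries n →ₐ[ℂ] ConvSeries n), IsWeightRaisingSubst w Φ h ∧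
          ∀ f, Φ (Ψ f) = f := by
    intro g Ψ hΨ
    obtain ⟨h, hh, hhc, hhg⟩ :=
      exists_subst_left_inverse hw hΨ.mem fun i => converges hw (g i)
    let h' : Fin n → ConvSeries n := fun i => ⟨h i, (mem_iff_converges hw).mpr (hhc i)⟩
    obtain ⟨Φ, hΦ⟩ := key h' hh
    refine ⟨h', Φ, hΦ, fun f => Subtype.ext ?_⟩
    rw [hΦ.coe_apply, hΨ.coe_apply]
    exact hhg _
  obtain ⟨Ψ, hΨ⟩ := key g hg
  obtain ⟨h, Φ, hΦ, hΦΨ⟩ := left_inv g Ψ hΨ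
  -- A left inverse that itself has a left inverse is two-sided.
  obtain ⟨k, Θ, -, hΘΦ⟩ := left_inv h Φ hΦ
  have hΨΦ : ∀ f, Ψ (Φ f) = f := fun f => by
    rw [← hΘΦ (Ψ (Φ f)), hΦΨ, hΘΦ]
  let e : ConvSeries n ≃ₐ[ℂ] ConvSeries n :=
    AlgEquiv.ofAlgHom Ψ Φ (AlgHom.ext hΨΦ) (AlgHom.ext hΦΨ)
  exact ⟨e, ⟨⟨g, hΨ⟩, h, hΦ⟩, hΨ⟩

end ConvSeries

/-! ### Finite determinacy. -/

namespace ConvergentSeries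

open MvPowerSeries

lemma eventually_mul_le {C δ : ℝ≥0∞} (hC : C < ⊤) (hδ : 0 < δ) :
    ∀ᶠ ε in 𝓝[>] (0 : ℝ≥0∞), ε * C ≤ δ := by
  have := ENNReal.Tendsto.mul_const (f := 𝓝[>] (0 : ℝ≥0∞)) (m := id)
    (tendsto_id.mono_left nhdsWithin_le_nhds) (Or.inr hC.ne)
  rw [zero_mul] at this
  exact this.eventually_le_const hδ

/-- Pigeonhole: exponents all less than `k` give weight at most `k * ∑ w i`. -/
lemma exists_le_apply_of_lt_weight {σ : Type*} [Fintype σ] {w : σ → ℕ} {k : ℕ}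
    {d : σ →₀ ℕ} (h : k * ∑ i, w i < Finsupp.weight w d) : ∃ i, k ≤ d i := by
  by_contra! hlt
  rw [Finsupp.weight_apply, Finsupp.sum_fintype _ _ (by simp), Finset.mul_sum] at h
  exact absurd h (not_lt.mpr (Finset.sum_le_sum fun i _ => Nat.mul_le_mul_right _ (hlt i).le))

/-- A series of large weight is a combination of the powers `x_i ^ k`. -/
lemma exists_eq_sum_X_pow_mul {σ : Type*} [Fintype σ] {w : σ → ℕ} (k L : ℕ)
    {f : MvPowerSeries σ ℂ} (hf : f ∈ weightIdeal w (k * ∑ i, w i + 1 + L)) :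
    ∃ H : σ → MvPowerSeries σ ℂ, f = ∑ i, X i ^ k * H i ∧ (∀ i, H i ∈ weightIdeal w (L + 1)) ∧
      (Converges w f → ∀ i, Converges w (H i)) := by
  classical
  obtain ⟨H, hH, hHc⟩ := exists_eq_sum_monomial_mul (fun i : σ => Finsupp.single i k) f (by
    intro d hd
    obtain ⟨i, hi⟩ : ∃ i, k ≤ d i := by
      refine exists_le_apply_of_lt_weight (w := w) ?_
      by_contra h
      exact hd (hf d (by omega))
    exact ⟨i, by simpa using hi⟩)
  refine ⟨H, ?_, fun i => ?_, fun hc i => Converges.of_coeff (hHc i) hc⟩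
  · simpa only [X_pow_eq] using hH
  · refine weightIdeal_antitone w ?_ (mem_weightIdeal_of_coeff (hHc i) hf)
    rw [weight_single]
    have := Nat.mul_le_mul_left k (Finset.single_le_sum (f := w) (fun _ _ => Nat.zero_le _)
      (Finset.mem_univ i))
    omega

/-- The implicit function argument behind finite determinacy: a perturbation of `f` in the square
of the Jacobian ideal is induced by a substitution `x ↦ x + ∑ u ∂f`. -/
lemma exists_subst_eq_add {n : ℕ} {w : Fin n → ℕ} (hw : ∀ i, 0 < w i)
    {f : MvPowerSeries (Fin n) ℂ} (hf : Converges w f) (L : ℕ)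
    (P : Fin n → Fin n → MvPowerSeries (Fin n) ℂ) (hPc : ∀ i j, Converges w (P i j))
    (hP : ∀ i j, P i j ∈ weightIdeal w (L + 1)) :
    ∃ g : Fin n → MvPowerSeries (Fin n) ℂ, (∀ i, Converges w (g i)) ∧
      (∀ i, g i ∈ weightIdeal w (L + 1)) ∧
      subst (fun i => X i + g i) f = f + ∑ i, ∑ j, pderiv ℂ i f * pderiv ℂ j f * P i j := by
  classical
  obtain ⟨H, hH, -, hHc⟩ := exists_taylor f
  have hfc : ∀ i, Converges w (pderiv ℂ i f) := fun i => by
    rw [← isConvergent_iff_converges hw] at hf ⊢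
    exact hf.pderiv i
  let w2 : Fin n ⊕ Fin n → ℕ := Sum.elim w w
  obtain ⟨R, ⟨hRf, hRH⟩, hR1, hR0⟩ :=
    ((((eventually_all.mpr fun i => hfc i).and
      (eventually_all.mpr fun k => eventually_all.mpr fun l => hHc w hw hf k l))).and
        ((eventually_le_nhdsGT_zero one_pos).and self_mem_nhdsWithin)).exists
  have hR0 : 0 < R := hR0
  set A : ℝ≥0∞ := ∑ i, polyNorm (radius w R) (pderiv ℂ i f) with hA
  set B : ℝ≥0∞ := ∑ k, ∑ l, polyNorm (radius w2 R) (H k l) with hB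
  have hAt : A < ⊤ := ENNReal.sum_lt_top.mpr fun i _ => hRf i
  have hBt : B < ⊤ := ENNReal.sum_lt_top.mpr fun k _ => ENNReal.sum_lt_top.mpr fun l _ => hRH k l
  -- `ε` bounds the unknowns `u`. The bound `ε A ≤ R ^ w k` keeps `G u` in the polydisc where the `H
  -- k l` have finite norm, and `ε B ≤ 1/2` makes the quadratic term at most `ε / 2`. The radius `r`
  -- is chosen afterwards so that `P` accounts for the other half.
  obtain ⟨ε, ⟨hεA, hεB⟩, hε1, hε0⟩ :=
    (((eventually_all.mpr fun k => eventually_mul_le hAt (ENNReal.pow_pos hR0 (w k))).and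
      (eventually_mul_le hBt (δ := 2⁻¹) (by norm_num))).and
        ((eventually_le_nhdsGT_zero one_pos).and self_mem_nhdsWithin)).exists
  have hε0 : 0 < ε := hε0
  obtain ⟨r, hrP, hrR, hr0⟩ :=
    ((eventually_all.mpr fun i => eventually_all.mpr fun j => (hPc i j).eventually_le_const
      (weightIdeal_antitone w (by omega) (hP i j)) (ENNReal.half_pos hε0.ne')).and
        ((eventually_le_nhdsGT_zero hR0).and self_mem_nhdsWithin)).exists
  have hr0 : 0 < r := hr0
  let G : (Fin n × Fin n → MvPowerSeries (Fin n) ℂ) → Fin n → MvPowerSeries (Fin n) ℂ :=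
    fun u k => ∑ i, pderiv ℂ i f * u (k, i)
  have hGL : ∀ {u : Fin n × Fin n → MvPowerSeries (Fin n) ℂ} {N : ℕ},
      (∀ p, u p ∈ weightIdeal w N) → ∀ k, G u k ∈ weightIdeal w N := fun h k =>
    sum_mem fun i _ => Ideal.mul_mem_left _ _ (h _)
  have hG0 : ∀ {u : Fin n × Fin n → MvPowerSeries (Fin n) ℂ},
      (∀ p, u p ∈ weightIdeal w (L + 1)) → ∀ k, constantCoeff (G u k) = 0 := fun h k =>
    constantCoeff_eq_zero_of_mem (Nat.succ_pos _) (hGL h k)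
  have hGn : ∀ {u : Fin n × Fin n → MvPowerSeries (Fin n) ℂ},
      (∀ p, polyNorm (radius w r) (u p) ≤ ε) → ∀ k, polyNorm (radius w r) (G u k) ≤ R ^ w k := by
    intro u hu k
    refine (polyNorm_sum_le _ _ _).trans (le_trans ?_ (hεA k))
    rw [hA, Finset.mul_sum]
    refine Finset.sum_le_sum fun i _ => (polyNorm_mul_le _ _ _).trans ?_
    rw [mul_comm]
    exact mul_le_mul' (hu _) (polyNorm_mono_radius (radius_mono w hrR) _)
  -- With `g_k = ∑ u_{ki} ∂ᵢf`, the Taylor expansion of `f(x + g) - f` is `∑ ∂ᵢf ∂ⱼf (u_{ij} + ∑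
  -- u_{ki} u_{lj} H_{kl}(x, g))`. It suffices that each bracket equals `P i j`, and this is the
  -- fixed point equation.
  obtain ⟨u, hu, hfix⟩ := exists_fixedPoint (radius w r) (w := w) (fun _ : Fin n × Fin n => ε)
    (fun _ => L + 1) (fun _ => 0) (fun _ => Nat.zero_le _)
    (fun u p => P p.1 p.2 - ∑ q : Fin n × Fin n, u (q.1, p.1) * u (q.2, p.2) *
      subst (Sum.elim X (G u)) (H q.1 q.2))
    (by
      intro u hu p
      refine ⟨?_, sub_mem (hP _ _) (sum_mem fun q _ => ?_)⟩
      · refine (polyNorm_sub_le _ _ _).trans ?_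
        rw [← ENNReal.add_halves ε]
        refine add_le_add (hrP _ _) ((polyNorm_sum_le _ _ _).trans ?_)
        calc _ ≤ ∑ q : Fin n × Fin n, ε * ε * polyNorm (radius w2 R) (H q.1 q.2) := by
              refine Finset.sum_le_sum fun q _ => (polyNorm_mul_le _ _ _).trans ?_
              refine mul_le_mul' ((polyNorm_mul_le _ _ _).trans
                (mul_le_mul' (hu _).1 (hu _).1)) ?_
              refine (polyNorm_subst_le _ (hasSubst_elim (hG0 fun p => (hu p).2)) _).trans
                (polyNorm_mono_radius ?_ _)
              rintro (i | i)
              · simp only [Sum.elim_inl, polyNorm_X]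
                exact radius_mono w hrR i
              · exact hGn (fun p => (hu p).1) i
          _ = ε * (ε * B) := by
              rw [← Finset.mul_sum, Fintype.sum_prod_type, mul_assoc]
          _ ≤ ε * 2⁻¹ := by gcongr
      · exact Ideal.mul_mem_right _ _ (Ideal.mul_mem_left _ _ (hu _).2))
    (by
      intro N u v hu hv huv p
      simp only [zero_add] at huv ⊢
      rw [sub_sub_sub_cancel_left, ← Finset.sum_sub_distrib]
      refine sum_mem fun q _ => ?_
      have hu1 : ∀ p, u p ∈ weightIdeal w 1 := fun p =>
        weightIdeal_antitone w (by omega) (hu p).2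
      have hv1 : ∀ p, v p ∈ weightIdeal w 1 := fun p =>
        weightIdeal_antitone w (by omega) (hv p).2
      -- Zero weights on the source make the filtration hypotheses trivial; only closeness to order
      -- `N` is transferred. The extra unit of weight comes from the other factors.
      have hq := subst_sub_subst_mem_weightIdeal (w := w) (v := fun _ => 0) (M := 0) (N := N)
        (hasSubst_elim (hG0 fun p => (hv p).2)) (hasSubst_elim (hG0 fun p => (hu p).2))
        (fun i => mem_weightIdeal_zero w _) (fun i => mem_weightIdeal_zero w _) (by
          rintro (i | i)
          · simp
          · simp only [Sum.elim_inr, G, zero_add]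
            rw [← Finset.sum_sub_distrib]
            refine sum_mem fun j _ => ?_
            rw [← mul_sub, ← neg_sub, mul_neg, neg_mem_iff]
            exact Ideal.mul_mem_left _ _ (huv _)) (mem_weightIdeal_zero _ (H q.1 q.2))
      rw [zero_add] at hq
      -- Each term of this telescoping pairs a difference of weight at least `N` with an unknown of
      -- weight at least one.
      have key : ∀ a b c d x y : MvPowerSeries (Fin n) ℂ, a * b * x - c * d * y =
          a * (b * (x - y)) + (a * (b - d) + d * (a - c)) * y := by intros; ring
      rw [key]
      have hvu : ∀ p, v p - u p ∈ weightIdeal w N := fun p => by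
        rw [← neg_sub, neg_mem_iff]
        exact huv p
      rw [add_comm N 1]
      exact add_mem (mul_mem_weightIdeal (hv1 _) (Ideal.mul_mem_left _ _ hq))
        (Ideal.mul_mem_right _ _ (add_mem (mul_mem_weightIdeal (hv1 _) (hvu _))
          (mul_mem_weightIdeal (hu1 _) (hvu _)))))
  refine ⟨G u, fun k => Converges.of_radius hr0 (lt_of_le_of_lt (hGn (fun p => (hu p).1) k) ?_),
    hGL fun p => (hu p).2, ?_⟩
  · exact ENNReal.pow_lt_top (hR1.trans_lt ENNReal.one_lt_top)
  · rw [hH _ (hG0 fun p => (hu p).2)]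
    have hfix' : ∀ i j, P i j = u (i, j) + ∑ q : Fin n × Fin n, u (q.1, i) * u (q.2, j) *
        subst (Sum.elim X (G u)) (H q.1 q.2) := fun i j => by
      have := congrFun hfix (i, j)
      linear_combination this
    have h1 : ∑ i, G u i * pderiv ℂ i f =
        ∑ i, ∑ j, pderiv ℂ i f * pderiv ℂ j f * u (i, j) := by
      refine Finset.sum_congr rfl fun i _ => ?_
      rw [Finset.sum_mul]
      exact Finset.sum_congr rfl fun j _ => by ring
    have h2 : ∑ k, ∑ l, G u k * G u l * subst (Sum.elim X (G u)) (H k l) =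
        ∑ i, ∑ j, pderiv ℂ i f * pderiv ℂ j f * ∑ q : Fin n × Fin n, u (q.1, i) * u (q.2, j) *
          subst (Sum.elim X (G u)) (H q.1 q.2) := by
      simp only [Finset.mul_sum]
      rw [Finset.sum_congr rfl fun i _ => Finset.sum_comm, Finset.sum_comm (s := Finset.univ)
        (t := (Finset.univ : Finset (Fin n × Fin n))), Fintype.sum_prod_type]
      refine Finset.sum_congr rfl fun k _ => Finset.sum_congr rfl fun l _ => ?_
      rw [Finset.sum_mul_sum, Finset.sum_mul]
      refine Finset.sum_congr rfl fun i _ => ?_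
      rw [Finset.sum_mul]
      exact Finset.sum_congr rfl fun j _ => by ring
    rw [h1, h2, add_assoc, ← Finset.sum_add_distrib]
    congr 1
    refine Finset.sum_congr rfl fun i _ => ?_
    rw [← Finset.sum_add_distrib]
    refine Finset.sum_congr rfl fun j _ => ?_
    rw [hfix' i j]
    ring

end ConvergentSeries

namespace ConvSeries

open ConvergentSeries MvPowerSeries

variable {n : ℕ} {w : Fin n → ℕ}

/-- Finite determinacy. -/
lemma exists_isUnipotent_apply_eq_add (hw : ∀ i, 0 < w i) (f : ConvSeries n) {k : ℕ}
    (hk : ∀ i, ConvSeries.X i ^ k ∈ jacobianIdeal f) :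
    ∃ M, ∀ p : ConvSeries n, (p : MvPowerSeries (Fin n) ℂ) ∈ weightIdeal w M →
      ∃ Ψ : ConvSeries n ≃ₐ[ℂ] ConvSeries n, IsUnipotent w Ψ ∧ Ψ f = f + p := by
  classical
  simp only [jacobianIdeal, Ideal.mem_span_range_iff_exists_fun] at hk
  choose b hb using hk
  -- Such a `p` is a combination of the `x_i ^ (2k) = (x_i ^ k)²`, which lie in the square of
  -- `j(f)`. The second `∑ w i` makes the cofactors, and hence `g`, of weight greater than every `w
  -- i`.
  refine ⟨(2 * k) * ∑ i, w i + 1 + ∑ i, w i, fun p hp => ?_⟩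
  obtain ⟨H, hpH, hHL, hHc⟩ := exists_eq_sum_X_pow_mul (2 * k) (∑ i, w i) hp
  have hHc := hHc (converges hw p)
  obtain ⟨g, hgc, hg, hgf⟩ := exists_subst_eq_add hw (converges hw f) (∑ i, w i)
    (fun j l => ∑ i, (b i j * b i l : ConvSeries n) * H i)
    (fun j l => Converges.sum _ fun i _ => (converges hw _).mul (hHc i))
    (fun j l => sum_mem fun i _ => Ideal.mul_mem_left _ _ (hHL i))
  let g' : Fin n → ConvSeries n := fun i => ⟨g i, (mem_iff_converges hw).mpr (hgc i)⟩
  obtain ⟨Ψ, hΨ, hΨg⟩ := exists_isUnipotent hw g' fun i => weightIdeal_antitone w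
    (Nat.succ_le_succ (Finset.single_le_sum (f := w) (fun _ _ => Nat.zero_le _)
      (Finset.mem_univ i))) (hg i)
  refine ⟨Ψ, hΨ, Subtype.ext ?_⟩
  rw [hΨg.coe_apply]
  refine hgf.trans ?_
  rw [Subalgebra.coe_add, hpH]
  congr 1
  have hb' : ∀ i, (MvPowerSeries.X i : MvPowerSeries (Fin n) ℂ) ^ k =
      ∑ j, (b i j : MvPowerSeries (Fin n) ℂ) * pderiv ℂ j (f : MvPowerSeries (Fin n) ℂ) := by
    intro i
    have := congrArg (ConvSeries n).val (hb i)
    simpa [partialDeriv, coe_X] using this.symm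
  simp only [Finset.mul_sum]
  calc _ = ∑ i, ∑ j, ∑ l, pderiv ℂ j (f : MvPowerSeries (Fin n) ℂ) *
        pderiv ℂ l (f : MvPowerSeries (Fin n) ℂ) * ((b i j * b i l : ConvSeries n) * H i) := by
        rw [Finset.sum_comm]
        rw [Finset.sum_congr rfl fun l _ => Finset.sum_comm]
        rw [Finset.sum_comm]
        refine Finset.sum_congr rfl fun i _ => Finset.sum_comm
    _ = _ := by
        refine Finset.sum_congr rfl fun i _ => ?_
        rw [two_mul, pow_add, hb', Finset.sum_mul_sum, Finset.sum_mul]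
        refine Finset.sum_congr rfl fun j _ => ?_
        rw [Finset.sum_mul]
        refine Finset.sum_congr rfl fun l _ => ?_
        push_cast
        ring

end ConvSeries

/-! ### Normalisation weight by weight, and the normal form. -/

namespace ConvSeries

open ConvergentSeries MvPowerSeries

variable {n : ℕ} {w : Fin n → ℕ}

/-- The part of `f` of weight at most `M`. -/
def truncate (w : Fin n → ℕ) (M : ℕ) (f : ConvSeries n) : ConvSeries n :=
  ⟨fun d => if Finsupp.weight w d ≤ M then MvPowerSeries.coeff d (f : MvPowerSeries (Fin n) ℂ)
      else 0,
    IsConvergent.mono f.2 fun d => by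
      change ‖(if Finsupp.weight w d ≤ M then MvPowerSeries.coeff d (f : MvPowerSeries (Fin n) ℂ)
        else 0)‖ ≤ _
      split_ifs <;> simp⟩

lemma coeff_truncate (M : ℕ) (f : ConvSeries n) (d : Fin n →₀ ℕ) :
    coeff d (truncate w M f) = if Finsupp.weight w d ≤ M then coeff d f else 0 := rfl

lemma sub_truncate_mem (M : ℕ) (f : ConvSeries n) :
    ((f - truncate w M f : ConvSeries n) : MvPowerSeries (Fin n) ℂ) ∈ weightIdeal w (M + 1) := by
  intro d hd
  have := coeff_truncate (w := w) M f d
  rw [if_pos (by omega)] at this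
  rw [Subalgebra.coe_sub, map_sub, sub_eq_zero]
  exact this.symm

lemma coe_quasihomogeneousPart (k : ℕ) (f : ConvSeries n) (d : Fin n →₀ ℕ) :
    MvPowerSeries.coeff d (quasihomogeneousPart w k f : MvPowerSeries (Fin n) ℂ) =
      if Finsupp.weight w d = k then MvPowerSeries.coeff d (f : MvPowerSeries (Fin n) ℂ) else 0 := by
  classical
  rw [quasihomogeneousPart, coeff_weightedHomogeneousComponent]

lemma quasihomogeneousPart_mem (k : ℕ) (f : ConvSeries n) :
    (quasihomogeneousPart w k f : MvPowerSeries (Fin n) ℂ) ∈ weightIdeal w k := by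
  intro d hd
  rw [coe_quasihomogeneousPart, if_neg hd.ne]

/-- Positive weights leave only finitely many monomials of given weight, so the part is a polynomial
and the spanning hypothesis, which concerns monomials, applies to it. -/
lemma quasihomogeneousPart_eq_sum (hw : ∀ i, 0 < w i) (k : ℕ) (f : ConvSeries n) :
    ∃ s : Finset (Fin n →₀ ℕ), quasihomogeneousPart w k f = ∑ d ∈ s, coeff d f • mono d := by
  classical
  have hfin := Finsupp.finite_of_nat_weight_le w (fun i => (hw i).ne') k
  refine ⟨hfin.toFinset.filter fun d => Finsupp.weight w d = k, Subtype.ext ?_⟩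
  ext d
  rw [coe_quasihomogeneousPart, AddSubmonoidClass.coe_finsetSum, map_sum]
  simp only [Subalgebra.coe_smul, mono, coeff_smul, coeff_monomial, mul_ite, mul_one, mul_zero]
  rw [Finset.sum_ite_eq]
  refine if_congr ?_ rfl rfl
  simp only [Finset.mem_filter, Set.Finite.mem_toFinset, Set.mem_ofPred_eq]
  exact ⟨fun h => ⟨h.le, h⟩, fun h => h.2⟩

/-- Multiplication by a quasihomogeneous series commutes with taking quasihomogeneous parts. -/
lemma coeff_quasihomogeneousPart_mul {k l : ℕ} (b : ConvSeries n) {q : MvPowerSeries (Fin n) ℂ}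
    (hq : ∀ e, MvPowerSeries.coeff e q ≠ 0 → l + Finsupp.weight w e = k) (e : Fin n →₀ ℕ) :
    MvPowerSeries.coeff e ((quasihomogeneousPart w l b : MvPowerSeries (Fin n) ℂ) * q) =
      if Finsupp.weight w e = k then
        MvPowerSeries.coeff e ((b : MvPowerSeries (Fin n) ℂ) * q) else 0 := by
  classical
  have key : ∀ p ∈ Finset.HasAntidiagonal.antidiagonal e,
      MvPowerSeries.coeff p.1 (quasihomogeneousPart w l b : MvPowerSeries (Fin n) ℂ) *
        MvPowerSeries.coeff p.2 q = if Finsupp.weight w e = k then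
          MvPowerSeries.coeff p.1 (b : MvPowerSeries (Fin n) ℂ) * MvPowerSeries.coeff p.2 q
            else 0 := by
    intro p hp
    by_cases h : MvPowerSeries.coeff p.2 q = 0
    · simp [h]
    · have h1 := hq _ h
      have h2 : Finsupp.weight w e = Finsupp.weight w p.1 + Finsupp.weight w p.2 := by
        rw [← Finset.HasAntidiagonal.mem_antidiagonal.mp hp, map_add]
      rw [coe_quasihomogeneousPart, ite_mul, zero_mul]
      exact if_congr (by omega) rfl rfl
  rw [MvPowerSeries.coeff_mul, MvPowerSeries.coeff_mul, Finset.sum_congr rfl key]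
  split_ifs <;> simp

lemma coe_partialDeriv (i : Fin n) (f : ConvSeries n) :
    (partialDeriv i f : MvPowerSeries (Fin n) ℂ) = pderiv ℂ i (f : MvPowerSeries (Fin n) ℂ) := rfl

/-- Modulo the Jacobian ideal of a quasihomogeneous `f₀`, the weight `k` part of a series may be
moved to monomials in `S` by quasihomogeneous coefficients. -/
lemma exists_quasihomogeneous_combination (hw : ∀ i, 0 < w i) {f₀ : ConvSeries n} {d₀ k : ℕ}
    (hf₀ : ∀ e, coeff e f₀ ≠ 0 → Finsupp.weight w e = d₀) (hk : d₀ ≤ k) {S : Set (Fin n →₀ ℕ)}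
    (hS : IsMonomialSpanningSet f₀ S) (h : ConvSeries n) :
    ∃ a : Fin n → ConvSeries n,
      (∀ i, (a i : MvPowerSeries (Fin n) ℂ) ∈ weightIdeal w (w i + (k - d₀))) ∧
      (∀ e, Finsupp.weight w e ≠ k → coeff e (∑ i, a i * partialDeriv i f₀) = 0) ∧
      ∀ e, Finsupp.weight w e = k → e ∉ S →
        coeff e (∑ i, a i * partialDeriv i f₀) = coeff e h := by
  classical
  have hmem : Ideal.Quotient.mk (jacobianIdeal f₀) (quasihomogeneousPart w k h) ∈
      Submodule.span ℂ (monoClass f₀ '' S) := by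
    obtain ⟨s, hs⟩ := quasihomogeneousPart_eq_sum hw k h
    rw [hs, map_sum]
    refine Submodule.sum_mem _ fun d _ => ?_
    exact Submodule.smul_mem _ (coeff d h) (hS d)
  rw [Finsupp.mem_span_image_iff_linearCombination] at hmem
  obtain ⟨c, hcS, hc⟩ := hmem
  have hjac : quasihomogeneousPart w k h - c.sum (fun e z => z • mono e) ∈ jacobianIdeal f₀ := by
    rw [← Ideal.Quotient.eq, ← hc, Finsupp.linearCombination_apply, Finsupp.sum, Finsupp.sum,
      map_sum]
    rfl
  rw [jacobianIdeal, Ideal.mem_span_range_iff_exists_fun] at hjac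
  obtain ⟨b, hb⟩ := hjac
  have hsum : ∀ e, coeff e (c.sum fun e z => z • mono e) = c e := by
    intro e
    rw [coeff, Finsupp.sum, AddSubmonoidClass.coe_finsetSum, map_sum]
    simp only [Subalgebra.coe_smul, mono, coeff_smul, coeff_monomial, mul_ite, mul_one, mul_zero]
    rw [Finset.sum_ite_eq]
    split_ifs with he
    · rfl
    · exact (Finsupp.notMem_support_iff.mp he).symm
  -- `∂ᵢf₀` is quasihomogeneous of weight `d₀ - w i`. Keeping only the part of `b i` of weight `w i
  -- + (k - d₀)` therefore extracts exactly the weight `k` part of the relation.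
  have hcoeff : ∀ e, coeff e
      (∑ i, quasihomogeneousPart w (w i + (k - d₀)) (b i) * partialDeriv i f₀) =
        if Finsupp.weight w e = k then coeff e (∑ i, b i * partialDeriv i f₀) else 0 := by
    intro e
    rw [coeff, coeff, AddSubmonoidClass.coe_finsetSum, AddSubmonoidClass.coe_finsetSum, map_sum,
      map_sum]
    simp only [Subalgebra.coe_mul]
    rw [Finset.sum_congr rfl fun i _ => coeff_quasihomogeneousPart_mul (k := k) (b i)
      (q := partialDeriv i f₀) (fun e he => ?_) e]
    · split_ifs <;> simp
    · rw [coe_partialDeriv, coeff_pderiv] at he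
      have := hf₀ _ (left_ne_zero_of_mul he)
      rw [map_add, weight_single] at this
      omega
  refine ⟨fun i => quasihomogeneousPart w (w i + (k - d₀)) (b i),
    fun i => quasihomogeneousPart_mem _ _, fun e he => ?_, fun e he heS => ?_⟩
  · rw [hcoeff, if_neg he]
  · rw [hcoeff, if_pos he, hb, coeff, Subalgebra.coe_sub, map_sub, coe_quasihomogeneousPart,
      if_pos he]
    have h1 := hsum e
    rw [coeff] at h1
    -- The combination subtracted from the weight `k` part is supported on `S`, hence has no
    -- coefficient at `e ∉ S`.
    rw [h1, Finsupp.notMem_support_iff.mp fun h => heS (hcS h), sub_zero]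
    rfl

/-- Normalisation of the weight `k` part. -/
lemma exists_isUnipotent_normalize_weight (hw : ∀ i, 0 < w i) {f₀ : ConvSeries n} {d₀ k : ℕ}
    (hf₀ : ∀ e, coeff e f₀ ≠ 0 → Finsupp.weight w e = d₀) (hk : d₀ < k) {S : Set (Fin n →₀ ℕ)}
    (hS : IsMonomialSpanningSet f₀ S) {h : ConvSeries n}
    (hh : ((h - f₀ : ConvSeries n) : MvPowerSeries (Fin n) ℂ) ∈ weightIdeal w (d₀ + 1)) :
    ∃ Ψ : ConvSeries n ≃ₐ[ℂ] ConvSeries n, IsUnipotent w Ψ ∧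
      (∀ e, Finsupp.weight w e < k → coeff e (Ψ h) = coeff e h) ∧
      ∀ e, Finsupp.weight w e = k → e ∉ S → coeff e (Ψ h) = 0 := by
  obtain ⟨a, ha, ha0, haS⟩ := exists_quasihomogeneous_combination hw hf₀ hk.le hS h
  have hna : ∀ i, ((-a i : ConvSeries n) : MvPowerSeries (Fin n) ℂ) ∈
      weightIdeal w (w i + (k - d₀)) := fun i => by
    rw [Subalgebra.coe_neg, neg_mem_iff]
    exact ha i
  have hna1 : ∀ i, ((-a i : ConvSeries n) : MvPowerSeries (Fin n) ℂ) ∈ weightIdeal w (w i + 1) :=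
    fun i => weightIdeal_antitone w (by omega) (hna i)
  have hna0 : ∀ i, constantCoeff ((-a i : ConvSeries n) : MvPowerSeries (Fin n) ℂ) = 0 :=
    fun i => constantCoeff_eq_zero_of_mem (Nat.succ_pos _) (hna1 i)
  obtain ⟨Ψ, hΨ, hΨa⟩ := exists_isUnipotent hw (fun i => -a i) hna1
  have hf₀d : (f₀ : MvPowerSeries (Fin n) ℂ) ∈ weightIdeal w d₀ := fun e he => by
    by_contra hne
    exact he.ne (hf₀ e hne)
  have hhd : (h : MvPowerSeries (Fin n) ℂ) ∈ weightIdeal w d₀ := by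
    have := add_mem (weightIdeal_antitone w (Nat.le_succ _) hh) hf₀d
    rwa [Subalgebra.coe_sub, sub_add_cancel] at this
  obtain ⟨H, hH, hHw, -⟩ := exists_taylor (h : MvPowerSeries (Fin n) ℂ)
  -- In the first order term, `h` may be replaced by `f₀`: the error has weight at least `(w i + k -
  -- d₀) + (d₀ + 1 - w i) = k + 1`. The second order term has weight at least `2(k - d₀) + d₀`,
  -- which exceeds `k` because `k > d₀`.
  have hmod : (Ψ h : MvPowerSeries (Fin n) ℂ) -
      (h - ∑ i, a i * partialDeriv i f₀ : ConvSeries n) ∈ weightIdeal w (k + 1) := by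
    rw [hΨa.coe_apply, hH _ hna0]
    have h1 : ((h - ∑ i, a i * partialDeriv i f₀ : ConvSeries n) : MvPowerSeries (Fin n) ℂ) =
        h + ∑ i, ((-a i : ConvSeries n) : MvPowerSeries (Fin n) ℂ) *
          pderiv ℂ i (f₀ : MvPowerSeries (Fin n) ℂ) := by
      push_cast
      simp only [neg_mul, Finset.sum_neg_distrib, coe_partialDeriv]
      ring
    rw [h1, add_assoc, add_sub_add_left_eq_sub, add_sub_right_comm, ← Finset.sum_sub_distrib]
    refine add_mem (sum_mem fun i _ => ?_) (sum_mem fun i _ => sum_mem fun j _ => ?_)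
    · rw [← mul_sub, ← map_sub]
      rw [Subalgebra.coe_sub] at hh
      exact weightIdeal_antitone w (by omega)
        (mul_mem_weightIdeal (hna i) (pderiv_mem_weightIdeal hh i))
    · refine weightIdeal_antitone w ?_ (mul_mem_weightIdeal (mul_mem_weightIdeal (hna i) (hna j))
        (subst_mem_weightIdeal (w := w) (hasSubst_elim hna0) ?_ (hHw w d₀ hhd i j)))
      · omega
      · rintro (l | l)
        · exact X_mem_weightIdeal w l
        · exact weightIdeal_antitone w (Nat.le_add_right _ _) (hna l)
  have hcoeff : ∀ e, Finsupp.weight w e ≤ k →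
      coeff e (Ψ h) = coeff e h - coeff e (∑ i, a i * partialDeriv i f₀) := fun e he => by
    have := hmod e (by omega)
    rw [map_sub, sub_eq_zero, Subalgebra.coe_sub, map_sub] at this
    exact this
  refine ⟨Ψ, hΨ, fun e he => ?_, fun e he heS => ?_⟩
  · rw [hcoeff e he.le, ha0 e he.ne, sub_zero]
  · rw [hcoeff e he.le, haS e he heS, sub_self]

/-- Normalisation up to a given weight. -/
lemma exists_isUnipotent_normalize (hw : ∀ i, 0 < w i) {f₀ f : ConvSeries n} {d₀ : ℕ}
    (hf₀ : ∀ e, coeff e f₀ ≠ 0 → Finsupp.weight w e = d₀) {S : Set (Fin n →₀ ℕ)}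
    (hS : IsMonomialSpanningSet f₀ S)
    (hf : ((f - f₀ : ConvSeries n) : MvPowerSeries (Fin n) ℂ) ∈ weightIdeal w (d₀ + 1)) (M : ℕ) :
    ∃ Φ : ConvSeries n ≃ₐ[ℂ] ConvSeries n, IsUnipotent w Φ ∧
      ((Φ f - f₀ : ConvSeries n) : MvPowerSeries (Fin n) ℂ) ∈ weightIdeal w (d₀ + 1) ∧
      ∀ e, d₀ < Finsupp.weight w e → Finsupp.weight w e ≤ M → e ∉ S → coeff e (Φ f) = 0 := by
  induction M with
  | zero => exact ⟨AlgEquiv.refl, IsUnipotent.refl w, hf, fun e he he' => by omega⟩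
  | succ M ih =>
    obtain ⟨Φ, hΦ, hΦf, hΦS⟩ := ih
    rcases lt_or_ge d₀ (M + 1) with hM | hM
    · obtain ⟨Ψ, hΨ, hlt, heq⟩ := exists_isUnipotent_normalize_weight hw hf₀ hM hS hΦf
      refine ⟨Φ.trans Ψ, hΦ.trans hΨ, fun e he => ?_, fun e he he' heS => ?_⟩
      · have h1 := hΦf e he
        have h2 := hlt e (by omega)
        rw [Subalgebra.coe_sub, map_sub] at h1 ⊢
        rw [coeff, coeff] at h2
        rw [AlgEquiv.trans_apply, h2, h1]
      · rw [AlgEquiv.trans_apply]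
        rcases Nat.lt_or_eq_of_le he' with h | h
        · rw [hlt e h]
          exact hΦS e he (by omega) heS
        · exact heq e h heS
    · exact ⟨Φ, hΦ, hΦf, fun e he he' => by omega⟩

/-- The normal form theorem for a series whose Jacobian ideal contains powers of all variables. -/
lemma exists_normal_form (hw : ∀ i, 0 < w i) {f : ConvSeries n} (hf0 : f ≠ 0) {k : ℕ}
    (hk : ∀ i, X i ^ k ∈ jacobianIdeal f) {S : Set (Fin n →₀ ℕ)}
    (hS : IsMonomialSpanningSet (initialPart w f) S) :
    ∃ (Ψ : ConvSeries n ≃ₐ[ℂ] ConvSeries n) (g : Fin n → ConvSeries n),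
      (∀ i, Ψ (X i) = X i + g i) ∧ (∀ i, g i = 0 ∨ wt w (X i) < wt w (g i)) ∧
      ∀ d : Fin n →₀ ℕ, wt w (initialPart w f) < (Finsupp.weight w d : ℕ) →
        d ∉ S → coeff d (Ψ f) = 0 := by
  have hf0' : (f : MvPowerSeries (Fin n) ℂ) ≠ 0 := fun h => hf0 (Subtype.ext h)
  set d₀ := (wt w f).toNat with hd₀
  have hd : (d₀ : ℕ∞) = wt w f := (ne_zero_iff_weightedOrder_finite w).mp hf0'
  have hfd : (f : MvPowerSeries (Fin n) ℂ) ∈ weightIdeal w d₀ := le_weightedOrder_iff.mp hd.le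
  have hf₀ : ∀ e, coeff e (initialPart w f) ≠ 0 → Finsupp.weight w e = d₀ := by
    intro e he
    by_contra hne
    exact he ((coe_quasihomogeneousPart _ f e).trans (if_neg hne))
  have hff₀ : ((f - initialPart w f : ConvSeries n) : MvPowerSeries (Fin n) ℂ) ∈
      weightIdeal w (d₀ + 1) := by
    intro e he
    rw [Subalgebra.coe_sub, map_sub, initialPart, coe_quasihomogeneousPart]
    split_ifs with h
    · exact sub_self _
    · rw [hfd e (lt_of_le_of_ne (by omega) h), sub_zero]
  have hwt : (d₀ : ℕ∞) ≤ wt w (initialPart w f) :=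
    le_weightedOrder_iff.mpr (quasihomogeneousPart_mem _ _)
  -- The bound `M` is taken for `f` itself, before `Φ` is constructed, so there is no circularity.
  obtain ⟨M, hM⟩ := exists_isUnipotent_apply_eq_add hw f hk
  obtain ⟨Φ, hΦ, -, hΦS⟩ := exists_isUnipotent_normalize hw hf₀ hS hff₀ M
  obtain ⟨-, φ, hφ⟩ := id hΦ
  -- The tail is pulled back: `Φ⁻¹` preserves the filtration, so `f - Φ⁻¹ q` is a perturbation of
  -- `f` of high weight and equals `Ψ f`. Applying `Φ` then gives exactly the truncation.
  set q := Φ f - truncate w M (Φ f) with hq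
  have hqM : ((-Φ.symm q : ConvSeries n) : MvPowerSeries (Fin n) ℂ) ∈ weightIdeal w M := by
    rw [Subalgebra.coe_neg, neg_mem_iff]
    exact hφ.map_mem (weightIdeal_antitone w (Nat.le_succ M) (sub_truncate_mem M _))
  obtain ⟨Ψ, hΨ, hΨf⟩ := hM _ hqM
  have hfin : (Ψ.trans Φ) f = truncate w M (Φ f) := by
    rw [AlgEquiv.trans_apply, hΨf, map_add, map_neg, AlgEquiv.apply_symm_apply, hq]
    ring
  obtain ⟨⟨g, hg⟩, -⟩ := hΨ.trans hΦ
  refine ⟨Ψ.trans Φ, g, hg.map_X, fun i => Or.inr ?_, fun d hd' hdS => ?_⟩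
  · have h1 : wt w (X i) = (w i : ℕ) := by
      rw [wt, coe_X, MvPowerSeries.X, weightedOrder_monomial_of_ne_zero w one_ne_zero,
        weight_single, one_mul]
    have h2 := le_weightedOrder_iff.mpr (hg.mem i)
    rw [h1]
    exact lt_of_lt_of_le (by exact_mod_cast Nat.lt_succ_self _) h2
  · rw [hfin, coeff_truncate]
    split_ifs with h
    · exact hΦS d (by exact_mod_cast hwt.trans_lt hd') h hdS
    · rfl

end ConvSeries

/-! ### A preparation theorem with estimates. -/

namespace ConvergentSeries

open MvPowerSeries

variable {n : ℕ}

/-- The exponent in the box `{0, …, k - 1}ⁿ` with given entries. -/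
def boxExponent {k : ℕ} (d : Fin n → Fin k) : Fin n →₀ ℕ :=
  Finsupp.equivFunOnFinite.symm fun i => (d i : ℕ)

lemma boxExponent_injective (k : ℕ) :
    Function.Injective (boxExponent : (Fin n → Fin k) → Fin n →₀ ℕ) := fun _ _ h =>
  funext fun i => Fin.ext (DFunLike.congr_fun h i)

/-- Division of a series by the powers `x_i ^ k`, with norm bounds. -/
lemma exists_box_division (k : ℕ) (ρ : Fin n → ℝ≥0∞) (h : MvPowerSeries (Fin n) ℂ) :
    ∃ H : Fin n → MvPowerSeries (Fin n) ℂ,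
      h = ∑ d : Fin n → Fin k, monomial (boxExponent d) (coeff (boxExponent d) h) +
        ∑ i, X i ^ k * H i ∧
      ∀ i, ρ i ^ k * polyNorm ρ (H i) ≤ polyNorm ρ h := by
  classical
  set p : MvPowerSeries (Fin n) ℂ :=
    ∑ d : Fin n → Fin k, monomial (boxExponent d) (coeff (boxExponent d) h) with hp
  have hpin : ∀ d : Fin n → Fin k, coeff (boxExponent d) p = coeff (boxExponent d) h := by
    intro d
    rw [hp, map_sum, Finset.sum_eq_single d]
    · rw [coeff_monomial_same]
    · intro e _ he
      rw [coeff_monomial_ne]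
      exact fun h => he (boxExponent_injective k h.symm)
    · simp
  have hpout : ∀ e : Fin n →₀ ℕ, (∃ i, k ≤ e i) → coeff e p = 0 := by
    rintro e ⟨i, hi⟩
    rw [hp, map_sum]
    refine Finset.sum_eq_zero fun d _ => coeff_monomial_ne ?_ _
    rintro rfl
    exact absurd (d i).2 (not_lt.mpr hi)
  have hbox : ∀ e : Fin n →₀ ℕ, (∀ i, e i < k) → ∃ d : Fin n → Fin k, e = boxExponent d :=
    fun e he => ⟨fun i => ⟨e i, he i⟩, Finsupp.ext fun i => rfl⟩
  obtain ⟨H, hH, hHc⟩ := exists_eq_sum_monomial_mul (fun i : Fin n => Finsupp.single i k) (h - p)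
    (by
      intro e he
      by_contra! hlt
      obtain ⟨d, rfl⟩ := hbox e fun i => by
        have := hlt i
        rw [Finsupp.single_le_iff] at this
        omega
      exact he (by rw [map_sub, hpin, sub_self]))
  refine ⟨H, ?_, fun i => ?_⟩
  · simp only [X_pow_eq]
    rw [← hH]
    ring
  · have h1 := mul_polyNorm_le_of_coeff ρ (hHc i)
    rw [Finset.prod_eq_single i (by
      intro j _ hj
      rw [Finsupp.single_eq_of_ne hj, pow_zero]) (by simp), Finsupp.single_eq_same] at h1
    -- Removing the box part only deletes coefficients of `h`.
    refine h1.trans (polyNorm_mono ρ fun e => ?_)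
    by_cases he : ∃ i, k ≤ e i
    · rw [map_sub, hpout e he, sub_zero]
    · push Not at he
      obtain ⟨d, rfl⟩ := hbox e he
      rw [map_sub, hpin, sub_self]
      simp

/-- The series in one variable with given coefficients. -/
def seriesOfSeq (c : ℕ → ℂ) : MvPowerSeries (Fin 1) ℂ := fun e => c (e 0)

lemma coeff_seriesOfSeq (c : ℕ → ℂ) (e : Fin 1 →₀ ℕ) : coeff e (seriesOfSeq c) = c (e 0) := rfl

lemma polyNorm_seriesOfSeq_le (c : ℕ → ℂ) (s : ℝ≥0∞) :
    polyNorm (fun _ => s) (seriesOfSeq c) ≤ ∑' N, ‖c N‖ₑ * s ^ N := by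
  have hinj : Function.Injective fun e : Fin 1 →₀ ℕ => e 0 := fun a b h =>
    Finsupp.ext fun i => by rw [Subsingleton.elim i 0]; exact h
  refine le_trans (le_of_eq (tsum_congr fun e => ?_))
    (ENNReal.tsum_comp_le_tsum_of_injective hinj fun N => ‖c N‖ₑ * s ^ N)
  rw [coeff_seriesOfSeq]
  simp

/-- Identifies the substituted series with the formal limit of `∑ c_M y ^ M`, the form in which the
iteration of `exists_expansion` produces it. -/
lemma subst_seriesOfSeq_sub_mem {y : MvPowerSeries (Fin n) ℂ} (hy : constantCoeff y = 0)
    (c : ℕ → ℂ) (N : ℕ) :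
    subst (fun _ : Fin 1 => y) (seriesOfSeq c) - ∑ M ∈ Finset.range N, C (c M) * y ^ M ∈
      weightIdeal (fun _ => 1) N := by
  classical
  have hs : HasSubst fun _ : Fin 1 => y := hasSubst_of_constantCoeff_zero fun _ => hy
  have hy1 : y ∈ weightIdeal (fun _ => 1) 1 := (mem_weightIdeal_one_iff fun _ => one_pos).mpr hy
  have hmem : seriesOfSeq c - ∑ M ∈ Finset.range N, monomial (Finsupp.single 0 M) (c M) ∈
      weightIdeal (fun _ : Fin 1 => 1) N := by
    intro e he
    have hwe : Finsupp.weight (fun _ : Fin 1 => 1) e = e 0 := by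
      rw [Finsupp.weight_apply, Finsupp.sum_fintype _ _ (by simp)]
      simp
    have hee : e = Finsupp.single 0 (e 0) := Finsupp.ext fun i => by
      rw [Subsingleton.elim i 0, Finsupp.single_eq_same]
    rw [map_sub, map_sum, coeff_seriesOfSeq, Finset.sum_eq_single (e 0)]
    · rw [← hee, coeff_monomial_same, sub_self]
    · intro M _ hM
      refine coeff_monomial_ne ?_ _
      intro h
      rw [h, Finsupp.single_eq_same] at hM
      exact hM rfl
    · intro h
      rw [Finset.mem_range] at h
      omega
  have := subst_mem_weightIdeal (w := fun _ : Fin n => 1) hs (fun _ => hy1) hmem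
  rw [← coe_substAlgHom hs, map_sub, map_sum] at this
  simp only [substAlgHom_monomial] at this
  rw [coe_substAlgHom] at this
  convert this using 2
  refine Finset.sum_congr rfl fun M _ => ?_
  rw [Finsupp.prod_single_index (by simp)]
  rfl

end ConvergentSeries

namespace ConvSeries

open ConvergentSeries MvPowerSeries

variable {n : ℕ}

/-- Preparation: if modulo `Q` some powers of all variables are multiples of `y`, then every
series is modulo `Q` a combination of finitely many monomials with coefficients convergent series
in `y`. -/
lemma exists_expansion {Q : Ideal (ConvSeries n)} {y : ConvSeries n}
    (hy : constantCoeff (y : MvPowerSeries (Fin n) ℂ) = 0) {k : ℕ}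
    (hk : ∀ i, X i ^ k ∈ Q ⊔ Ideal.span {y}) :
    ∀ᶠ r in 𝓝[>] (0 : ℝ≥0∞), ∃ s : ℝ≥0∞, 0 < s ∧ ∀ h : ConvSeries n,
      polyNorm (fun _ => r) (h : MvPowerSeries (Fin n) ℂ) < ⊤ →
      ∃ a : (Fin n → Fin k) → ConvSeries 1,
        (∀ d, polyNorm (fun _ => s) (a d : MvPowerSeries (Fin 1) ℂ) < ⊤) ∧
        h - ∑ d, substHom (fun _ => y) (fun _ => hy) (a d) * mono (boxExponent d) ∈ Q := by
  classical
  have hone : ∀ {m : ℕ} (_ : Fin m), 0 < 1 := fun _ => one_pos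
  have hrad : ∀ {m : ℕ} (r : ℝ≥0∞), radius (fun _ : Fin m => 1) r = fun _ => r := fun r =>
    funext fun _ => pow_one r
  have hsplit : ∀ i, ∃ q v : ConvSeries n, q ∈ Q ∧ X i ^ k = q + v * y := by
    intro i
    obtain ⟨q, hq, z, hz, hqz⟩ := Submodule.mem_sup.mp (hk i)
    obtain ⟨v, rfl⟩ := Ideal.mem_span_singleton'.mp hz
    exact ⟨q, v, hq, hqz.symm⟩
  choose q v hq hqv using hsplit
  filter_upwards [eventually_all.mpr fun i => converges (w := fun _ => 1) hone (v i),
    eventually_le_nhdsGT_zero one_pos, self_mem_nhdsWithin] with r hv hr1 hr0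
  have hr0 : 0 < r := hr0
  have hrt : r < ⊤ := hr1.trans_lt ENNReal.one_lt_top
  simp only [hrad] at hv
  set V : ℝ≥0∞ := (r ^ k)⁻¹ with hV
  have hVt : V < ⊤ := ENNReal.inv_lt_top.mpr (ENNReal.pow_pos hr0 _)
  set A : ℝ≥0∞ := (∑ i, polyNorm (fun _ => r) (v i : MvPowerSeries (Fin n) ℂ)) * V with hA
  have hAt : A < ⊤ := ENNReal.mul_lt_top (ENNReal.sum_lt_top.mpr fun i _ => hv i) hVt
  -- `s` depends on `r` but not on `h`, so one radius in the parameter serves the whole algebra of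
  -- the polydisc.
  obtain ⟨s, hsA, hs0⟩ :=
    ((eventually_mul_le hAt (δ := 2⁻¹) (by norm_num)).and self_mem_nhdsWithin).exists
  have hs0 : 0 < s := hs0
  refine ⟨s, hs0, fun h hh => ?_⟩
  choose D hD hDn using fun h : MvPowerSeries (Fin n) ℂ =>
    exists_box_division k (fun _ => r) h
  have hDn' : ∀ h i, polyNorm (fun _ => r) (D h i) ≤ V * polyNorm (fun _ => r) h := by
    intro h i
    rw [hV, ← ENNReal.div_eq_inv_mul, ENNReal.le_div_iff_mul_le
      (Or.inl (ENNReal.pow_pos hr0 _).ne') (Or.inl (ENNReal.pow_lt_top hrt).ne), mul_comm]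
    exact hDn h i
  -- Division by the `x_i ^ k = q i + v i * y` gives `h = box part + (element of Q) + y * T h` when
  -- the `D h i` converge. Iterating expands `h` in powers of `y`; the norms of the iterates grow at
  -- most like `A ^ N`, and `s A ≤ 1/2`.
  let T : MvPowerSeries (Fin n) ℂ → MvPowerSeries (Fin n) ℂ :=
    fun h => ∑ i, (v i : MvPowerSeries (Fin n) ℂ) * D h i
  have hTn : ∀ h, polyNorm (fun _ => r) (T h) ≤ A * polyNorm (fun _ => r) h := by
    intro h
    refine (polyNorm_sum_le _ _ _).trans ?_
    rw [hA, mul_assoc, Finset.sum_mul]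
    exact Finset.sum_le_sum fun i _ => (polyNorm_mul_le _ _ _).trans
      (mul_le_mul' le_rfl (hDn' h i))
  let t : ℕ → MvPowerSeries (Fin n) ℂ := fun N => T^[N] h
  have ht : ∀ N, t (N + 1) = T (t N) := fun N => Function.iterate_succ_apply' T N _
  have htn : ∀ N, polyNorm (fun _ => r) (t N) ≤
      A ^ N * polyNorm (fun _ => r) (h : MvPowerSeries (Fin n) ℂ) := by
    intro N
    induction N with
    | zero => simp [t]
    | succ N ih =>
      rw [ht, pow_succ', mul_assoc]
      exact (hTn _).trans (mul_le_mul' le_rfl ih)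
  set Y : MvPowerSeries (Fin n) ℂ := (y : MvPowerSeries (Fin n) ℂ) with hY
  have hy1 : Y ∈ weightIdeal (fun _ => 1) 1 := (mem_weightIdeal_one_iff hone).mpr hy
  have hypow : ∀ N, Y ^ N ∈ weightIdeal (fun _ => 1) N := fun N => by
    simpa using pow_mem_weightIdeal hy1 N
  let c : (Fin n → Fin k) → ℕ → ℂ := fun d N => MvPowerSeries.coeff (boxExponent d) (t N)
  have hstep : ∀ N, t N = ∑ d, monomial (boxExponent d) (c d N) +
      ∑ i, (q i : MvPowerSeries (Fin n) ℂ) * D (t N) i + Y * t (N + 1) := by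
    intro N
    have h1 : ∀ i, (MvPowerSeries.X i : MvPowerSeries (Fin n) ℂ) ^ k =
        (q i : MvPowerSeries (Fin n) ℂ) + v i * Y := fun i => by
      have := congrArg (ConvSeries n).val (hqv i)
      simpa [coe_X] using this
    refine (hD (t N)).trans ?_
    rw [add_assoc]
    congr 1
    rw [ht]
    simp only [T, Finset.mul_sum]
    rw [← Finset.sum_add_distrib]
    refine Finset.sum_congr rfl fun i _ => ?_
    rw [h1]
    ring
  have hexp : ∀ N, (h : MvPowerSeries (Fin n) ℂ) = ∑ M ∈ Finset.range N, Y ^ M *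
      (∑ d, monomial (boxExponent d) (c d M) + ∑ i, (q i : MvPowerSeries (Fin n) ℂ) * D (t M) i) +
        Y ^ N * t N := by
    intro N
    induction N with
    | zero => simp [t]
    | succ N ih =>
      rw [Finset.sum_range_succ]
      refine ih.trans ?_
      conv_lhs => rw [hstep N]
      ring
  have hgeom : ∑' N : ℕ, (2⁻¹ : ℝ≥0∞) ^ N < ⊤ := by
    rw [ENNReal.tsum_geometric, ENNReal.inv_lt_top]
    norm_num
  have hc : ∀ d, polyNorm (fun _ => s) (seriesOfSeq (c d)) < ⊤ := by
    intro d
    set B := (∏ i, r ^ boxExponent d i)⁻¹ *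
      polyNorm (fun _ => r) (h : MvPowerSeries (Fin n) ℂ) with hB
    have hprod : 0 < ∏ i, r ^ boxExponent d i := by
      rw [Finset.prod_pow_eq_pow_sum]
      exact ENNReal.pow_pos hr0 _
    have hprodt : ∏ i, r ^ boxExponent d i ≠ ⊤ := by
      rw [Finset.prod_pow_eq_pow_sum]
      exact (ENNReal.pow_lt_top hrt).ne
    have hBt : B < ⊤ := ENNReal.mul_lt_top (ENNReal.inv_lt_top.mpr hprod) hh
    refine (polyNorm_seriesOfSeq_le _ _).trans_lt (lt_of_le_of_lt
      (b := ∑' N : ℕ, B * 2⁻¹ ^ N) (ENNReal.tsum_le_tsum fun N => ?_) ?_)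
    · have h1 : ‖c d N‖ₑ ≤ B * A ^ N := by
        have := (coeff_mul_le_polyNorm (fun _ => r) (t N) (boxExponent d)).trans (htn N)
        rw [← ENNReal.le_div_iff_mul_le (Or.inl hprod.ne') (Or.inl hprodt)] at this
        refine this.trans (le_of_eq ?_)
        rw [hB, div_eq_mul_inv]
        ring
      calc ‖c d N‖ₑ * s ^ N ≤ B * A ^ N * s ^ N := by gcongr
        _ = B * (s * A) ^ N := by rw [mul_pow]; ring
        _ ≤ B * 2⁻¹ ^ N := by gcongr
    · rw [ENNReal.tsum_mul_left]
      exact ENNReal.mul_lt_top hBt hgeom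
  -- Summing the cofactors of each `q i` over all steps, on a radius where `y` has norm at most `s`,
  -- exhibits the error as a finite combination of the `q i`. No closedness of the ideal `Q` is
  -- needed.
  have hU : ∀ i, ∃ U : ConvSeries n, ∀ N, (U : MvPowerSeries (Fin n) ℂ) -
      ∑ M ∈ Finset.range N, Y ^ M * D (t M) i ∈ weightIdeal (fun _ => 1) N := by
    intro i
    obtain ⟨U, hU, hUn⟩ := exists_formal_sum (fun _ => 1) (fun N => Y ^ N * D (t N) i)
      fun N => Ideal.mul_mem_right _ _ (hypow N)
    refine ⟨⟨U, (mem_iff_converges (w := fun _ => 1) hone).mpr ?_⟩, hU⟩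
    filter_upwards [(converges (w := fun _ => 1) hone y).eventually_le_const hy1 hs0,
      eventually_le_nhdsGT_zero hr0] with r' hr' hr'r
    rw [hrad] at hr' ⊢
    set B := V * polyNorm (fun _ => r) (h : MvPowerSeries (Fin n) ℂ) with hB
    refine (hUn _).trans_lt (lt_of_le_of_lt
      (b := ∑' N : ℕ, B * 2⁻¹ ^ N) (ENNReal.tsum_le_tsum fun N => ?_) ?_)
    · calc polyNorm (fun _ => r') (Y ^ N * D (t N) i)
          ≤ s ^ N * (V * (A ^ N * polyNorm (fun _ => r) (h : MvPowerSeries (Fin n) ℂ))) := by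
            refine (polyNorm_mul_le _ _ _).trans (mul_le_mul' ((polyNorm_pow_le _ _ _).trans
              (pow_le_pow_left' hr' N)) ?_)
            refine (polyNorm_mono_radius (fun _ => hr'r) _).trans ((hDn' _ _).trans ?_)
            exact mul_le_mul' le_rfl (htn N)
        _ = B * (s * A) ^ N := by rw [hB, mul_pow]; ring
        _ ≤ B * 2⁻¹ ^ N := by gcongr
    · rw [ENNReal.tsum_mul_left]
      exact ENNReal.mul_lt_top (ENNReal.mul_lt_top hVt hh) hgeom
  choose U hU using hU
  let a : (Fin n → Fin k) → ConvSeries 1 := fun d => ⟨seriesOfSeq (c d),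
    (mem_iff_converges (w := fun _ => 1) hone).mpr
      (Converges.of_radius hs0 (by rw [hrad]; exact hc d))⟩
  refine ⟨a, hc, ?_⟩
  have hsum : h - ∑ d, substHom (fun _ => y) (fun _ => hy) (a d) * mono (boxExponent d) =
      ∑ i, q i * U i := by
    refine Subtype.ext (eq_of_forall_sub_mem_weightIdeal (w := fun _ => 1) fun N => ?_)
    push_cast
    simp only [coe_substHom]
    rw [hexp N]
    have hmono : ∀ d : Fin n → Fin k, ((mono (boxExponent d) : ConvSeries n) :
      MvPowerSeries (Fin n) ℂ) = monomial (boxExponent d) 1 := fun _ => rfl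
    have hid : (∑ M ∈ Finset.range N, Y ^ M * (∑ d, monomial (boxExponent d) (c d M) +
          ∑ i, (q i : MvPowerSeries (Fin n) ℂ) * D (t M) i) + Y ^ N * t N) -
        ∑ d, subst (fun _ : Fin 1 => Y) (seriesOfSeq (c d)) * monomial (boxExponent d) 1 -
        ∑ i, (q i : MvPowerSeries (Fin n) ℂ) * U i = Y ^ N * t N -
        ∑ d, (subst (fun _ : Fin 1 => Y) (seriesOfSeq (c d)) -
          ∑ M ∈ Finset.range N, C (c d M) * Y ^ M) * monomial (boxExponent d) 1 -
        ∑ i, (q i : MvPowerSeries (Fin n) ℂ) * (U i - ∑ M ∈ Finset.range N, Y ^ M * D (t M) i) := by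
      have e1 : ∑ M ∈ Finset.range N, Y ^ M * (∑ d, monomial (boxExponent d) (c d M) +
          ∑ i, (q i : MvPowerSeries (Fin n) ℂ) * D (t M) i) =
          ∑ d, (∑ M ∈ Finset.range N, C (c d M) * Y ^ M) * monomial (boxExponent d) 1 +
          ∑ i, (q i : MvPowerSeries (Fin n) ℂ) * ∑ M ∈ Finset.range N, Y ^ M * D (t M) i := by
        simp only [mul_add, Finset.sum_add_distrib, Finset.mul_sum, Finset.sum_mul]
        congr 1
        · rw [Finset.sum_comm]
          refine Finset.sum_congr rfl fun d _ => Finset.sum_congr rfl fun M _ => ?_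
          have : (monomial (boxExponent d) (c d M) : MvPowerSeries (Fin n) ℂ) =
              C (c d M) * monomial (boxExponent d) 1 := by
            rw [← monomial_zero_eq_C_apply, monomial_mul_monomial, zero_add, mul_one]
          rw [this]
          ring
        · rw [Finset.sum_comm]
          exact Finset.sum_congr rfl fun d _ => Finset.sum_congr rfl fun M _ => by ring
      simp only [sub_mul, mul_sub, Finset.sum_sub_distrib]
      rw [e1]
      ring
    simp only [hmono]
    change (∑ M ∈ Finset.range N, Y ^ M * (∑ d, monomial (boxExponent d) (c d M) +
          ∑ i, (q i : MvPowerSeries (Fin n) ℂ) * D (t M) i) + Y ^ N * t N) -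
        ∑ d, subst (fun _ : Fin 1 => Y) (seriesOfSeq (c d)) * monomial (boxExponent d) 1 -
        ∑ i, (q i : MvPowerSeries (Fin n) ℂ) * U i ∈ _
    rw [hid]
    refine sub_mem (sub_mem (Ideal.mul_mem_right _ _ (hypow N)) (sum_mem fun d _ => ?_))
      (sum_mem fun i _ => Ideal.mul_mem_left _ _ (hU i N))
    exact Ideal.mul_mem_right _ _ (subst_seriesOfSeq_sub_mem hy (c d) N)
  rw [hsum]
  exact Ideal.sum_mem _ fun i _ => Ideal.mul_mem_right _ _ (hq i)

end ConvSeries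

/-! ### Extending derivations. -/

/-- A derivation into an algebraic field extension of characteristic zero extends. -/
lemma exists_derivation_extension {k B K : Type*} [Field k] [CharZero k] [CommRing B] [IsDomain B]
    [Field K] [Algebra k B] [Algebra k K] [Algebra B K] [IsScalarTower k B K] [FaithfulSMul B K]
    [Algebra.IsAlgebraic B K] (d : Derivation k B K) :
    ∃ D : Derivation k K K, ∀ b, D (algebraMap B K b) = d b := by
  let _ : Algebra (FractionRing B) K := FractionRing.liftAlgebra B K
  have : IsScalarTower B (FractionRing B) K := FractionRing.isScalarTower_liftAlgebra B K
  have : CharZero (FractionRing B) :=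
    charZero_of_injective_algebraMap (algebraMap k (FractionRing B)).injective
  have : Algebra.IsAlgebraic (FractionRing B) K :=
    (IsFractionRing.comap_isAlgebraic_iff (A := B)).mp inferInstance
  -- Localisation is formally étale, and so is an algebraic extension of a field of characteristic
  -- zero. Hence `K` is formally étale over `B`, and the differentials of `K` are those of `B` after
  -- base change.
  have := Algebra.FormallyEtale.of_isSeparable (FractionRing B) K
  have := Algebra.FormallyEtale.of_isLocalization (Rₘ := FractionRing B) (nonZeroDivisors B)
  have : Algebra.FormallyEtale B K := Algebra.FormallyEtale.comp B (FractionRing B) K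
  refine ⟨((d.liftKaehlerDifferential.liftBaseChange K).comp
    (KaehlerDifferential.tensorKaehlerEquivOfFormallyEtale k B K).symm.toLinearMap).compDer
      (KaehlerDifferential.D k K), fun b => ?_⟩
  simp [KaehlerDifferential.tensorKaehlerEquivOfFormallyEtale_symm_D_algebraMap]

/-- Let `D` be a domain that is finite over a differential ring `B`, and a quotient of a ring `O`
with partial derivatives `∂ i`. If the image of an element `y` in `D` comes from an element of `B` of
derivative one, but all partial derivatives of `y` vanish in `D`, then the intersection of the
ideals of `D` generated by the powers of the coordinates is not zero. -/
lemma exists_ne_zero_forall_mem_span_pow {k O D B ι : Type*} [Field k] [CharZero k] [CommRing O]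
    [CommRing D] [IsDomain D] [CommRing B] [IsDomain B] [Finite ι] [Algebra k O] [Algebra k D]
    [Algebra k B] [Algebra O D] [Algebra B D] [IsScalarTower k O D] [IsScalarTower k B D]
    [FaithfulSMul B D] [Module.Finite B D] (d : Derivation k B B) (pd : ι → Derivation k O O)
    (x : ι → O) (hself : ∀ i, pd i (x i) = 1) (hne : ∀ i j, i ≠ j → pd i (x j) = 0) (y : O) (t : B)
    (hyt : algebraMap O D y = algebraMap B D t) (ht : d t = 1)
    (hy : ∀ i, algebraMap O D (pd i y) = 0)
    (hyN : ∀ N, ∃ p ∈ Algebra.adjoin k (Set.range x),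
      y - p ∈ Ideal.span (Set.range fun i => x i ^ N)) :
    ∃ z : D, z ≠ 0 ∧ ∀ N, z ∈ Ideal.span (Set.range fun i => algebraMap O D (x i) ^ N) := by
  classical
  cases nonempty_fintype ι
  let K := FractionRing D
  have : FaithfulSMul B K := FaithfulSMul.trans B D K
  have : Algebra.IsAlgebraic B K :=
    (IsFractionRing.isAlgebraic_iff' B D K).mp inferInstance
  obtain ⟨Δ, hΔ⟩ := exists_derivation_extension (K := K)
    (((Algebra.linearMap B K).compDer d : Derivation k B K))
  have hΔ' : ∀ b, Δ (algebraMap D K (algebraMap B D b)) = algebraMap B K (d b) := fun b => by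
    rw [← IsScalarTower.algebraMap_apply B D K, hΔ]
    rfl
  -- The defect in the chain rule for `Δ`. It kills the coordinates and hence polynomials, yet takes
  -- the value `1` at `y`.
  let δ : Derivation k O K := Δ.compAlgebraMap O -
    ∑ i, (LinearMap.toSpanSingleton O K (Δ (algebraMap O K (x i)))).compDer (pd i)
  have hδ : ∀ h, δ h = Δ (algebraMap O K h) -
      ∑ i, algebraMap O K (pd i h) * Δ (algebraMap O K (x i)) := by
    intro h
    have hsum : (∑ i, (LinearMap.toSpanSingleton O K (Δ (algebraMap O K (x i)))).compDer (pd i) :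
        Derivation k O K) h = ∑ i, algebraMap O K (pd i h) * Δ (algebraMap O K (x i)) := by
      rw [← Derivation.coeFnAddMonoidHom_apply, map_sum, Finset.sum_apply]
      refine Finset.sum_congr rfl fun i _ => ?_
      rw [Derivation.coeFnAddMonoidHom_apply, ← Algebra.smul_def]
      rfl
    rw [Derivation.sub_apply, hsum]
    rfl
  have hδx : ∀ i, δ (x i) = 0 := by
    intro i
    rw [hδ, Finset.sum_eq_single i, hself, map_one, one_mul, sub_self]
    · intro j _ hj
      rw [hne j i hj, map_zero, zero_mul]
    · simp
  have hδadj : ∀ p ∈ Algebra.adjoin k (Set.range x), δ p = 0 := by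
    have := Derivation.eqOn_adjoin (D1 := δ) (D2 := 0) (s := Set.range x) (by
      rintro _ ⟨i, rfl⟩
      exact hδx i)
    exact fun p hp => this hp
  have hOD : ∀ h : O, algebraMap O K h = algebraMap D K (algebraMap O D h) :=
    IsScalarTower.algebraMap_apply O D K
  have hδy : δ y = 1 := by
    rw [hδ, hOD y, hyt, hΔ', ht, map_one, Finset.sum_eq_zero, sub_zero]
    intro i _
    rw [hOD (pd i y), hy, map_zero, zero_mul]
  obtain ⟨m, s, hs⟩ := Module.Finite.exists_fin (R := B) (M := D)
  -- As `D` is finite over `B` and `Δ` preserves the image of `B`, a denominator common to the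
  -- values on the generators and the coordinates works for all values of `Δ` on `D`, and then of
  -- `δ` on `O`.
  obtain ⟨c, hc⟩ := IsLocalization.exist_integer_multiples_of_finite (nonZeroDivisors D)
    (Sum.elim (fun j => Δ (algebraMap D K (s j))) fun i => Δ (algebraMap O K (x i)))
  have hcΔ : ∀ z : D, ∃ u : D, algebraMap D K u = algebraMap D K c * Δ (algebraMap D K z) := by
    intro z
    have hz : z ∈ Submodule.span B (Set.range s) := hs ▸ Submodule.mem_top
    induction hz using Submodule.span_induction with
    | mem z hz =>
      obtain ⟨j, rfl⟩ := hz
      obtain ⟨u, hu⟩ := hc (Sum.inl j)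
      exact ⟨u, hu.trans (Algebra.smul_def _ _)⟩
    | zero => exact ⟨0, by simp⟩
    | add a b _ _ ha hb =>
      obtain ⟨u, hu⟩ := ha
      obtain ⟨v, hv⟩ := hb
      exact ⟨u + v, by rw [map_add, map_add, map_add, mul_add, hu, hv]⟩
    | smul b a _ ha =>
      obtain ⟨u, hu⟩ := ha
      refine ⟨algebraMap B D b * u + c * (a * algebraMap B D (d b)), ?_⟩
      rw [Algebra.smul_def, map_mul (algebraMap D K), Derivation.leibniz, hΔ', smul_eq_mul,
        smul_eq_mul, map_add, map_mul, map_mul, map_mul, hu,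
        ← IsScalarTower.algebraMap_apply B D K (d b)]
      ring
  have hcδ : ∀ h : O, ∃ u : D, algebraMap D K u = algebraMap D K c * δ h := by
    intro h
    obtain ⟨u, hu⟩ := hcΔ (algebraMap O D h)
    choose v hv using fun i => hc (Sum.inr i)
    refine ⟨u - ∑ i, algebraMap O D (pd i h) * v i, ?_⟩
    rw [map_sub, map_sum, hδ, mul_sub, hu, Finset.mul_sum, hOD h]
    congr 1
    refine Finset.sum_congr rfl fun i _ => ?_
    rw [map_mul, hv i, Sum.elim_inr, Algebra.smul_def, hOD (pd i h)]
    ring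
  refine ⟨c, nonZeroDivisors.ne_zero c.2, fun N => ?_⟩
  obtain ⟨p, hp, hyp⟩ := hyN N
  obtain ⟨h, hh⟩ := Ideal.mem_span_range_iff_exists_fun.mp hyp
  choose u hu using fun i => hcδ (h i)
  -- Write `y = p + ∑ h_i x_i ^ N` with `p` polynomial. Since `δ` kills `p` and the `x_i ^ N`,
  -- applying `c δ` gives `c = ∑ (c δ h_i) x_i ^ N`.
  have key : (c : D) = ∑ i, u i * algebraMap O D (x i) ^ N := by
    refine IsFractionRing.injective D K ?_
    have h1 : δ y = ∑ i, algebraMap O K (x i) ^ N * δ (h i) := by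
      rw [← sub_add_cancel y p, map_add, hδadj p hp, add_zero, ← hh, map_sum]
      refine Finset.sum_congr rfl fun i _ => ?_
      rw [Derivation.leibniz, hδadj _ (pow_mem (Algebra.subset_adjoin (Set.mem_range_self i)) N), smul_zero,
        zero_add, Algebra.smul_def, map_pow]
    rw [hδy] at h1
    rw [map_sum, ← mul_one (algebraMap D K c), h1, Finset.mul_sum]
    refine Finset.sum_congr rfl fun i _ => ?_
    rw [map_mul, hu, map_pow, hOD (x i)]
    ring
  rw [key]
  exact Ideal.sum_mem _ fun i _ => Ideal.mul_mem_left _ _ (Ideal.subset_span ⟨i, rfl⟩)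

/-! ### Prime quotients of `ℂ{x}` with a parameter. -/

namespace ConvSeries

open ConvergentSeries MvPowerSeries

variable {n : ℕ}

instance : IsDomain (ConvSeries n) :=
  have : NoZeroDivisors (ConvSeries n) :=
    Function.Injective.noZeroDivisors (ConvSeries n).val Subtype.val_injective rfl fun _ _ => rfl
  NoZeroDivisors.to_isDomain _

/-- On a small polydisc the non-constant part has norm less than the constant term, so the Neumann
series converges. -/
lemma isUnit_of_constantCoeff_ne_zero {f : ConvSeries n}
    (hf : constantCoeff (f : MvPowerSeries (Fin n) ℂ) ≠ 0) : IsUnit f := by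
  have hone : ∀ i : Fin n, 0 < (fun _ => 1 : Fin n → ℕ) i := fun _ => one_pos
  set c := constantCoeff (f : MvPowerSeries (Fin n) ℂ) with hc
  have hC : Converges (fun _ => 1) (C c : MvPowerSeries (Fin n) ℂ) :=
    Eventually.of_forall fun r => by simp [polyNorm_C]
  have hv : C c - (f : MvPowerSeries (Fin n) ℂ) ∈ weightIdeal (fun _ => 1) 1 :=
    (mem_weightIdeal_one_iff hone).mpr (by simp [hc])
  have hc0 : ‖c‖ₑ ≠ 0 := by simpa using hf
  obtain ⟨r, hr, hr0⟩ := (((hC.sub (converges hone f)).eventually_le_const hv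
    (ENNReal.half_pos hc0)).and self_mem_nhdsWithin).exists
  obtain ⟨z, hz, hzn⟩ := exists_inverse_polyNorm_lt_top (radius (fun _ => 1) r) hv
    (hr.trans_lt (ENNReal.half_lt_self hc0 enorm_ne_top))
  rw [sub_sub_cancel] at hz
  exact IsUnit.of_mul_eq_one
    (⟨z, (mem_iff_converges hone).mpr (Converges.of_radius hr0 hzn)⟩ : ConvSeries n)
    (Subtype.ext hz)

/-- A non-zero convergent series in one variable is a power of the variable times a unit. -/
lemma exists_eq_X_pow_mul {b : ConvSeries 1} (hb : b ≠ 0) :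
    ∃ (s : ℕ) (u : ConvSeries 1), constantCoeff (u : MvPowerSeries (Fin 1) ℂ) ≠ 0 ∧
      b = X 0 ^ s * u := by
  classical
  have hsingle : ∀ e : Fin 1 →₀ ℕ, e = Finsupp.single 0 (e 0) := fun e => Finsupp.ext fun i => by
    rw [Subsingleton.elim i 0, Finsupp.single_eq_same]
  have hex : ∃ s, MvPowerSeries.coeff (Finsupp.single 0 s) (b : MvPowerSeries (Fin 1) ℂ) ≠ 0 := by
    by_contra! h
    refine hb (Subtype.ext (MvPowerSeries.ext fun e => ?_))
    rw [hsingle e, h]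
    simp
  set s := Nat.find hex
  obtain ⟨H, hH, hHc⟩ := exists_eq_sum_monomial_mul (fun _ : Unit => Finsupp.single (0 : Fin 1) s)
    (b : MvPowerSeries (Fin 1) ℂ) (by
      intro e he
      refine ⟨(), ?_⟩
      rw [hsingle e] at he
      rw [Finsupp.single_le_iff]
      exact Nat.find_min' hex he)
  have hone : ∀ i : Fin 1, 0 < (fun _ => 1 : Fin 1 → ℕ) i := fun _ => one_pos
  rw [Fintype.sum_unique] at hH
  refine ⟨s, ⟨H default, (mem_iff_converges hone).mpr
    (Converges.of_coeff (hHc default) (converges hone b))⟩, ?_, Subtype.ext ?_⟩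
  · have h1 : MvPowerSeries.coeff (Finsupp.single 0 s) (b : MvPowerSeries (Fin 1) ℂ) ≠ 0 :=
      Nat.find_spec hex
    rw [hH] at h1
    have h2 := coeff_add_monomial_mul (Finsupp.single (0 : Fin 1) s) 0 (H default) (1 : ℂ)
    rw [add_zero, one_mul] at h2
    rwa [h2] at h1
  · simpa [X_pow_eq, coe_X] using hH

/-- A maximal ideal among those containing no power of the ideal of the origin. -/
lemma exists_isPrime_of_X_pow_notMem {I : Ideal (ConvSeries n)}
    (hI : ∀ k, ∃ i, X i ^ k ∉ I) :
    ∃ Q : Ideal (ConvSeries n), I ≤ Q ∧ Q.IsPrime ∧ (∀ k, ∃ i, X i ^ k ∉ Q) ∧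
      ∀ y ∉ Q, ∃ k, ∀ i, X i ^ k ∈ Q ⊔ Ideal.span {y} := by
  classical
  let J : ℕ → Ideal (ConvSeries n) := fun k => Ideal.span (Set.range fun i => X i ^ k)
  have hJ : ∀ k (Q : Ideal (ConvSeries n)), J k ≤ Q ↔ ∀ i, X i ^ k ∈ Q := fun k Q => by
    rw [Ideal.span_le, Set.range_subset_iff]
    rfl
  -- `J k` is finitely generated, so if it lies in the union of a chain it lies in a member. Zorn's
  -- lemma thus applies without Noetherianity.
  have hJc : ∀ k, IsCompactElement (J k) := fun k =>
    (Submodule.fg_iff_compact _).mp (Submodule.fg_span (Set.finite_range _))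
  obtain ⟨Q, hIQ, hQ⟩ := zorn_le_nonempty₀ {Q : Ideal (ConvSeries n) | ∀ k, ¬ J k ≤ Q} (by
    intro c hc hchain y hy
    refine ⟨sSup c, fun k hk => ?_, fun z hz => le_sSup hz⟩
    obtain ⟨x, hx, hkx⟩ := (CompleteLattice.isCompactElement_iff_le_of_directed_sSup_le _ _).mp
      (hJc k) c ⟨y, hy⟩ hchain.directedOn hk
    exact hc hx k hkx) I (by
    intro k hk
    obtain ⟨i, hi⟩ := hI k
    exact hi ((hJ k I).mp hk i))
  have hQ1 : ∀ k, ¬ J k ≤ Q := hQ.prop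
  have hmax : ∀ y ∉ Q, ∃ k, ∀ i, X i ^ k ∈ Q ⊔ Ideal.span {y} := by
    intro y hy
    by_contra! h
    have hmem : Q ⊔ Ideal.span {y} ∈ {Q : Ideal (ConvSeries n) | ∀ k, ¬ J k ≤ Q} := by
      intro k hk
      obtain ⟨i, hi⟩ := h k
      exact hi ((hJ k _).mp hk i)
    exact hy (hQ.le_of_ge hmem le_sup_left
      (Ideal.mem_sup_right (Ideal.mem_span_singleton_self y)))
  refine ⟨Q, hIQ, ⟨?_, ?_⟩, fun k => ?_, hmax⟩
  · rintro rfl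
    exact hQ1 0 le_top
  · intro a b hab
    by_contra! h
    obtain ⟨k, hk⟩ := hmax a h.1
    obtain ⟨l, hl⟩ := hmax b h.2
    refine hQ1 (k + l) ((hJ _ _).mpr fun i => ?_)
    rw [pow_add]
    have h1 := Ideal.mul_mem_mul (hk i) (hl i)
    -- If neither `a` nor `b` were in `Q`, maximality would put powers of the variables into both
    -- enlarged ideals, hence into their product.
    refine (?_ : (Q ⊔ Ideal.span {a}) * (Q ⊔ Ideal.span {b}) ≤ Q) h1
    rw [Ideal.mul_sup, Ideal.sup_mul, Ideal.sup_mul]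
    refine sup_le (sup_le (Ideal.mul_le_inf.trans inf_le_left) (Ideal.mul_le_inf.trans ?_))
      (sup_le (Ideal.mul_le_inf.trans ?_) ?_)
    · exact inf_le_right
    · exact inf_le_left
    rw [Ideal.span_singleton_mul_span_singleton, Ideal.span_singleton_le_iff_mem]
    exact hab
  · by_contra! h
    exact hQ1 k ((hJ k Q).mpr h)

/-- The partial derivative as a derivation of the algebra of convergent series. -/
def partialDerivation (i : Fin n) : Derivation ℂ (ConvSeries n) (ConvSeries n) :=
  Derivation.mk'
    { toFun := partialDeriv i
      map_add' := fun _ _ => Subtype.ext (map_add (pderiv ℂ i) _ _)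
      map_smul' := fun c _ => Subtype.ext ((pderiv ℂ i).map_smul c _) }
    fun _ _ => Subtype.ext ((pderiv ℂ i).leibniz _ _)

lemma partialDerivation_apply (i : Fin n) (f : ConvSeries n) :
    partialDerivation i f = partialDeriv i f := rfl

lemma partialDeriv_X (i j : Fin n) : partialDeriv i (X j) = if i = j then 1 else 0 := by
  split_ifs with h
  · subst h
    exact Subtype.ext pderiv_X_self
  · exact Subtype.ext (pderiv_X_of_ne (Ne.symm h))

section

variable {D : Type*} [CommRing D] [Algebra ℂ D] (π : ConvSeries n →ₐ[ℂ] D) {y : ConvSeries n}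
  (hy : constantCoeff (y : MvPowerSeries (Fin n) ℂ) = 0)

/-- The homomorphism from convergent series in one variable that sends the variable to the image
of `y`. -/
def paramHom : ConvSeries 1 →ₐ[ℂ] D :=
  π.comp (substHom (fun _ => y) fun _ => hy)

lemma paramHom_X : paramHom π hy (X 0) = π y := by
  change π (substHom (fun _ => y) (fun _ => hy) (X 0)) = _
  congr 1
  refine Subtype.ext ?_
  rw [coe_substHom, coe_X, subst_X (hasSubst_coe fun _ => hy)]

/-- `ℂ{t}` is a discrete valuation ring with uniformiser `t`, and `t` maps to `π y`. -/
lemma exists_paramHom_eq {b : ConvSeries 1} (hb : b ≠ 0) :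
    ∃ (s : ℕ) (u : D), IsUnit u ∧ paramHom π hy b = π y ^ s * u := by
  obtain ⟨s, u, hu, rfl⟩ := exists_eq_X_pow_mul hb
  exact ⟨s, paramHom π hy u, (isUnit_of_constantCoeff_ne_zero hu).map _, by
    rw [map_mul, map_pow, paramHom_X]⟩

lemma paramHom_injective [IsDomain D] (hy0 : π y ≠ 0) :
    Function.Injective (paramHom π hy) := by
  rw [injective_iff_map_eq_zero]
  intro b hb
  by_contra hne
  obtain ⟨s, u, hu, h⟩ := exists_paramHom_eq π hy hne
  rw [h] at hb
  rcases mul_eq_zero.mp hb with h | h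
  · exact hy0 (eq_zero_of_pow_eq_zero h)
  · exact hu.ne_zero h

/-- Presents the quotient as an abstract domain given only with `π`; later arguments equip it with
algebra structures over `ℂ{x}` and `ℂ{t}`. -/
lemma exists_algHom_ker_eq (Q : Ideal (ConvSeries n)) [Q.IsPrime] :
    ∃ (D : Type) (_ : CommRing D) (_ : IsDomain D) (_ : Algebra ℂ D) (π : ConvSeries n →ₐ[ℂ] D),
      Function.Surjective π ∧ RingHom.ker π = Q :=
  ⟨ConvSeries n ⧸ Q, inferInstance, Ideal.Quotient.isDomain Q, inferInstance,
    Ideal.Quotient.mkₐ ℂ Q, Ideal.Quotient.mkₐ_surjective ℂ Q, Ideal.Quotient.mkₐ_ker ℂ Q⟩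

end

end ConvSeries

namespace ConvSeries

open ConvergentSeries MvPowerSeries

variable {n : ℕ}

lemma coe_aeval_X (p : MvPolynomial (Fin n) ℂ) :
    ((MvPolynomial.aeval (X : Fin n → ConvSeries n) p : ConvSeries n) :
      MvPowerSeries (Fin n) ℂ) = p := by
  induction p using MvPolynomial.induction_on with
  | C c => simp [MvPowerSeries.algebraMap_apply]
  | add p q hp hq => simp [hp, hq]
  | mul_X p i hp => simp [hp, coe_X]

lemma exists_mem_adjoin_sub_mem_span (f : ConvSeries n) (N : ℕ) :
    ∃ p ∈ Algebra.adjoin ℂ (Set.range (X : Fin n → ConvSeries n)),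
      f - p ∈ Ideal.span (Set.range fun i => (X i : ConvSeries n) ^ N) := by
  have hone : ∀ i : Fin n, 0 < (fun _ => 1 : Fin n → ℕ) i := fun _ => one_pos
  obtain ⟨p, hp⟩ := exists_mvPolynomial_sub_mem (f : MvPowerSeries (Fin n) ℂ)
    (N * ∑ i : Fin n, 1 + 1 + 0)
  refine ⟨MvPolynomial.aeval X p, ?_, ?_⟩
  · rw [Algebra.adjoin_range_eq_range_aeval]
    exact ⟨p, rfl⟩
  · rw [← coe_aeval_X, ← Subalgebra.coe_sub] at hp
    obtain ⟨H, hH, -, hHc⟩ := exists_eq_sum_X_pow_mul N 0 hp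
    have hHc := hHc (converges hone _)
    refine Ideal.mem_span_range_iff_exists_fun.mpr
      ⟨fun i => ⟨H i, (mem_iff_converges hone).mpr (hHc i)⟩, Subtype.ext ?_⟩
    rw [hH]
    push_cast
    simp only [coe_X]
    exact Finset.sum_congr rfl fun i _ => mul_comm _ _

section

variable {D : Type*} [CommRing D] [Algebra ℂ D] {π : ConvSeries n →ₐ[ℂ] D}
  {y : ConvSeries n} {k : ℕ}

lemma not_isUnit_map [Nontrivial D] (hπ : Function.Surjective π)
    (hy : constantCoeff (y : MvPowerSeries (Fin n) ℂ) = 0) : ¬ IsUnit (π y) := by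
  intro h
  obtain ⟨v, hv⟩ := h.exists_right_inv
  obtain ⟨v, rfl⟩ := hπ v
  have hu : IsUnit (1 - y * v) := isUnit_of_constantCoeff_ne_zero (by simp [hy])
  refine (hu.map π).ne_zero ?_
  rw [map_sub, map_mul, hv, map_one, sub_self]

lemma map_dvd_map_X_pow (hk : ∀ i, X i ^ k ∈ RingHom.ker π ⊔ Ideal.span {y}) (i : Fin n) :
    π y ∣ π (X i) ^ k := by
  obtain ⟨q, hq, v, hv, hqv⟩ := Submodule.mem_sup.mp (hk i)
  obtain ⟨v, rfl⟩ := Ideal.mem_span_singleton'.mp hv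
  refine ⟨π v, ?_⟩
  rw [← map_pow, ← hqv, map_add, (RingHom.mem_ker).mp hq, zero_add, map_mul, mul_comm]

/-- If `y` is a parameter for a quotient domain of `ℂ{x}`, then the partial derivatives of `y` do
not all vanish there. -/
lemma exists_map_partialDeriv_ne_zero [IsDomain D] (hπ : Function.Surjective π)
    (hy : constantCoeff (y : MvPowerSeries (Fin n) ℂ) = 0) (hy0 : π y ≠ 0)
    (hk : ∀ i, X i ^ k ∈ RingHom.ker π ⊔ Ideal.span {y}) : ∃ i, π (partialDeriv i y) ≠ 0 := by
  by_contra! hder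
  have hone : ∀ {m : ℕ} (i : Fin m), 0 < (fun _ => 1 : Fin m → ℕ) i := fun _ => one_pos
  let _ : Algebra (ConvSeries n) D := RingHom.toAlgebra π
  have : IsScalarTower ℂ (ConvSeries n) D :=
    IsScalarTower.of_algebraMap_eq fun c => (π.commutes c).symm
  let _ : Algebra (ConvSeries 1) D := RingHom.toAlgebra (paramHom π hy)
  have hmap : ∀ b, algebraMap (ConvSeries 1) D b = paramHom π hy b := fun _ => rfl
  have : IsScalarTower ℂ (ConvSeries 1) D :=
    IsScalarTower.of_algebraMap_eq fun c => ((paramHom π hy).commutes c).symm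
  have : FaithfulSMul (ConvSeries 1) D :=
    (faithfulSMul_iff_algebraMap_injective _ _).mpr (paramHom_injective π hy hy0)
  have : Module.Finite (ConvSeries 1) D := by
    refine ⟨?_⟩
    have htop : (⊤ : Submodule (ConvSeries 1) D) = Submodule.span _
        (Set.range fun d : Fin n → Fin k => π (mono (boxExponent d))) := by
      refine (eq_top_iff.mpr fun z _ => ?_).symm
      obtain ⟨h, rfl⟩ := hπ z
      obtain ⟨r, hr, hhr⟩ := ((exists_expansion hy hk).and (converges hone h)).exists
      obtain ⟨s, -, hs⟩ := hr
      obtain ⟨a, -, ha⟩ := hs h (by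
        have : radius (fun _ : Fin n => 1) r = fun _ => r := funext fun _ => pow_one r
        rwa [this] at hhr)
      rw [RingHom.mem_ker, map_sub, map_sum, sub_eq_zero] at ha
      rw [ha]
      refine Submodule.sum_mem _ fun d _ => ?_
      rw [map_mul]
      exact Submodule.smul_mem _ (a d) (Submodule.subset_span ⟨d, rfl⟩)
    rw [htop]
    exact Submodule.fg_span (Set.finite_range _)
  obtain ⟨z, hz0, hz⟩ := exists_ne_zero_forall_mem_span_pow (k := ℂ) (O := ConvSeries n)
    (D := D) (B := ConvSeries 1) (partialDerivation 0) partialDerivation X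
    (fun i => by rw [partialDerivation_apply, partialDeriv_X, if_pos rfl])
    (fun i j hij => by rw [partialDerivation_apply, partialDeriv_X, if_neg hij]) y (X 0)
    (paramHom_X π hy).symm (by rw [partialDerivation_apply, partialDeriv_X, if_pos rfl])
    hder (exists_mem_adjoin_sub_mem_span y)
  -- A substitute for Krull's intersection theorem: `z` divides the image of a non-zero `b ∈ ℂ{t}`,
  -- that is `π y ^ s` times a unit, while the powers `x_i ^ (k (s + 1))` force `π y ^ (s + 1)` to
  -- divide `z`. Then `π y` would be a unit.
  obtain ⟨b, hb0, hzb⟩ := IsAlgebraic.exists_nonzero_dvd (R := ConvSeries 1)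
    (Algebra.IsIntegral.isIntegral z).isAlgebraic (mem_nonZeroDivisors_of_ne_zero hz0)
  obtain ⟨s, u, hu, hbu⟩ := exists_paramHom_eq π hy hb0
  rw [hmap, hbu] at hzb
  have hdvd : π y ^ (s + 1) ∣ z := by
    rw [← Ideal.mem_span_singleton]
    refine (Ideal.span_le.mpr ?_ : Ideal.span _ ≤ _) (hz (k * (s + 1)))
    rintro _ ⟨i, rfl⟩
    beta_reduce
    rw [SetLike.mem_coe, Ideal.mem_span_singleton, pow_mul]
    exact pow_dvd_pow_of_dvd (map_dvd_map_X_pow hk i) _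
  have hYu : π y ∣ u := by
    have := hdvd.trans hzb
    rw [pow_succ] at this
    exact (mul_dvd_mul_iff_left (pow_ne_zero s hy0)).mp this
  exact not_isUnit_map hπ hy (isUnit_of_dvd_unit hYu hu)

end

end ConvSeries

/-! ### Extending characters along integral extensions. -/

/-- A character of `B` extends to integral extensions of `B`. -/
lemma exists_algHom_of_isIntegralElem {k A B D : Type*} [Field k] [IsAlgClosed k] [CommRing A]
    [CommRing B] [CommRing D] [Algebra k A] [Algebra k B] [Algebra k D]
    {θ : B →ₐ[k] D} (hθ : Function.Injective θ) (π : A →ₐ[k] D)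
    (hπ : ∀ a, (θ : B →+* D).IsIntegralElem (π a)) (ε : B →ₐ[k] k) :
    ∃ χ : A →ₐ[k] k, ∀ a b, π a = θ b → χ a = ε b := by
  let _ : Algebra B D := RingHom.toAlgebra θ
  have : IsScalarTower k B D := IsScalarTower.of_algebraMap_eq fun c => (θ.commutes c).symm
  let S := integralClosure B D
  let ι : A →ₐ[k] S := AlgHom.codRestrict π (S.restrictScalars k) hπ
  have := RingHom.ker_isPrime ε
  -- Lying over for the kernel of `ε`. The quotient by `P` is a domain integral over the
  -- algebraically closed field `k`, hence equal to `k`.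
  obtain ⟨P, -, hP, hPε⟩ := Ideal.exists_ideal_over_prime_of_isIntegral (S := S)
    (RingHom.ker ε) ⊥ (by
      intro b hb
      have hb0 : algebraMap B S b = 0 := hb
      have : θ b = 0 := congrArg Subtype.val hb0
      rw [(map_eq_zero_iff θ hθ).mp this]
      exact zero_mem _)
  have hker : ∀ b, algebraMap B S b ∈ P ↔ ε b = 0 := fun b => by
    rw [← RingHom.mem_ker, ← hPε, Ideal.mem_comap]
  let q := Ideal.Quotient.mkₐ k P
  have hq : ∀ b, q (algebraMap B S b) = algebraMap k (S ⧸ P) (ε b) := by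
    intro b
    have h1 : algebraMap B S (b - algebraMap k B (ε b)) ∈ P := (hker _).mpr (by simp)
    have h2 := Ideal.Quotient.eq_zero_iff_mem.mpr h1
    rw [map_sub, map_sub, sub_eq_zero, ← IsScalarTower.algebraMap_apply k B S] at h2
    exact h2.trans (q.commutes _)
  have hdom : IsDomain (S ⧸ P) := Ideal.Quotient.isDomain P
  have : Algebra.IsIntegral k (S ⧸ P) := by
    refine ⟨fun z => ?_⟩
    obtain ⟨z, rfl⟩ := Ideal.Quotient.mkₐ_surjective k P z
    have h1 : ((q : S →+* S ⧸ P).comp (algebraMap B S)).IsIntegralElem (q z) :=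
      (Algebra.IsIntegral.isIntegral (R := B) z).map_of_comp_eq (RingHom.id B) (q : S →+* S ⧸ P) rfl
    have h2 : (q : S →+* S ⧸ P).comp (algebraMap B S) =
        (algebraMap k (S ⧸ P)).comp (ε : B →+* k) := RingHom.ext hq
    rw [h2] at h1
    exact h1.of_comp
  let e : k ≃ₐ[k] S ⧸ P := AlgEquiv.ofBijective (Algebra.ofId k (S ⧸ P))
    IsAlgClosed.algebraMap_bijective_of_isIntegral
  refine ⟨(e.symm : (S ⧸ P) →ₐ[k] k).comp (q.comp ι), fun a b hab => ?_⟩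
  have h1 : ι a = algebraMap B S b := Subtype.ext hab
  change e.symm (q (ι a)) = ε b
  rw [h1, hq, AlgEquiv.symm_apply_eq]
  rfl

/-- A character of `B` extends to an algebra that is spanned by finitely many elements over `B`. -/
lemma exists_algHom_of_eq_sum_mul {k A B D ι : Type*} [Field k] [IsAlgClosed k] [CommRing A]
    [CommRing B] [CommRing D] [IsDomain D] [Algebra k A] [Algebra k B] [Algebra k D] [Fintype ι]
    {θ : B →ₐ[k] D} (hθ : Function.Injective θ) (π : A →ₐ[k] D) (v : ι → A)
    (hv : ∀ a, ∃ b : ι → B, π a = ∑ i, θ (b i) * π (v i)) (ε : B →ₐ[k] k) :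
    ∃ χ : A →ₐ[k] k, ∀ a b, π a = θ b → χ a = ε b := by
  refine exists_algHom_of_isIntegralElem hθ π (fun a => ?_) ε
  let _ : Algebra B D := RingHom.toAlgebra θ
  let M : Submodule B D := Submodule.span B (Set.range fun i => π (v i))
  have hM : ∀ a, π a ∈ M := by
    intro a
    obtain ⟨b, hb⟩ := hv a
    rw [hb]
    exact Submodule.sum_mem _ fun i _ => Submodule.smul_mem _ (b i) (Submodule.subset_span ⟨i, rfl⟩)
  -- The determinant trick. The finitely generated module `M` contains the image of `A`, so
  -- multiplication by `π a` sends its generators back into `M`.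
  refine isIntegral_of_smul_mem_submodule M ?_ (Submodule.fg_span (Set.finite_range _)) (π a) ?_
  · intro hbot
    have := hM 1
    rw [hbot, Submodule.mem_bot, map_one] at this
    exact one_ne_zero this
  · intro u hu
    induction hu using Submodule.span_induction with
    | mem u hu =>
      obtain ⟨i, rfl⟩ := hu
      rw [smul_eq_mul, ← map_mul]
      exact hM _
    | zero => rw [smul_zero]; exact zero_mem _
    | add u u' _ _ hu hu' => rw [smul_add]; exact add_mem hu hu'
    | smul b u _ hu => rw [smul_comm]; exact Submodule.smul_mem _ _ hu

/-- A version of `exists_algHom_of_eq_sum_mul` for subalgebras. -/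
lemma Subalgebra.exists_algHom_of_eq_sum_mul {k R R' D ι : Type*} [Field k] [IsAlgClosed k]
    [CommRing R] [CommRing R'] [CommRing D] [IsDomain D] [Algebra k R] [Algebra k R']
    [Algebra k D] [Fintype ι] (A : Subalgebra k R) (B : Subalgebra k R') {θ : R' →ₐ[k] D}
    (hθ : Function.Injective θ) (π : R →ₐ[k] D) (v : ι → A)
    (hv : ∀ a ∈ A, ∃ b : ι → B, π a = ∑ i, θ (b i) * π (v i)) (ε : B →ₐ[k] k) :
    ∃ χ : A →ₐ[k] k, ∀ (a : A) (b : B), π a = θ b → χ a = ε b :=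
  _root_.exists_algHom_of_eq_sum_mul (θ := θ.comp B.val) (hθ.comp Subtype.val_injective)
    (π.comp A.val) v (fun a => hv a.1 a.2) ε

/-! ### Characters of polydisc algebras, and points of the vanishing locus. -/

namespace ConvSeries

open ConvergentSeries MvPowerSeries

variable {n : ℕ}

/-- The algebra of power series that converge absolutely on the polydisc of radius `r`. -/
def polydiscAlgebra (n : ℕ) (r : ℝ≥0∞) : Subalgebra ℂ (ConvSeries n) where
  carrier := {f | polyNorm (fun _ => r) (f : MvPowerSeries (Fin n) ℂ) < ⊤}
  mul_mem' hf hg := (polyNorm_mul_le _ _ _).trans_lt (ENNReal.mul_lt_top hf hg)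
  add_mem' hf hg := (polyNorm_add_le _ _ _).trans_lt (ENNReal.add_lt_top.mpr ⟨hf, hg⟩)
  algebraMap_mem' c := by
    change polyNorm _ (algebraMap ℂ (MvPowerSeries (Fin n) ℂ) c) < ⊤
    rw [MvPowerSeries.algebraMap_apply, polyNorm_C]
    exact enorm_lt_top

lemma mem_polydiscAlgebra {r : ℝ≥0∞} {f : ConvSeries n} :
    f ∈ polydiscAlgebra n r ↔ polyNorm (fun _ => r) (f : MvPowerSeries (Fin n) ℂ) < ⊤ := Iff.rfl

lemma mono_mem_polydiscAlgebra {r : ℝ≥0∞} (hr : r < ⊤) (d : Fin n →₀ ℕ) :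
    mono d ∈ polydiscAlgebra n r := by
  change polyNorm _ (monomial d 1) < ⊤
  rw [polyNorm_monomial, enorm_one, one_mul]
  exact ENNReal.prod_lt_top fun i _ => ENNReal.pow_lt_top hr

/-- Evaluation of power series at a point of the polydisc of radius `r`. -/
def evalHom {r : ℝ≥0∞} {z : Fin n → ℂ} (hz : ∀ i, ‖z i‖ₑ ≤ r) : polydiscAlgebra n r →ₐ[ℂ] ℂ :=
  AlgHom.ofLinearMap
    { toFun := fun f => eval f.1 z
      map_add' := fun f g => by
        rw [eval, eval, eval, ← (summable_norm_term f.2 hz).of_norm.tsum_add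
          (summable_norm_term g.2 hz).of_norm]
        exact tsum_congr fun d => by simp [term, add_mul]
      map_smul' := fun c f => by
        rw [eval, eval, RingHom.id_apply, smul_eq_mul, ← tsum_mul_left]
        exact tsum_congr fun d => by simp [term, mul_assoc] }
    (by
      change ∑' d, term (1 : MvPowerSeries (Fin n) ℂ) z d = 1
      classical
      rw [tsum_eq_single 0]
      · simp [term]
      · intro d hd
        simp [term, MvPowerSeries.coeff_one, hd])
    fun f g => by
      change ∑' d, term ((f.1 : MvPowerSeries (Fin n) ℂ) * (g.1 : MvPowerSeries (Fin n) ℂ)) z d = eval f.1 z * eval g.1 z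
      have hf := summable_norm_term f.2 hz
      have hg := summable_norm_term g.2 hz
      rw [eval, eval, hf.of_norm.tsum_mul_tsum_eq_tsum_sum_antidiagonal hg.of_norm
        (summable_mul_of_summable_norm hf hg)]
      exact tsum_congr fun d => term_mul _ _ _ _

lemma evalHom_apply {r : ℝ≥0∞} {z : Fin n → ℂ} (hz : ∀ i, ‖z i‖ₑ ≤ r)
    (f : polydiscAlgebra n r) : evalHom hz f = eval f.1 z := rfl

lemma eval_mono (d : Fin n →₀ ℕ) (z : Fin n → ℂ) : eval (mono d) z = ∏ i, z i ^ d i := by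
  classical
  change ∑' e, term (monomial d (1 : ℂ)) z e = _
  rw [tsum_eq_single d]
  · simp [term]
  · intro e he
    rw [term, MvPowerSeries.coeff_monomial_ne he, zero_mul]

lemma eval_zero (f : ConvSeries n) :
    eval f 0 = constantCoeff (f : MvPowerSeries (Fin n) ℂ) := by
  rw [eval, tsum_eq_single 0]
  · simp [term]
  · intro d hd
    obtain ⟨i, hi⟩ := Finsupp.ne_iff.mp hd
    rw [term, Finset.prod_eq_zero (Finset.mem_univ i), mul_zero]
    simpa using hi

section character

variable {r : ℝ≥0∞} (χ : polydiscAlgebra n r →ₐ[ℂ] ℂ)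

/-- Otherwise `χ h - h` would be invertible in the algebra of the polydisc, although `χ` sends it to
zero. -/
lemma enorm_character_le (hr : 0 < r) (h : polydiscAlgebra n r) :
    ‖χ h‖ₑ ≤ polyNorm (fun _ => r) (h.1 : MvPowerSeries (Fin n) ℂ) := by
  classical
  by_contra! hlt
  set H := (h.1 : MvPowerSeries (Fin n) ℂ)
  set c₀ := constantCoeff H
  have hone : ∀ i : Fin n, 0 < (fun _ => 1 : Fin n → ℕ) i := fun _ => one_pos
  -- The constant term is split off because the formal Neumann series requires a perturbation
  -- without constant term.
  have hsplit : ‖c₀‖ₑ + polyNorm (fun _ => r) (H - C c₀) ≤ polyNorm (fun _ => r) H := by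
    rw [polyNorm, polyNorm, ENNReal.tsum_eq_add_tsum_ite
      (f := fun d : Fin n →₀ ℕ => ‖MvPowerSeries.coeff d H‖ₑ * _) 0]
    gcongr with d
    · simp [c₀]
    · split_ifs with hd
      · simp [hd, c₀]
      · simp [MvPowerSeries.coeff_C, hd]
  have hnorm : polyNorm (fun _ => r) (H - C c₀) < ‖χ h - c₀‖ₑ := by
    have h1 : ‖χ h‖ₑ ≤ ‖χ h - c₀‖ₑ + ‖c₀‖ₑ := by
      simpa using enorm_add_le (χ h - c₀) c₀
    have h2 := (hsplit.trans_lt hlt).trans_le h1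
    rw [add_comm] at h2
    exact lt_of_add_lt_add_right h2
  obtain ⟨z, hz, hzn⟩ := exists_inverse_polyNorm_lt_top (fun _ => r) (w := fun _ => 1)
    ((mem_weightIdeal_one_iff hone).mpr (by simp [c₀])) hnorm
  have hzc : z ∈ ConvSeries n := (mem_iff_converges hone).mpr (Converges.of_radius hr (by
    have : radius (fun _ : Fin n => 1) r = fun _ => r := funext fun _ => pow_one r
    rwa [this]))
  obtain ⟨z', hz'⟩ : ∃ z' : polydiscAlgebra n r, (z'.1 : MvPowerSeries (Fin n) ℂ) = z :=
    ⟨⟨⟨z, hzc⟩, mem_polydiscAlgebra.mpr hzn⟩, rfl⟩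
  have h3 : algebraMap ℂ _ (χ h) * z' = 1 + h * z' := by
    refine Subtype.ext (Subtype.ext ?_)
    change algebraMap ℂ (MvPowerSeries (Fin n) ℂ) (χ h) * (z'.1 : MvPowerSeries (Fin n) ℂ) =
      1 + H * (z'.1 : MvPowerSeries (Fin n) ℂ)
    rw [hz', ← hz, MvPowerSeries.algebraMap_apply, map_sub]
    simp only [Algebra.algebraMap_self, RingHom.id_apply]
    ring
  have h4 := congrArg χ h3
  rw [map_mul, AlgHom.commutes, map_add, map_mul, map_one] at h4
  simp at h4

/-- Every character of the algebra of a polydisc is the evaluation at a point. -/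
lemma exists_eval_eq_character (hr0 : 0 < r) (hr : r < ⊤) :
    ∃ ξ : Fin n → ℂ, (∀ i, ‖ξ i‖ₑ ≤ r) ∧ ∀ h, χ h = eval h.1 ξ := by
  classical
  let x : Fin n → polydiscAlgebra n r := fun i => ⟨X i, mono_mem_polydiscAlgebra hr _⟩
  let m : (Fin n →₀ ℕ) → polydiscAlgebra n r := fun d => ⟨mono d, mono_mem_polydiscAlgebra hr d⟩
  have hξ : ∀ i, ‖χ (x i)‖ₑ ≤ r := fun i => by
    refine (enorm_character_le χ hr0 (x i)).trans_eq ?_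
    change polyNorm _ ((X i : ConvSeries n) : MvPowerSeries (Fin n) ℂ) = r
    rw [coe_X, polyNorm_X]
  refine ⟨fun i => χ (x i), hξ, fun h => ?_⟩
  have hm : ∀ d, χ (m d) = ∏ i, χ (x i) ^ d i := by
    intro d
    have : m d = ∏ i, x i ^ d i := by
      refine Subtype.ext (Subtype.ext ?_)
      push_cast
      change monomial d (1 : ℂ) = ∏ i, ((X i : ConvSeries n) : MvPowerSeries (Fin n) ℂ) ^ d i
      simp only [coe_X]
      rw [MvPowerSeries.monomial_one_eq, Finsupp.prod_fintype _ _ fun i => pow_zero _]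
    rw [this, map_prod]
    simp only [map_pow]
  have hH : polyNorm (fun _ => r) (h.1 : MvPowerSeries (Fin n) ℂ) < ⊤ := h.2
  set H := (h.1 : MvPowerSeries (Fin n) ℂ)
  symm
  refine HasSum.tsum_eq ?_
  -- On polynomials `χ` is evaluation at `ξ`. By the norm bound, the error for a partial sum of `h`
  -- is at most the tail of the `ℓ¹` norm.
  rw [HasSum, tendsto_iff_edist_tendsto_0]
  refine tendsto_of_tendsto_of_tendsto_of_le_of_le tendsto_const_nhds
    (ENNReal.tendsto_tsum_compl_atTop_zero hH.ne) (fun _ => zero_le) fun s => ?_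
  have h1 : ∑ d ∈ s, term H (fun i => χ (x i)) d = χ (∑ d ∈ s, MvPowerSeries.coeff d H • m d) := by
    rw [map_sum]
    refine Finset.sum_congr rfl fun d _ => ?_
    rw [map_smul, hm, smul_eq_mul, term]
  rw [h1, edist_comm, edist_eq_enorm_sub, ← map_sub]
  refine (enorm_character_le χ hr0 _).trans ?_
  refine (ENNReal.tsum_le_tsum fun d => ?_).trans_eq (tsum_subtype {d | d ∉ s} fun d =>
    ‖MvPowerSeries.coeff d H‖ₑ * ∏ i : Fin n, r ^ d i).symm
  have h2 : ((h - ∑ e ∈ s, MvPowerSeries.coeff e H • m e : polydiscAlgebra n r).1 :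
      MvPowerSeries (Fin n) ℂ) = H - ∑ e ∈ s, monomial e (MvPowerSeries.coeff e H) := by
    push_cast
    congr 1
    refine Finset.sum_congr rfl fun e _ => ?_
    change MvPowerSeries.coeff e H • monomial e (1 : ℂ) = _
    rw [← map_smul, smul_eq_mul, mul_one]
  rw [h2, map_sub, map_sum]
  simp only [MvPowerSeries.coeff_monomial, Finset.sum_ite_eq]
  by_cases hd : d ∈ s <;> simp [hd]

end character

section

variable {D : Type*} [CommRing D] [IsDomain D] [Algebra ℂ D] {π : ConvSeries n →ₐ[ℂ] D}
  {y : ConvSeries n} {k : ℕ}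

/-- Evaluation at `t` on the one-variable disc extends along the finite expansion. The resulting
character kills the elements of `ker π` in the polydisc algebra, and takes the value `t` at `y` when
`y` lies there. -/
lemma exists_character (hy : constantCoeff (y : MvPowerSeries (Fin n) ℂ) = 0) (hy0 : π y ≠ 0)
    {r s : ℝ≥0∞} (hr : r < ⊤) (hs : s < ⊤) (hexp : ∀ h ∈ polydiscAlgebra n r,
      ∃ a : (Fin n → Fin k) → ConvSeries 1, (∀ d, a d ∈ polydiscAlgebra 1 s) ∧
        π h = ∑ d, paramHom π hy (a d) * π (mono (boxExponent d))) {t : ℂ} (ht : ‖t‖ₑ ≤ s) :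
    ∃ χ : polydiscAlgebra n r →ₐ[ℂ] ℂ, ∀ h, (π h.1 = 0 → χ h = 0) ∧ (π h.1 = π y → χ h = t) := by
  obtain ⟨χ, hχ⟩ := Subalgebra.exists_algHom_of_eq_sum_mul (polydiscAlgebra n r)
    (polydiscAlgebra 1 s) (paramHom_injective π hy hy0) π
    (fun d => ⟨mono (boxExponent d), mono_mem_polydiscAlgebra hr _⟩) (fun h hh => by
      obtain ⟨a, ha, hh⟩ := hexp h hh
      exact ⟨fun d => ⟨a d, ha d⟩, hh⟩) (evalHom (z := fun _ => t) fun _ => ht)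
  refine ⟨χ, fun h => ⟨fun hh => ?_, fun hh => ?_⟩⟩
  · rw [hχ h 0 (hh.trans (map_zero _).symm), map_zero]
  · rw [hχ h ⟨X 0, mono_mem_polydiscAlgebra hs _⟩ (hh.trans (paramHom_X π hy).symm),
      evalHom_apply]
    exact (eval_mono _ _).trans (by simp)

/-- The vanishing locus of the kernel of a homomorphism from `ℂ{x}` to a domain that has a
parameter contains points other than the origin. -/
lemma eventually_exists_eval_eq_zero (hy : constantCoeff (y : MvPowerSeries (Fin n) ℂ) = 0)
    (hy0 : π y ≠ 0) (hk : ∀ i, X i ^ k ∈ RingHom.ker π ⊔ Ideal.span {y}) :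
    ∀ᶠ r in 𝓝[>] (0 : ℝ≥0∞), ∃ ξ : Fin n → ℂ, ξ ≠ 0 ∧ (∀ i, ‖ξ i‖ₑ ≤ r) ∧
      ∀ h, π h = 0 → polyNorm (fun _ => r) (h : MvPowerSeries (Fin n) ℂ) < ⊤ → eval h ξ = 0 := by
  have hone : ∀ i : Fin n, 0 < (fun _ => 1 : Fin n → ℕ) i := fun _ => one_pos
  filter_upwards [exists_expansion hy hk, converges hone y, self_mem_nhdsWithin,
    eventually_le_nhdsGT_zero one_pos] with r hexp hyr hr0 hr1
  have hr : r < ⊤ := hr1.trans_lt ENNReal.one_lt_top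
  replace hyr : y ∈ polydiscAlgebra n r := by
    have : radius (fun _ : Fin n => 1) r = fun _ => r := funext fun _ => pow_one r
    rwa [this] at hyr
  obtain ⟨s, hs0, hs⟩ := hexp
  -- The minimum with one keeps the radius of the disc finite. Since `t ≠ 0` is the value of `y` at
  -- `ξ` and `y` vanishes at the origin, `ξ ≠ 0`.
  obtain ⟨t, ht0, hts⟩ : ∃ t : ℂ, t ≠ 0 ∧ ‖t‖ₑ ≤ min s 1 := by
    obtain ⟨t, ht0, hts⟩ := ENNReal.lt_iff_exists_nnreal_btwn.mp (lt_min hs0 one_pos)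
    refine ⟨(t : ℝ), ?_, ?_⟩
    · simpa using (ENNReal.coe_pos.mp ht0).ne'
    · rw [← ofReal_norm, Complex.norm_real, ← NNReal.val_eq_coe]
      simpa using hts.le
  obtain ⟨χ, hχ⟩ := exists_character hy hy0 hr ((min_le_right s 1).trans_lt ENNReal.one_lt_top)
    (fun h hh => by
      obtain ⟨b, hb, hbh⟩ := hs h hh
      rw [RingHom.mem_ker, map_sub, map_sum, sub_eq_zero] at hbh
      exact ⟨b, fun d => (polyNorm_mono_radius (fun _ => min_le_left _ _) _).trans_lt (hb d),
        hbh.trans (Finset.sum_congr rfl fun d _ => map_mul π _ _)⟩) hts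
  obtain ⟨ξ, hξr, hξ⟩ := exists_eval_eq_character χ hr0 hr
  refine ⟨ξ, ?_, hξr, fun h hh hhr => ?_⟩
  · rintro rfl
    have h1 := (hχ ⟨y, hyr⟩).2 rfl
    rw [hξ, eval_zero, hy] at h1
    exact ht0 h1.symm
  · have h1 := (hχ ⟨h, hhr⟩).1 hh
    rwa [hξ] at h1

end

/-- The Jacobian ideal of an isolated singularity contains a power of the ideal of the origin. -/
lemma exists_X_pow_mem_jacobianIdeal {f : ConvSeries n} (hf : DefinesIsolatedSingularity f) :
    ∃ k, ∀ i, X i ^ k ∈ jacobianIdeal f := by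
  by_contra! hI
  obtain ⟨Q, hfQ, hQ, hXQ, hparam⟩ := exists_isPrime_of_X_pow_notMem hI
  obtain ⟨D, _, _, _, π, hπ, hker⟩ := exists_algHom_ker_eq Q
  have hmem : ∀ {h}, h ∈ Q ↔ π h = 0 := fun {h} => by rw [← hker, RingHom.mem_ker]
  rw [← hker] at hparam
  have hder : ∀ i, π (partialDeriv i f) = 0 := fun i =>
    hmem.mp (hfQ (Ideal.subset_span ⟨i, rfl⟩))
  have hf0 : constantCoeff (f : MvPowerSeries (Fin n) ℂ) = 0 := by
    rw [← eval_zero]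
    exact hf.1
  -- Otherwise `f` is a parameter all of whose partial derivatives vanish in `D`. This is the step
  -- that deduces the vanishing of `f` from that of its derivatives.
  have hfπ : π f = 0 := by
    by_contra hne
    obtain ⟨k, hk⟩ := hparam f hne
    obtain ⟨i, hi⟩ := exists_map_partialDeriv_ne_zero hπ hf0 hne hk
    exact hi (hder i)
  obtain ⟨i, hi⟩ := hXQ 1
  rw [pow_one, hmem] at hi
  obtain ⟨k, hk⟩ := hparam (X i) hi
  have hone : ∀ i : Fin n, 0 < (fun _ => 1 : Fin n → ℕ) i := fun _ => one_pos
  have hpts := eventually_exists_eval_eq_zero (by rw [coe_X]; simp) hi hk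
  obtain ⟨ε, hε, hiso⟩ := Metric.eventually_nhds_iff.mp (eventually_nhdsWithin_iff.mp hf.2)
  have hradius : ∀ r, radius (fun _ : Fin n => 1) r = fun _ => r := fun r =>
    funext fun _ => pow_one r
  -- One radius small enough for the neighbourhood of isolation and for the norms of `f` and its
  -- derivatives yields a forbidden common zero.
  obtain ⟨r, ⟨ξ, hξ0, hξr, hξ⟩, hrε, hrf, hrd⟩ := (hpts.and
    ((eventually_le_nhdsGT_zero (ENNReal.ofReal_pos.mpr (half_pos hε))).and
      ((converges hone f).and (eventually_all.mpr fun i =>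
        converges hone (partialDeriv i f))))).exists
  rw [hradius] at hrf
  simp only [hradius] at hrd
  obtain ⟨j, hj⟩ := hiso (y := ξ) (by
    rw [dist_pi_lt_iff hε]
    intro i
    rw [Pi.zero_apply, dist_zero_right]
    have := (hξr i).trans hrε
    rw [← ofReal_norm, ENNReal.ofReal_le_ofReal_iff (half_pos hε).le] at this
    linarith) hξ0 (hξ f hfπ hrf)
  exact hj (hξ _ (hder j) (hrd j))

end ConvSeries

end

theorem mainTheorem10 (n : ℕ) (hn : 0 < n) (w : Fin n → ℕ) (hw : ∀ i, 0 < w i)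
    (f : ConvSeries n) (hf : ConvSeries.DefinesIsolatedSingularity f)
    (S : Set (Fin n →₀ ℕ))
    (hS : ConvSeries.IsMonomialSpanningSet (ConvSeries.initialPart w f) S) :
    ∃ (Ψ : ConvSeries n ≃ₐ[ℂ] ConvSeries n) (g : Fin n → ConvSeries n),
      (∀ i, Ψ (ConvSeries.X i) = ConvSeries.X i + g i) ∧
      (∀ i, g i = 0 ∨ ConvSeries.wt w (ConvSeries.X i) < ConvSeries.wt w (g i)) ∧
      ∀ d : Fin n →₀ ℕ,
        ConvSeries.wt w (ConvSeries.initialPart w f) < (Finsupp.weight w d : ℕ) →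
        d ∉ S → ConvSeries.coeff d (Ψ f) = 0 := by
  obtain ⟨k, hk⟩ := ConvSeries.exists_X_pow_mem_jacobianIdeal hf
  refine ConvSeries.exists_normal_form hw ?_ hk hS
  -- If `f = 0` then `j(f) = 0` would contain a power of `x₁`, which exists since `n > 0`. In a
  -- domain this forces `x₁ = 0`, against `∂x₁/∂x₁ = 1`.
  rintro rfl
  have hbot : ConvSeries.jacobianIdeal (0 : ConvSeries n) ≤ ⊥ := by
    refine Ideal.span_le.mpr ?_
    rintro _ ⟨i, rfl⟩
    exact map_zero (ConvSeries.partialDerivation i)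
  have hX : (ConvSeries.X (⟨0, hn⟩ : Fin n) : ConvSeries n) ^ k = 0 := hbot (hk _)
  have hd := ConvSeries.partialDeriv_X (⟨0, hn⟩ : Fin n) ⟨0, hn⟩
  rw [if_pos rfl, eq_zero_of_pow_eq_zero hX] at hd
  exact zero_ne_one ((map_zero (ConvSeries.partialDerivation _)).symm.trans hd)
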